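/- **Theorem (completeness of the Bethe ansatz).** Let $k\ge 0$, $n\ge 1$, let $t$ be an indeterminate, and let $\Bbbk=\mathbb{C}\{\!\{t\}\!\}=\bigcup_{m\ge1}\mathbb{C}((t^{1/m}))$ be the field of Puiseux series, with the conjugation $f\mapsto\bar f$ that conjugates the coefficients and fixes $t$. Let $\mathcal{A}^+_{k,n}$ be the set of partitions $\lambda=(\lambda_1,\dots,\lambda_k)$ with $n\ge\lambda_1\ge\cdots\ge\lambda_k\ge1$, and let $m_i(\lambda)$ be the multiplicity of the part $i$ in $\lambda$. A *Bethe solution* is a tuple $y\in\Bbbk^k$ of non-zero, pairwise distinct elements with $$y_i^n\prod_{j\ne i}\frac{y_i-t y_j}{y_i-y_j}=\prod_{j\ne i}\frac{t y_i-y_j}{y_i-y_j},\qquad i=1,\dots,k;$$ Bethe solutions that differ by a permutation of the $y_i$ are identified. *Fock space.* Let $\mathcal{F}^{\otimes n}$ be the $\Bbbk$-vector space with basis $|m_1,\dots,m_n\rangle$, $m_i\in\mathbb{Z}_{\ge0}$, with the operators $\beta_i^*|\dots,m_i,\dots\rangle=(1-t^{m_i+1})|\dots,m_i+1,\dots\rangle$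 and $\beta_i|\dots,m_i,\dots\rangle=|\dots,m_i-1,\dots\rangle$ ($=0$ if $m_i=0$), and with the scalar product, antilinear in the first factor, for which this basis is orthogonal and $\langle m_1,\dots,m_n|m_1,\dots,m_n\rangle=\prod_i 1/(t)_{m_i}$, where $(t)_r=\prod_{s=1}^r(1-t^s)$. Put $|\lambda\rangle=|m_1(\lambda),\dots,m_n(\lambda)\rangle$ and let $\mathcal{F}_k^{\otimes n}$ be the span of the $|\lambda\rangle$, $\lambda\in\mathcal{A}^+_{k,n}$. Let $$L_i(u)=\begin{pmatrix}1&u\beta_i^*\\ \beta_i&u\end{pmatrix},\qquad L_n(u)\cdots L_1(u)=\begin{pmatrix}A(u)&B(u)\\C(u)&D(u)\end{pmatrix},\qquad \boldsymbol{E}(u)=A(u)+D(u),$$ and let $\mathfrak{b}(y)=B(y_1^{-1})\cdots B(y_k^{-1})|0,\dots,0\rangle$ be the Bethe vector of $y$. Let $Q_\lambda(x;t)$ and $P_\lambda(x;t)$ be the Hall–Littlewood functions. *Polynomials.* In $\Bbbk[e_1,\dots,e_k]$ put $e_0=1$, $e_r=0$ for $r>k$, and define $g_r(s)$ by $\sum_{r\ge0}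 g_r(s)u^r=\frac{\sum_r(-s)^re_ru^r}{\sum_r(-1)^re_ru^r}$. Let $I_{k,n}$ be the ideal generated by $g_n(t)-(1-t^k)$ (for $k\ge1$) and by $g_{n+r}(t)+t^kg_r(t^{-1})$ for $0<r<k$, and let $V_{k,n}\subset\Bbbk^k$ be its zero locus. Then: 1. There is a bijection $\sigma\mapsto y_\sigma$ from $\mathcal{A}^+_{k,n}$ to the set of Bethe solutions up to permutation. Moreover $V_{k,n}$ is the set of points $(e_1(y),\dots,e_k(y))$, $y$ a Bethe solution; its vanishing ideal is $I_{k,n}$; $I_{k,n}$ is radical; and $\Bbbk[e_1,\dots,e_k]/I_{k,n}$ is finite-dimensional of dimension $|\mathcal{A}^+_{k,n}|$. 2. For every such bijection (with any choice of representatives $y_\sigma$) put $\mathfrak{b}_\sigma=\mathfrak{b}(y_\sigma)$. Then $\mathfrak{b}_\sigma=\sum_{\lambda\in\mathcal{A}^+_{k,n}}Q_\lambda(y_\sigma^{-1};t)|\lambda\rangle$, the vectors $\mathfrak{b}_\sigma$, $\sigma\in\mathcal{A}^+_{k,n}$, form a basis of $\mathcal{F}_k^{\otimes n}$, and for all $\rho,\sigma$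 $$\langle\mathfrak{b}_\rho|\mathfrak{b}_\sigma\rangle=\sum_{\lambda\in\mathcal{A}^+_{k,n}}Q_\lambda(y_\rho;t)P_\lambda(\bar y_\sigma;t),$$ which is $0$ for $\rho\ne\sigma$. Each $\mathfrak{b}_\sigma$ is an eigenvector of $\boldsymbol{E}(u)$ for every $u\in\Bbbk$, and, writing $y=y_\sigma$, if $1-uy_i\ne0$ for all $i$, then the eigenvalue is $$\prod_{i=1}^k\frac{1-uty_i}{1-uy_i}+t^ku^n\prod_{i=1}^k\frac{1-ut^{-1}y_i}{1-uy_i}.$$ -/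

import Mathlib

noncomputable section

namespace QBoson

/-! ### The field of Puiseux series `⋃ₘ ℂ((t^{1/m}))` -/

/-- The embedding of `ℂ((s))` into the Hahn series over `ℚ` that sends `s` to `t^{1/m}`,
that is `∑ c_l s^l ↦ ∑ c_l t^{l/m}`. -/
def laurentRoot (m : ℕ+) : LaurentSeries ℂ →+* HahnSeries ℚ ℂ :=
  HahnSeries.embDomainRingHom
    ((AddMonoidHom.mulRight ((m : ℚ)⁻¹)).comp (Int.castAddHom ℚ))
    (fun a b h => by
      have hm : ((m : ℚ)⁻¹) ≠ 0 := inv_ne_zero (by exact_mod_cast m.ne_zero)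
      simpa [hm] using h)
    (fun a b => by
      have hm : (0 : ℚ) < ((m : ℚ)⁻¹) := inv_pos.mpr (by exact_mod_cast m.pos)
      simp [hm])

theorem laurentRoot_coeff (m : ℕ+) (f : LaurentSeries ℂ) (l : ℤ) :
    (laurentRoot m f).coeff ((l : ℚ) * (m : ℚ)⁻¹) = f.coeff l := by
  unfold laurentRoot
  exact HahnSeries.embDomain_coeff (a := l)

theorem laurentRoot_coeff_of_notMem (m : ℕ+) (f : LaurentSeries ℂ) (q : ℚ)
    (hq : ∀ l : ℤ, (l : ℚ) * (m : ℚ)⁻¹ ≠ q) : (laurentRoot m f).coeff q = 0 := by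
  unfold laurentRoot
  refine HahnSeries.embDomain_notin_image_support ?_
  rintro ⟨l, -, hl⟩
  exact hq l hl

/-- An element of `ℂ((t^{1/m}))` is a Hahn series with exponents in `(1/m)ℤ`. -/
theorem mem_range_laurentRoot (m : ℕ+) (f : HahnSeries ℚ ℂ) :
    f ∈ (laurentRoot m).range ↔ ∀ q ∈ f.support, ∃ l : ℤ, (l : ℚ) * (m : ℚ)⁻¹ = q := by
  constructor
  · rintro ⟨g, rfl⟩ q hq
    by_contra h
    push Not at h
    exact hq (laurentRoot_coeff_of_notMem m g q h)
  · intro h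
    have hm : (0 : ℚ) < ((m : ℚ)⁻¹) := inv_pos.mpr (by exact_mod_cast m.pos)
    let e : ℤ ↪o ℚ := OrderEmbedding.ofMapLEIff (fun l : ℤ => (l : ℚ) * (m : ℚ)⁻¹)
      (fun a b => by simp [hm])
    have hpwo : (Function.support fun l : ℤ => f.coeff ((l : ℚ) * (m : ℚ)⁻¹)).IsPWO := by
      have h1 : (e '' (Function.support fun l : ℤ => f.coeff ((l : ℚ) * (m : ℚ)⁻¹))).IsPWO := by
        refine f.isPWO_support.mono ?_
        rintro _ ⟨l, hl, rfl⟩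
        exact hl
      intro u
      obtain ⟨a, b, hab, hle⟩ := h1 (fun i => ⟨e (u i).1, (u i).1, (u i).2, rfl⟩)
      exact ⟨a, b, hab, e.le_iff_le.mp hle⟩
    refine ⟨⟨fun l : ℤ => f.coeff ((l : ℚ) * (m : ℚ)⁻¹), hpwo⟩, ?_⟩
    ext q
    by_cases hq : ∃ l : ℤ, (l : ℚ) * (m : ℚ)⁻¹ = q
    · obtain ⟨l, rfl⟩ := hq
      rw [laurentRoot_coeff]
    · have h0 : f.coeff q = 0 := by
        by_contra hne
        exact hq (h q hne)
      rw [h0]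
      push Not at hq
      exact laurentRoot_coeff_of_notMem m _ q hq

theorem range_laurentRoot_le (m m' : ℕ+) :
    (laurentRoot m).range ≤ (laurentRoot (m * m')).range := by
  intro f hf
  rw [mem_range_laurentRoot] at hf ⊢
  intro q hq
  obtain ⟨l, rfl⟩ := hf q hq
  refine ⟨l * (m' : ℕ), ?_⟩
  have h1 : (m : ℚ) ≠ 0 := by exact_mod_cast m.ne_zero
  have h2 : (m' : ℚ) ≠ 0 := by exact_mod_cast m'.ne_zero
  push_cast
  field_simp

theorem range_laurentRoot_le' (m m' : ℕ+) :
    (laurentRoot m').range ≤ (laurentRoot (m * m')).range := by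
  rw [mul_comm]
  exact range_laurentRoot_le m' m

/-- The field of Puiseux series over `ℂ`: the union over `m ≥ 1` of the fields
`ℂ((t^{1/m}))` of formal Laurent series in `t^{1/m}`. -/
def puiseuxSubfield : Subfield (HahnSeries ℚ ℂ) where
  carrier := {f | ∃ m : ℕ+, f ∈ (laurentRoot m).range}
  zero_mem' := ⟨1, zero_mem _⟩
  one_mem' := ⟨1, one_mem _⟩
  add_mem' := by
    rintro f g ⟨m, hf⟩ ⟨m', hg⟩
    exact ⟨m * m', add_mem (range_laurentRoot_le m m' hf) (range_laurentRoot_le' m m' hg)⟩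
  mul_mem' := by
    rintro f g ⟨m, hf⟩ ⟨m', hg⟩
    exact ⟨m * m', mul_mem (range_laurentRoot_le m m' hf) (range_laurentRoot_le' m m' hg)⟩
  neg_mem' := by
    rintro f ⟨m, hf⟩
    exact ⟨m, neg_mem hf⟩
  inv_mem' := by
    rintro f ⟨m, g, rfl⟩
    exact ⟨m, g⁻¹, map_inv₀ (laurentRoot m) g⟩

/-- The field `𝕜 = ℂ{{t}}` of Puiseux series. -/
abbrev Puiseux : Type := ↥puiseuxSubfield

/-- The indeterminate `t`, as a Puiseux series. -/
def tVar : Puiseux :=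
  ⟨HahnSeries.single 1 1, 1, by
    rw [mem_range_laurentRoot]
    intro q hq
    refine ⟨1, ?_⟩
    have : q = 1 := by
      by_contra h
      exact hq (HahnSeries.coeff_single_of_ne h)
    simp [this]⟩

/-- Complex conjugation of Puiseux series: the coefficients are conjugated and `t̄ = t`,
that is `∑ c_l t^{l/m} ↦ ∑ c̄_l t^{l/m}`. -/
def conj (f : Puiseux) : Puiseux :=
  ⟨f.1.map (starRingEnd ℂ), by
    obtain ⟨m, hm⟩ := f.2
    refine ⟨m, ?_⟩
    rw [mem_range_laurentRoot] at hm ⊢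
    intro q hq
    refine hm q ?_
    intro h
    exact hq (by simp [h])⟩

/-! ### Partitions and Hall-Littlewood functions

A partition with at most `k` parts is a weakly decreasing tuple `Fin k → ℕ`. -/

open scoped Classical in
/-- The set of partitions `(λ₁, …, λ_k)` with `n ≥ λ₁ ≥ ⋯ ≥ λ_k ≥ 1`. -/
def alcove (k n : ℕ) : Finset (Fin k → ℕ) :=
  (Fintype.piFinset fun _ => Finset.Icc 1 n).filter Antitone

/-- The length `λ'_i` of the `i`-th column (`i ≥ 1`). -/
def colLen {k : ℕ} (lam : Fin k → ℕ) (i : ℕ) : ℕ :=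
  (Finset.univ.filter fun j => i ≤ lam j).card

/-- `λ / μ` is a horizontal strip: `μ ⊆ λ` and each column of `λ / μ` has at most one box. -/
def IsHorizontalStrip {k : ℕ} (lam mu : Fin k → ℕ) : Prop :=
  mu ≤ lam ∧ ∀ i, 1 ≤ i → colLen lam i ≤ colLen mu i + 1

section HallLittlewood

variable {R : Type*} [CommRing R]

open scoped Classical in
/-- The coefficient `φ_{λ/μ}(t)`: for a horizontal strip it is the product of
`1 - t^{m_i(λ)}` over all `i ≥ 1` such that `λ / μ` has a box in column `i` and none in
column `i + 1`. -/
def phi (t : R) {k : ℕ} (lam mu : Fin k → ℕ) : R :=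
  if IsHorizontalStrip lam mu then
    ∏ i ∈ (Finset.Icc 1 (Finset.univ.sup lam)).filter
        (fun i => colLen lam i = colLen mu i + 1 ∧ colLen lam (i + 1) = colLen mu (i + 1)),
      (1 - t ^ (colLen lam i - colLen lam (i + 1)))
  else 0

open scoped Classical in
/-- The coefficient `ψ_{λ/μ}(t)`: for a horizontal strip it is the product of
`1 - t^{m_i(μ)}` over all `i ≥ 1` such that `λ / μ` has no box in column `i` and a box in
column `i + 1`. -/
def psi (t : R) {k : ℕ} (lam mu : Fin k → ℕ) : R :=
  if IsHorizontalStrip lam mu then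
    ∏ i ∈ (Finset.Icc 1 (Finset.univ.sup lam)).filter
        (fun i => colLen lam i = colLen mu i ∧ colLen lam (i + 1) = colLen mu (i + 1) + 1),
      (1 - t ^ (colLen mu i - colLen mu (i + 1)))
  else 0

open scoped Classical in
/-- The finite set of partitions `μ ⊆ λ`. -/
def subpartitions {k : ℕ} (lam : Fin k → ℕ) : Finset (Fin k → ℕ) :=
  (Fintype.piFinset fun j => Finset.range (lam j + 1)).filter Antitone

open scoped Classical in
/-- The generating function `∑_T w_T x^T` over semistandard tableaux `T` of shape `λ` in the
variables `x₁, …, x_m`. A tableau is a chain `∅ = λ⁰ ⊆ λ¹ ⊆ ⋯ ⊆ λᵐ = λ` of horizontal strips,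
`x^T = ∏ x_i ^ |λⁱ / λⁱ⁻¹|` and `w_T = ∏ w(λⁱ, λⁱ⁻¹)`; the recursion splits off the last strip
(for both weights used below, chains with other steps have weight zero). -/
def tableauSum {k : ℕ} (w : (Fin k → ℕ) → (Fin k → ℕ) → R) :
    (m : ℕ) → (Fin m → R) → (Fin k → ℕ) → R
  | 0, _, lam => if lam = 0 then 1 else 0
  | m + 1, x, lam =>
      ∑ mu ∈ subpartitions lam,
        w lam mu * x (Fin.last m) ^ (∑ j, lam j - ∑ j, mu j) *
          tableauSum w m (fun i => x i.castSucc) mu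

/-- The Hall-Littlewood function `Q_λ(x; t) = ∑_T φ_T(t) x^T` in `m` variables. -/
def hallLittlewoodQ (t : R) {k m : ℕ} (x : Fin m → R) (lam : Fin k → ℕ) : R :=
  tableauSum (phi t) m x lam

/-- The Hall-Littlewood function `P_λ(x; t) = ∑_T ψ_T(t) x^T` in `m` variables. -/
def hallLittlewoodP (t : R) {k m : ℕ} (x : Fin m → R) (lam : Fin k → ℕ) : R :=
  tableauSum (psi t) m x lam

end HallLittlewood

/-! ### The `q`-boson Fock space -/

/-- The `n`-fold tensor power of the Fock space, over `𝕜`, through its basis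
`|m₁, …, m_n⟩ = |m₁⟩ ⊗ ⋯ ⊗ |m_n⟩`. -/
abbrev Fock (n : ℕ) : Type := (Fin n → ℕ) →₀ Puiseux

/-- The basis vector `|m₁, …, m_n⟩`. -/
def ket {n : ℕ} (m : Fin n → ℕ) : Fock n := Finsupp.single m 1

/-- The creation operator at site `i`: `β*_i |…, m_i, …⟩ = (1 - t^{m_i+1}) |…, m_i + 1, …⟩`. -/
def create {n : ℕ} (i : Fin n) : Module.End Puiseux (Fock n) :=
  Finsupp.linearCombination Puiseux fun m =>
    (1 - tVar ^ (m i + 1)) • ket (Function.update m i (m i + 1))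

/-- The annihilation operator at site `i`: `β_i |…, m_i, …⟩ = |…, m_i - 1, …⟩`, and `0` if
`m_i = 0`. -/
def annihilate {n : ℕ} (i : Fin n) : Module.End Puiseux (Fock n) :=
  Finsupp.linearCombination Puiseux fun m =>
    if m i = 0 then 0 else ket (Function.update m i (m i - 1))

/-- The `L`-operator at site `i`. -/
def lOp {n : ℕ} (u : Puiseux) (i : Fin n) : Matrix (Fin 2) (Fin 2) (Module.End Puiseux (Fock n)) :=
  !![1, u • create i; annihilate i, u • 1]

/-- The monodromy matrix `T(u) = L_n(u) ⋯ L_1(u)`. -/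
def monodromy (n : ℕ) (u : Puiseux) : Matrix (Fin 2) (Fin 2) (Module.End Puiseux (Fock n)) :=
  (List.ofFn fun i : Fin n => lOp u i.rev).prod

/-- The entry `B(u)` of the monodromy matrix `T(u) = (A(u), B(u); C(u), D(u))`. -/
def opB (n : ℕ) (u : Puiseux) : Module.End Puiseux (Fock n) := monodromy n u 0 1

/-- The transfer matrix `E(u) = A(u) + z D(u)` at `z = 1`. -/
def transferMatrix (n : ℕ) (u : Puiseux) : Module.End Puiseux (Fock n) :=
  monodromy n u 0 0 + monodromy n u 1 1

/-- The Bethe vector `𝔟(y) = B(y₁⁻¹) ⋯ B(y_k⁻¹) |∅⟩`. -/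
def betheVector (n : ℕ) {k : ℕ} (y : Fin k → Puiseux) : Fock n :=
  (List.ofFn fun i : Fin k => opB n (y i)⁻¹).prod (ket 0)

/-- The vector `|λ⟩ = |m₁(λ), …, m_n(λ)⟩`, with `m_i(λ)` the multiplicity of the part `i`. -/
def ketPartition (n : ℕ) {k : ℕ} (lam : Fin k → ℕ) : Fock n :=
  ket fun i : Fin n => (Finset.univ.filter fun j => lam j = (i : ℕ) + 1).card

/-- The `k`-particle subspace, spanned by the vectors `|λ⟩` with `λ` in the alcove. -/
def fockSector (n k : ℕ) : Submodule Puiseux (Fock n) :=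
  Submodule.span Puiseux (ketPartition n '' (alcove k n : Set (Fin k → ℕ)))

/-- The `t`-Pochhammer symbol `(t)_r = (1 - t)(1 - t²) ⋯ (1 - t^r)`. -/
def tPoch (r : ℕ) : Puiseux := ∏ s ∈ Finset.range r, (1 - tVar ^ (s + 1))

/-- The scalar product, antilinear in the first factor, for which the vectors `|m₁, …, m_n⟩`
are orthogonal with `⟨m₁, …, m_n | m₁, …, m_n⟩ = ∏ 1 / (t)_{m_i}`; for it `β_i` and `β*_i` are
adjoint to each other. -/
def fockInner {n : ℕ} (v w : Fock n) : Puiseux :=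
  ∑ m ∈ v.support, conj (v m) * w m / ∏ i, tPoch (m i)

/-! ### Bethe ansatz equations -/

/-- `y` is a solution of the Bethe ansatz equations at `z = 1`: the Bethe roots are invertible
and pairwise distinct (so that the denominators do not vanish), and satisfy
`y_i^n ∏_{j ≠ i} (y_i - t y_j)/(y_i - y_j) = ∏_{j ≠ i} (t y_i - y_j)/(y_i - y_j)`. -/
def IsBetheSolution (n : ℕ) {k : ℕ} (y : Fin k → Puiseux) : Prop :=
  (∀ i, y i ≠ 0) ∧ Function.Injective y ∧
    ∀ i, y i ^ n * ∏ j ∈ Finset.univ.erase i, (y i - tVar * y j) / (y i - y j) =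
      ∏ j ∈ Finset.univ.erase i, (tVar * y i - y j) / (y i - y j)

/-- Two solutions are identified if they differ by a permutation of the Bethe roots. -/
def betheSetoid (k n : ℕ) : Setoid {y : Fin k → Puiseux // IsBetheSolution n y} where
  r y y' := ∃ w : Equiv.Perm (Fin k), y'.1 = y.1 ∘ w
  iseqv :=
    ⟨fun _ => ⟨1, rfl⟩,
      fun {y y'} ⟨w, hw⟩ => ⟨w⁻¹, by rw [hw]; ext i; simp⟩,
      fun {y y' y''} ⟨w, hw⟩ ⟨w', hw'⟩ => ⟨w * w', by rw [hw', hw]; rfl⟩⟩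

/-- Solutions of the Bethe ansatz equations up to permutation of the Bethe roots. -/
abbrev BetheOrbit (k n : ℕ) : Type := Quotient (betheSetoid k n)

/-! ### The variety in the variables `e₁, …, e_k` and its ideal -/

/-- The elementary symmetric function `e_r` in `𝕜[e₁, …, e_k]`: `e₀ = 1`, the variables
`e₁, …, e_k` are `X 0, …, X (k - 1)`, and `e_r = 0` for `r > k`. -/
def eVar (k r : ℕ) : MvPolynomial (Fin k) Puiseux :=
  if r = 0 then 1 else if h : r - 1 < k then MvPolynomial.X ⟨r - 1, h⟩ else 0

/-- The power series `E(-s u) = ∑_r (-s)^r e_r u^r` in `u`. -/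
def eSeries (k : ℕ) (s : Puiseux) : PowerSeries (MvPolynomial (Fin k) Puiseux) :=
  PowerSeries.mk fun r => MvPolynomial.C ((-s) ^ r) * eVar k r

/-- The polynomial `g_r(s) ∈ 𝕜[e₁, …, e_k]`, the coefficient of `u^r` in
`E(-s u) / E(-u) = ∏ (1 - s u y_i) / (1 - u y_i)`. -/
def gPoly (k : ℕ) (s : Puiseux) (r : ℕ) : MvPolynomial (Fin k) Puiseux :=
  PowerSeries.coeff r (eSeries k s * PowerSeries.invOfUnit (eSeries k 1) 1)

/-- The polynomials `g̃_n = g_n(t) - (1 - t^k)` and `g̃_{n+r} = g_{n+r}(t) + t^k g_r(t⁻¹)` for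
`0 < r < k`. -/
def gTilde (k n r : ℕ) : MvPolynomial (Fin k) Puiseux :=
  if r = 0 then gPoly k tVar n - MvPolynomial.C (1 - tVar ^ k)
  else gPoly k tVar (n + r) + MvPolynomial.C (tVar ^ k) * gPoly k tVar⁻¹ r

/-- The ideal generated by `g̃_n, …, g̃_{n+k-1}`. -/
def betheIdeal (k n : ℕ) : Ideal (MvPolynomial (Fin k) Puiseux) :=
  Ideal.span (Set.range fun r : Fin k => gTilde k n r)

/-- The point `(e₁(y), …, e_k(y))`. -/
def esymmPoint {k : ℕ} (y : Fin k → Puiseux) : Fin k → Puiseux :=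
  fun i => (Finset.univ.val.map y).esymm ((i : ℕ) + 1)

end QBoson

end

noncomputable section

namespace QBoson

/-! ### Power series inside Puiseux series, conjugation -/

/-! Completeness is a count in which an upper and a lower bound meet at the binomial number
`n.multichoose k`, the number of partitions in the alcove (`card_alcove`).

Upper bound. Give `e_r` the weight `r`. The generators of the Bethe ideal have the leading forms
`g_n(t), …, g_{n+k-1}(t)`, and their other terms have smaller weight. A spanning set of the quotient
is built by a Pascal recursion in `(k, n)`: monomials without the last variable belong to `(k-1,
n)`, multiples of it to `(k, n-1)`. So the quotient has dimension at most `n.multichoose k`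
(`exists_spanning`, `betheIdeal_quotient`).

Lower bound. At `t = 0` the equations read `y_i^{n+k} = (-1)^{k-1} ∏ y_j`. They have at least
`n.multichoose k` solutions with distinct entries up to permutation, all on the unit circle
(`exists_solutions_at_zero`). A `t`-adic contraction lifts each of them to `ℂ⟦t⟧`
(`isContraction_newtonStep`), and uniqueness of the fixed point gives `ȳ = y⁻¹` for the lift.

The link is the functional equation `q(tu) + t^k u^n q(t⁻¹u) = q(u) Λ(u)` with `q(u) = ∏ (1 - u
y_i)` and `Λ` a polynomial of degree at most `n` (`exists_tq`). Comparing coefficients of `u^n` and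
above puts `(e_1(y), …, e_k(y))` in the zero locus (`aeval_gTilde`). Evaluations at distinct zeros
are independent functionals on the quotient, so the bounds coincide: the constructed solutions are
all of them, the ideal is radical, and every Bethe root satisfies `ȳ = y⁻¹`
(`zeroLocus_of_finrank_le`, `conj_betheSolution`).

For the Bethe vectors, the `RTT` relation gives the exchange relations of `A` and `D` with `B`. The
Bethe equations cancel the unwanted terms, so `𝔟(y)` is an eigenvector with eigenvalue `Λ(u)`
(`bethe_eigen`). As `Λ` determines `q` (`qPoly_eq_of_tq`), different orbits have different
eigenvalue polynomials. Hence the vectors are independent, and a basis by the count. Since the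
adjoint of `E(u)` is `ū^n E(ū⁻¹)` and `ȳ = y⁻¹`, they are also orthogonal. Finally the matrix
elements of `B(u)` are the branching coefficients of Hall-Littlewood functions
(`opB_apply_occupation`), whence the expansion in the `Q_λ` and the formula for the scalar product.
-/

/-- The embedding `ℂ⟦t⟧ → ℂ{{t}}`. -/
def ofPS : PowerSeries ℂ →+* Puiseux :=
  (HahnSeries.ofPowerSeries ℚ ℂ).codRestrict puiseuxSubfield (fun f => ⟨1, by
    rw [mem_range_laurentRoot]
    intro q hq
    rw [HahnSeries.ofPowerSeries_apply] at hq
    obtain ⟨l, -, rfl⟩ := HahnSeries.support_embDomain_subset hq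
    exact ⟨l, by simp⟩⟩)

theorem ofPS_val (f : PowerSeries ℂ) : (ofPS f).1 = HahnSeries.ofPowerSeries ℚ ℂ f := rfl

theorem ofPS_injective : Function.Injective ofPS := fun _ _ h =>
  HahnSeries.ofPowerSeries_injective (Γ := ℚ) (congrArg Subtype.val h)

theorem ofPS_X : ofPS PowerSeries.X = tVar :=
  Subtype.ext HahnSeries.ofPowerSeries_X

theorem conj_coeff (f : Puiseux) (q : ℚ) : (conj f).1.coeff q = star (f.1.coeff q) := rfl

/-- Conjugation of Puiseux series as a ring homomorphism. -/
def conjHom : Puiseux →+* Puiseux where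
  toFun := conj
  map_one' := by
    apply Subtype.ext; ext q
    rw [conj_coeff]
    by_cases h : q = 0 <;> simp [HahnSeries.coeff_one, h]
  map_zero' := by
    apply Subtype.ext; ext q
    rw [conj_coeff]; simp
  map_add' f g := by
    apply Subtype.ext; ext q
    simp [conj_coeff]
  map_mul' f g := by
    apply Subtype.ext
    exact HahnSeries.map_mul (starRingEnd ℂ : ℂ →ₙ+* ℂ)

theorem conjHom_apply (f : Puiseux) : conjHom f = conj f := rfl

theorem conj_conj (f : Puiseux) : conj (conj f) = f := by
  apply Subtype.ext; ext q
  simp [conj_coeff]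

theorem conj_ofPS (f : PowerSeries ℂ) :
    conj (ofPS f) = ofPS (PowerSeries.map (starRingEnd ℂ) f) := by
  apply Subtype.ext; ext q
  rw [conj_coeff, ofPS_val, ofPS_val]
  by_cases hq : ∃ l : ℕ, (l : ℚ) = q
  · obtain ⟨l, rfl⟩ := hq
    simp [HahnSeries.ofPowerSeries_apply_coeff]
  · push Not at hq
    rw [HahnSeries.ofPowerSeries_apply, HahnSeries.ofPowerSeries_apply,
      HahnSeries.embDomain_of_notMem_range, HahnSeries.embDomain_of_notMem_range] <;> simp [hq]

theorem conj_tVar : conj tVar = tVar := by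
  rw [← ofPS_X, conj_ofPS, PowerSeries.map_X]

theorem tVar_ne_zero : tVar ≠ 0 := by
  rw [← ofPS_X]
  exact (map_ne_zero_iff ofPS ofPS_injective).2 PowerSeries.X_ne_zero

theorem one_sub_tVar_pow_ne_zero {r : ℕ} (hr : r ≠ 0) : 1 - tVar ^ r ≠ 0 := by
  rw [← ofPS_X, ← map_one ofPS, ← map_pow, ← map_sub]
  refine (map_ne_zero_iff ofPS ofPS_injective).2 fun h => ?_
  have := congrArg PowerSeries.constantCoeff h
  simp [hr] at this

theorem tPoch_ne_zero (r : ℕ) : tPoch r ≠ 0 :=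
  Finset.prod_ne_zero_iff.2 fun _ _ => one_sub_tVar_pow_ne_zero (Nat.succ_ne_zero _)

instance : CharZero Puiseux :=
  charZero_of_injective_ringHom (f := ofPS.comp PowerSeries.C)
    (ofPS_injective.comp PowerSeries.C_injective)

/-! ### A spanning set for the quotient by the Bethe ideal -/

section Spanning

open PowerSeries

variable {K A : Type*} [Field K] [CommRing A] [Algebra K A]

/-- The span of the monomials in `e 1, …, e j` of weight at most `d`, where `e i` has weight `i`. -/
def monomialSpan (K : Type*) {A : Type*} [Field K] [CommRing A] [Algebra K A]
    (e : ℕ → A) (j d : ℕ) : Submodule K A :=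
  Submodule.span K {a | ∃ s : Multiset ℕ, (∀ i ∈ s, 1 ≤ i ∧ i ≤ j) ∧ s.sum ≤ d ∧
    (s.map e).prod = a}

variable (e : ℕ → A)

theorem monomialSpan_mono {j j' d d' : ℕ} (hj : j ≤ j') (hd : d ≤ d') :
    monomialSpan K e j d ≤ monomialSpan K e j' d' := by
  refine Submodule.span_mono ?_
  rintro _ ⟨s, h1, h2, rfl⟩
  exact ⟨s, fun i hi => ⟨(h1 i hi).1, (h1 i hi).2.trans hj⟩, h2.trans hd, rfl⟩

theorem one_mem_monomialSpan (j d : ℕ) : (1 : A) ∈ monomialSpan K e j d :=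
  Submodule.subset_span ⟨0, by simp, by simp, by simp⟩

theorem algebraMap_mem_monomialSpan (j d : ℕ) (c : K) :
    algebraMap K A c ∈ monomialSpan K e j d := by
  rw [Algebra.algebraMap_eq_smul_one]
  exact Submodule.smul_mem _ _ (one_mem_monomialSpan e j d)

theorem mul_mem_monomialSpan {j d d' : ℕ} {a b : A} (ha : a ∈ monomialSpan K e j d)
    (hb : b ∈ monomialSpan K e j d') : a * b ∈ monomialSpan K e j (d + d') := by
  have h : monomialSpan K e j d * monomialSpan K e j d' ≤ monomialSpan K e j (d + d') := by
    rw [monomialSpan, monomialSpan, Submodule.span_mul_span]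
    refine Submodule.span_mono ?_
    rintro _ ⟨_, ⟨s, h1, h2, rfl⟩, _, ⟨s', h1', h2', rfl⟩, rfl⟩
    refine ⟨s + s', fun i hi => ?_, ?_, ?_⟩
    · rcases Multiset.mem_add.1 hi with h | h
      exacts [h1 i h, h1' i h]
    · rw [Multiset.sum_add]; lia
    · rw [Multiset.map_add, Multiset.prod_add]
  exact h (Submodule.mul_mem_mul ha hb)

theorem mem_monomialSpan {i j : ℕ} (he : e 0 = 1) (hi : i ≤ j) : e i ∈ monomialSpan K e j i := by
  rcases Nat.eq_zero_or_pos i with rfl | h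
  · rw [he]; exact one_mem_monomialSpan e j 0
  · exact Submodule.subset_span ⟨{i}, by simpa using ⟨h, hi⟩, by simp, by simp⟩

/-- The coefficient of `u ^ m` has weight at most `m`. -/
def IsWeighted (K : Type*) {A : Type*} [Field K] [CommRing A] [Algebra K A]
    (e : ℕ → A) (j : ℕ) (F : A⟦X⟧) : Prop :=
  ∀ m, coeff m F ∈ monomialSpan K e j m

variable {e}

theorem IsWeighted.mul {j : ℕ} {F G : A⟦X⟧} (hF : IsWeighted K e j F) (hG : IsWeighted K e j G) :
    IsWeighted K e j (F * G) := fun m => by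
  rw [coeff_mul]
  refine Submodule.sum_mem _ fun p hp => ?_
  rw [← Finset.HasAntidiagonal.mem_antidiagonal.1 hp]
  exact mul_mem_monomialSpan e (hF _) (hG _)

theorem IsWeighted.sub {j : ℕ} {F G : A⟦X⟧} (hF : IsWeighted K e j F) (hG : IsWeighted K e j G) :
    IsWeighted K e j (F - G) := fun m => by
  rw [map_sub]
  exact Submodule.sub_mem _ (hF m) (hG m)

theorem isWeighted_algebraMap (j : ℕ) (c : K) :
    IsWeighted K e j (algebraMap K A⟦X⟧ c) := fun m => by
  rw [PowerSeries.algebraMap_apply, coeff_C]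
  split_ifs
  · exact algebraMap_mem_monomialSpan e j m c
  · exact Submodule.zero_mem _

theorem IsWeighted.mono {j j' : ℕ} (h : j ≤ j') {F : A⟦X⟧} (hF : IsWeighted K e j F) :
    IsWeighted K e j' F := fun m => monomialSpan_mono e h le_rfl (hF m)

theorem IsWeighted.invOfUnit {j : ℕ} {F : A⟦X⟧} (hF : IsWeighted K e j F) :
    IsWeighted K e j (invOfUnit F 1) := fun m => by
  induction m using Nat.strong_induction_on with
  | _ m ih =>
    rw [coeff_invOfUnit]
    split_ifs with h
    · simpa using one_mem_monomialSpan e j m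
    · simp only [inv_one, Units.val_one, neg_mul, one_mul]
      refine Submodule.neg_mem _ (Submodule.sum_mem _ fun p hp => ?_)
      split_ifs with h2
      · have := mul_mem_monomialSpan e (hF p.1) (ih _ h2)
        rwa [Finset.HasAntidiagonal.mem_antidiagonal.1 hp] at this
      · exact Submodule.zero_mem _

variable (e)

/-- The truncated series `∑_{r ≤ j} (-s)^r e_r u^r`. -/
def truncESeries (j : ℕ) (s : K) : A⟦X⟧ :=
  PowerSeries.mk fun r => if r ≤ j then algebraMap K A ((-s) ^ r) * e r else 0

/-- The series `∑ g_r(s) u^r` for the variables `e_1, …, e_j`. -/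
def gSeries (j : ℕ) (s : K) : A⟦X⟧ :=
  truncESeries e j s * invOfUnit (truncESeries e j (1 : K)) 1

variable {e}

theorem isWeighted_truncESeries (he : e 0 = 1) (j : ℕ) (s : K) :
    IsWeighted K e j (truncESeries e j s) := fun m => by
  rw [truncESeries, coeff_mk]
  split_ifs with h
  · rw [← Algebra.smul_def]
    exact Submodule.smul_mem _ _ (mem_monomialSpan e he h)
  · exact Submodule.zero_mem _

theorem isWeighted_gSeries (he : e 0 = 1) (j : ℕ) (s : K) : IsWeighted K e j (gSeries e j s) :=
  (isWeighted_truncESeries he j s).mul (isWeighted_truncESeries he j 1).invOfUnit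

theorem constantCoeff_truncESeries (he : e 0 = 1) (j : ℕ) (s : K) :
    constantCoeff (truncESeries e j s) = 1 := by
  rw [← coeff_zero_eq_constantCoeff_apply, truncESeries, coeff_mk]
  simp [he]

theorem truncESeries_mul_inv (he : e 0 = 1) (j : ℕ) :
    truncESeries e j (1 : K) * invOfUnit (truncESeries e j (1 : K)) 1 = 1 :=
  mul_invOfUnit _ _ (constantCoeff_truncESeries he j 1)

theorem truncESeries_mul_gSeries (he : e 0 = 1) (j : ℕ) (s : K) :
    truncESeries e j (1 : K) * gSeries e j s = truncESeries e j s := by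
  rw [gSeries, mul_left_comm, truncESeries_mul_inv (K := K) he, mul_one]

theorem coeff_zero_gSeries (he : e 0 = 1) (j : ℕ) (s : K) : coeff 0 (gSeries e j s) = 1 := by
  have := congrArg constantCoeff (truncESeries_mul_gSeries he j s)
  simpa [constantCoeff_truncESeries he] using this

theorem truncESeries_succ (j : ℕ) (s : K) :
    truncESeries e (j + 1) s =
      truncESeries e j s + X ^ (j + 1) * C (e (j + 1)) * algebraMap K A⟦X⟧ ((-s) ^ (j + 1)) := by
  ext m
  rw [map_add, PowerSeries.algebraMap_apply, mul_assoc, ← map_mul, coeff_X_pow_mul', coeff_C,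
    truncESeries, truncESeries, coeff_mk, coeff_mk]
  rcases lt_trichotomy m (j + 1) with h | rfl | h
  · rw [if_pos h.le, if_pos (by lia), if_neg (by lia), add_zero]
  · rw [if_pos le_rfl, if_neg (by lia), if_pos le_rfl, if_pos (by lia), zero_add, mul_comm]
  · rw [if_neg (by lia), if_neg (by lia), if_pos (by lia), if_neg (by lia), zero_add]

/-- Dropping the variable `e_{j+1}` changes numerator and denominator of `E(-su)/E(-u)` by scalar
multiples of `u^{j+1} e_{j+1}`, so the quotients differ by a multiple of it. The weight of the
cofactor must be controlled, because the reduction below is an induction on weight. -/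
theorem gSeries_succ (he : e 0 = 1) (j : ℕ) (s : K) :
    ∃ F : A⟦X⟧, IsWeighted K e (j + 1) F ∧
      gSeries e j s = gSeries e (j + 1) s + X ^ (j + 1) * C (e (j + 1)) * F := by
  refine ⟨(gSeries e (j + 1) s * algebraMap K A⟦X⟧ ((-1) ^ (j + 1)) -
    algebraMap K A⟦X⟧ ((-s) ^ (j + 1))) * invOfUnit (truncESeries e j (1 : K)) 1, ?_, ?_⟩
  · exact (((isWeighted_gSeries he _ s).mul (isWeighted_algebraMap _ _)).sub
      (isWeighted_algebraMap _ _)).mul ((isWeighted_truncESeries he j 1).invOfUnit.mono (by lia))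
  · have h1 := truncESeries_mul_gSeries he (j + 1) s
    rw [truncESeries_succ, truncESeries_succ] at h1
    have h2 := truncESeries_mul_inv (K := K) he j
    rw [gSeries]
    linear_combination (-invOfUnit (truncESeries e j (1 : K)) 1) * h1 +
      gSeries e (j + 1) s * h2

/-- This is the coefficient of `u^{n+k+1}` in `E(-u) g(u) = E(-su)`, solved for the term with
`e_{k+1}`. It trades `e_{k+1} g_n` for multiples of `g_{n+1}, …, g_{n+k+1}`. -/
theorem mul_gSeries_coeff (he : e 0 = 1) (k : ℕ) (s : K) (hs : s ^ (k + 1) ≠ 1) (n : ℕ) :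
    ∃ c : ℕ → K, e (k + 1) * coeff n (gSeries e (k + 1) s) =
      ∑ j ∈ Finset.range (k + 1), c j • (e j * coeff (n + k + 1 - j) (gSeries e (k + 1) s)) := by
  have h := congrArg (coeff (n + k + 1)) (truncESeries_mul_gSeries he (k + 1) s)
  have hsum : coeff (n + k + 1) (truncESeries e (k + 1) (1 : K) * gSeries e (k + 1) s) =
      ∑ j ∈ Finset.range (k + 2),
        ((-1 : K) ^ j) • (e j * coeff (n + k + 1 - j) (gSeries e (k + 1) s)) := by
    rw [coeff_mul, Finset.Nat.sum_antidiagonal_eq_sum_range_succ_mk]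
    symm
    refine Finset.sum_subset_zero_on_sdiff (Finset.range_subset_range.2 (by lia)) ?_ ?_
    · intro j hj
      simp only [Finset.mem_sdiff, Finset.mem_range] at hj
      rw [truncESeries, coeff_mk, if_neg (by lia), zero_mul]
    · intro j hj
      rw [Finset.mem_range] at hj
      rw [truncESeries, coeff_mk, if_pos (by lia), ← Algebra.smul_def, smul_mul_assoc]
  rw [hsum, Finset.sum_range_succ, show n + k + 1 - (k + 1) = n by lia] at h
  have hrhs : coeff (n + k + 1) (truncESeries e (k + 1) s) =
      (if n = 0 then (-s) ^ (k + 1) else 0 : K) •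
        (e (k + 1) * coeff n (gSeries e (k + 1) s)) := by
    rw [truncESeries, coeff_mk]
    rcases Nat.eq_zero_or_pos n with rfl | hn
    · rw [if_pos (by lia), if_pos rfl, coeff_zero_gSeries he, mul_one, Algebra.smul_def]
      simp
    · rw [if_neg (by lia), if_neg (by lia), zero_smul]
  rw [hrhs] at h
  -- The right-hand side contributes only for `n = 0`, where `g_0 = 1` lets `(-s)^{k+1} e_{k+1}`
  -- join the term `e_{k+1} g_n`. This is where `s^{k+1} ≠ 1` is needed.
  set b : K := (if n = 0 then (-s) ^ (k + 1) else 0) - (-1) ^ (k + 1) with hb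
  have hb0 : b ≠ 0 := by
    rw [hb]
    split_ifs
    · rw [neg_pow, ← mul_sub_one]
      exact mul_ne_zero (pow_ne_zero _ (by simp)) (sub_ne_zero.2 hs)
    · simp
  refine ⟨fun j => b⁻¹ * (-1) ^ j, ?_⟩
  simp_rw [mul_smul]
  rw [← Finset.smul_sum, eq_inv_smul_iff₀ hb0, hb, sub_smul, ← h]
  abel

/-- The part of weight at most `d` of the ideal generated by `g_n, …, g_{n+k-1}`. -/
def gSpan (e : ℕ → A) (s : K) (k n d : ℕ) : Submodule K A :=
  Submodule.span K {a | ∃ r < k, ∃ d' p, p ∈ monomialSpan K e k d' ∧ d' + n + r ≤ d ∧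
    p * coeff (n + r) (gSeries e k s) = a}

theorem mul_mem_gSpan {s : K} {k n d r d' : ℕ} {p : A} (hr : r < k)
    (hp : p ∈ monomialSpan K e k d') (hd : d' + n + r ≤ d) :
    p * coeff (n + r) (gSeries e k s) ∈ gSpan e s k n d :=
  Submodule.subset_span ⟨r, hr, d', p, hp, hd, rfl⟩

-- A monomial free of `e_{k+1}` is reduced with the `k`-variable generators `g_{n+1}, …, g_{n+k}`,
-- which agree with the `(k+1)`-variable ones up to multiples of `e_{k+1}`. A multiple of `e_{k+1}`
-- is reduced, after division by it, with `g_n, …, g_{n+k}`; multiplying back gives elements of the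
-- span for `g_{n+1}, …, g_{n+k+1}`.
open scoped Classical in
theorem exists_spanning_succ (he : e 0 = 1) {s : K} {k n : ℕ} (hs : s ^ (k + 1) ≠ 1)
    {B₁ B₂ : Finset A}
    (h₁ : ∀ d, monomialSpan K e k d ≤ Submodule.span K B₁ ⊔ gSpan e s k (n + 1) d)
    (h₂ : ∀ d, monomialSpan K e (k + 1) d ≤ Submodule.span K B₂ ⊔ gSpan e s (k + 1) n d)
    (d : ℕ) : monomialSpan K e (k + 1) d ≤
      Submodule.span K ((B₁ ∪ B₂.image (e (k + 1) * ·) : Finset A) : Set A) ⊔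
        gSpan e s (k + 1) (n + 1) d := by
  set B : Finset A := B₁ ∪ B₂.image (e (k + 1) * ·)
  have hA : ∀ d' m, m ∈ monomialSpan K e (k + 1) d' → d' + (k + 1) ≤ d →
      e (k + 1) * m ∈ Submodule.span K (B : Set A) ⊔ gSpan e s (k + 1) (n + 1) d := by
    intro d' m hm hd
    have key : Submodule.span K (B₂ : Set A) ⊔ gSpan e s (k + 1) n d' ≤
        (Submodule.span K (B : Set A) ⊔ gSpan e s (k + 1) (n + 1) d).comap
          (LinearMap.mulLeft K (e (k + 1))) := by
      refine sup_le (Submodule.span_le.2 fun b hb => ?_) (Submodule.span_le.2 ?_)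
      · exact Submodule.mem_sup_left (Submodule.subset_span (Finset.mem_coe.2
          (Finset.mem_union_right _ (Finset.mem_image_of_mem _ hb))))
      · rintro _ ⟨r, hr, d'', p, hp, hd', rfl⟩
        refine Submodule.mem_sup_right ?_
        rw [LinearMap.mulLeft_apply]
        -- Only `g_n` is missing from the new list of generators, and `e_{k+1} g_n` is expressed
        -- through the others. The remaining generators are merely renumbered.
        rcases r with _ | r
        · obtain ⟨c, hc⟩ := mul_gSeries_coeff he k s hs n
          rw [add_zero, mul_left_comm, hc, Finset.mul_sum]
          refine Submodule.sum_mem _ fun j hj => ?_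
          rw [Finset.mem_range] at hj
          rw [mul_smul_comm, ← mul_assoc, show n + k + 1 - j = n + 1 + (k - j) by lia]
          exact Submodule.smul_mem _ _ (mul_mem_gSpan (by lia)
            (mul_mem_monomialSpan e hp (mem_monomialSpan e he (by lia : j ≤ k + 1))) (by lia))
        · rw [← mul_assoc, show n + (r + 1) = n + 1 + r by lia]
          exact mul_mem_gSpan (by lia)
            (mul_mem_monomialSpan e (mem_monomialSpan e he le_rfl) hp) (by lia)
    exact key (h₂ d' hm)
  obtain ⟨F, hF, hG⟩ := gSeries_succ he k s
  have hB : monomialSpan K e k d ≤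
      Submodule.span K (B : Set A) ⊔ gSpan e s (k + 1) (n + 1) d := by
    refine (h₁ d).trans (sup_le ?_ (Submodule.span_le.2 ?_))
    · exact le_sup_of_le_left (Submodule.span_mono (by
        rw [Finset.coe_subset]; exact Finset.subset_union_left))
    · rintro _ ⟨r, hr, d', p, hp, hd', rfl⟩
      have hp' := monomialSpan_mono e (Nat.le_succ k) le_rfl hp
      rw [hG, map_add, mul_add, mul_assoc (X ^ (k + 1)), coeff_X_pow_mul']
      refine Submodule.add_mem _ (Submodule.mem_sup_right
        (mul_mem_gSpan (by lia) hp' hd')) ?_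
      split_ifs with h
      · rw [coeff_C_mul, mul_left_comm]
        exact hA _ _ (mul_mem_monomialSpan e hp' (hF _)) (by lia)
      · rw [mul_zero]; exact Submodule.zero_mem _
  refine Submodule.span_le.2 ?_
  rintro _ ⟨m, hm1, hm2, rfl⟩
  by_cases hk : k + 1 ∈ m
  · obtain ⟨m', rfl⟩ := Multiset.exists_cons_of_mem hk
    rw [Multiset.map_cons, Multiset.prod_cons]
    rw [Multiset.sum_cons] at hm2
    exact hA m'.sum _ (Submodule.subset_span
      ⟨m', fun i hi => hm1 i (Multiset.mem_cons_of_mem hi), le_rfl, rfl⟩) (by lia)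
  · refine hB (Submodule.subset_span ⟨m, fun i hi => ⟨(hm1 i hi).1, ?_⟩, hm2, rfl⟩)
    have h1 := (hm1 i hi).2
    have h2 : i ≠ k + 1 := fun h => hk (h ▸ hi)
    lia

/-- The cardinalities obey `multichoose (n+1) (k+1) = multichoose n (k+1) + multichoose (n+1) k`. At
the boundary, `k = 0` leaves only constants, while `n = 0` has `g_0 = 1` among the generators, so
nothing survives. -/
theorem exists_spanning (he : e 0 = 1) {s : K} (hs : ∀ r, r ≠ 0 → s ^ r ≠ 1) (k n : ℕ) :
    ∃ B : Finset A, B.card ≤ n.multichoose k ∧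
      ∀ d, monomialSpan K e k d ≤ Submodule.span K (B : Set A) ⊔ gSpan e s k n d := by
  classical
  induction k generalizing n with
  | zero =>
    refine ⟨{1}, by simp, fun d => le_sup_of_le_left (Submodule.span_le.2 ?_)⟩
    rintro _ ⟨m, hm, -, rfl⟩
    have : m = 0 := Multiset.eq_zero_of_forall_notMem fun i hi => by
      have := hm i hi; lia
    subst this
    exact Submodule.subset_span (by simp)
  | succ k ihk =>
    induction n with
    | zero =>
      refine ⟨∅, by simp, fun d => le_sup_of_le_right fun p hp => ?_⟩
      have := mul_mem_gSpan (s := s) (n := 0) (Nat.succ_pos k) hp (le_refl (d + 0 + 0))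
      rwa [add_zero, coeff_zero_gSeries he, mul_one] at this
    | succ n ihn =>
      obtain ⟨B₁, hc₁, h₁⟩ := ihk (n + 1)
      obtain ⟨B₂, hc₂, h₂⟩ := ihn
      refine ⟨_, ?_, exists_spanning_succ he (hs _ (Nat.succ_ne_zero k)) h₁ h₂⟩
      rw [Nat.multichoose_succ_succ]
      have h3 := Finset.card_union_le B₁ (B₂.image (e (k + 1) * ·))
      have h4 := Finset.card_image_le (s := B₂) (f := (e (k + 1) * ·))
      lia

/-- Lower order perturbations of the generators do not spoil a spanning set. -/
theorem monomialSpan_le_sup_ideal {s : K} {k n : ℕ} {B : Finset A}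
    (hB : ∀ d, monomialSpan K e k d ≤ Submodule.span K (B : Set A) ⊔ gSpan e s k n d)
    (I : Ideal A)
    (hI : ∀ r < k, ∃ d < n + r, ∃ l ∈ monomialSpan K e k d,
      coeff (n + r) (gSeries e k s) + l ∈ I) (d : ℕ) :
    monomialSpan K e k d ≤ Submodule.span K (B : Set A) ⊔ I.restrictScalars K := by
  induction d using Nat.strong_induction_on with
  | _ d ih =>
    refine (hB d).trans (sup_le le_sup_left (Submodule.span_le.2 ?_))
    rintro _ ⟨r, hr, d', p, hp, hd, rfl⟩
    obtain ⟨d'', hd'', l, hl, hmem⟩ := hI r hr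
    have h1 : p * (coeff (n + r) (gSeries e k s) + l) ∈ I := I.mul_mem_left p hmem
    -- The correction `p * l` has weight strictly below `d`, so the induction on weight absorbs it.
    have h2 := ih (d' + d'') (by lia) (mul_mem_monomialSpan e hp hl)
    have h3 : p * coeff (n + r) (gSeries e k s) =
        p * (coeff (n + r) (gSeries e k s) + l) - p * l := by ring
    rw [h3]
    exact Submodule.sub_mem _ (Submodule.mem_sup_right h1) h2

theorem finrank_quotient_le {k : ℕ} {B : Finset A} {I : Ideal A}
    (hB : ∀ d, monomialSpan K e k d ≤ Submodule.span K (B : Set A) ⊔ I.restrictScalars K)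
    (htop : ∀ a : A, ∃ d, a ∈ monomialSpan K e k d) :
    Module.Finite K (A ⧸ I) ∧ Module.finrank K (A ⧸ I) ≤ B.card := by
  classical
  have hspan : Submodule.span K ((B.image (Ideal.Quotient.mkₐ K I) : Finset (A ⧸ I)) :
      Set (A ⧸ I)) = ⊤ := by
    rw [eq_top_iff]
    rintro x -
    obtain ⟨a, rfl⟩ := Ideal.Quotient.mkₐ_surjective K I x
    obtain ⟨d, hd⟩ := htop a
    obtain ⟨b, hb, c, hc, rfl⟩ := Submodule.mem_sup.1 (hB d hd)
    have hc0 : Ideal.Quotient.mkₐ K I c = 0 := Ideal.Quotient.eq_zero_iff_mem.2 hc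
    rw [map_add, hc0, add_zero, Finset.coe_image]
    exact Submodule.apply_mem_span_image_of_mem_span (Ideal.Quotient.mkₐ K I).toLinearMap hb
  refine ⟨⟨⟨_, hspan⟩⟩, ?_⟩
  have h := finrank_span_finset_le_card (R := K) (B.image (Ideal.Quotient.mkₐ K I))
  rw [Set.finrank, hspan, finrank_top] at h
  exact h.trans Finset.card_image_le

end Spanning

/-! The Bethe ideal. -/

theorem eVar_zero (k : ℕ) : eVar k 0 = 1 := if_pos rfl

theorem eVar_succ {k : ℕ} (i : Fin k) : eVar k (i + 1) = MvPolynomial.X i := by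
  simp [eVar]

theorem eVar_eq_zero {k r : ℕ} (h : k < r) : eVar k r = 0 := by
  rw [eVar, if_neg (by lia), dif_neg (by lia)]

theorem truncESeries_eVar (k : ℕ) (s : Puiseux) : truncESeries (eVar k) k s = eSeries k s := by
  ext1 r
  rw [truncESeries, eSeries, PowerSeries.coeff_mk, PowerSeries.coeff_mk]
  split_ifs with h
  · rfl
  · rw [eVar_eq_zero (by lia), mul_zero]

theorem coeff_gSeries_eVar (k : ℕ) (s : Puiseux) (r : ℕ) :
    PowerSeries.coeff r (gSeries (eVar k) k s) = gPoly k s r := by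
  rw [gSeries, truncESeries_eVar, truncESeries_eVar, gPoly]

theorem exists_mem_monomialSpan_eVar (k : ℕ) (a : MvPolynomial (Fin k) Puiseux) :
    ∃ d, a ∈ monomialSpan Puiseux (eVar k) k d := by
  induction a using MvPolynomial.induction_on with
  | C c => exact ⟨0, algebraMap_mem_monomialSpan _ k 0 c⟩
  | add p q hp hq =>
    obtain ⟨d, hd⟩ := hp
    obtain ⟨d', hd'⟩ := hq
    exact ⟨max d d', Submodule.add_mem _ (monomialSpan_mono _ le_rfl (le_max_left _ _) hd)
      (monomialSpan_mono _ le_rfl (le_max_right _ _) hd')⟩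
  | mul_X p i hp =>
    obtain ⟨d, hd⟩ := hp
    refine ⟨d + (i + 1), mul_mem_monomialSpan _ hd ?_⟩
    rw [← eVar_succ]
    exact mem_monomialSpan _ (eVar_zero k) (by lia)

/-- The terms added to `g_{n+r}(t)` are a constant, of weight `0 < n`, or `t^k g_r(t⁻¹)`, of weight
`r < n + r`. The spanning set found for the leading forms therefore also serves for this ideal. -/
theorem betheIdeal_quotient (k n : ℕ) (hn : 0 < n) :
    Module.Finite Puiseux (MvPolynomial (Fin k) Puiseux ⧸ betheIdeal k n) ∧
      Module.finrank Puiseux (MvPolynomial (Fin k) Puiseux ⧸ betheIdeal k n) ≤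
        n.multichoose k := by
  obtain ⟨B, hB, h⟩ := exists_spanning (eVar_zero k) (s := tVar)
    (fun r hr h => one_sub_tVar_pow_ne_zero hr (by rw [h, sub_self])) k n
  have hI : ∀ r < k, ∃ d < n + r, ∃ l ∈ monomialSpan Puiseux (eVar k) k d,
      PowerSeries.coeff (n + r) (gSeries (eVar k) k tVar) + l ∈ betheIdeal k n := by
    intro r hr
    have hmem : gTilde k n r ∈ betheIdeal k n := Ideal.subset_span ⟨⟨r, hr⟩, rfl⟩
    rw [gTilde] at hmem
    split_ifs at hmem with h0
    · refine ⟨0, by lia, -MvPolynomial.C (1 - tVar ^ k),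
        Submodule.neg_mem _ (algebraMap_mem_monomialSpan _ k 0 _), ?_⟩
      rw [coeff_gSeries_eVar, h0, add_zero, ← sub_eq_add_neg]
      exact hmem
    · refine ⟨r, by lia, _, ?_, by rw [coeff_gSeries_eVar]; exact hmem⟩
      rw [← coeff_gSeries_eVar, ← MvPolynomial.smul_eq_C_mul]
      exact Submodule.smul_mem _ _ (isWeighted_gSeries (eVar_zero k) k _ r)
  obtain ⟨h1, h2⟩ := finrank_quotient_le (monomialSpan_le_sup_ideal h _ hI)
    (exists_mem_monomialSpan_eVar k)
  exact ⟨h1, h2.trans hB⟩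

/-! ### The functional equation of a Bethe solution -/

section TQ

open Polynomial

variable {K : Type*} [Field K] {k : ℕ}

/-- The polynomial `q(u) = ∏ (1 - u y_i)`. -/
def qPoly (y : Fin k → K) : K[X] := ∏ i, (1 - C (y i) * X)

theorem qPoly_comp (y : Fin k → K) (s : K) :
    (qPoly y).comp (C s * X) = qPoly fun i => s * y i := by
  rw [qPoly, qPoly, Polynomial.prod_comp]
  refine Finset.prod_congr rfl fun i _ => ?_
  rw [sub_comp, one_comp, mul_comp, C_comp, X_comp, C_mul]
  ring

theorem qPoly_eval (y : Fin k → K) (u : K) :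
    (qPoly y).eval u = ∏ i, (1 - u * y i) := by
  rw [qPoly, eval_prod]
  refine Finset.prod_congr rfl fun i _ => ?_
  rw [eval_sub, eval_one, eval_mul, eval_C, eval_X, mul_comm]

theorem qPoly_coeff (y : Fin k → K) (r : ℕ) :
    (qPoly y).coeff r = (-1) ^ r * (Finset.univ.val.map y).esymm r := by
  have h : qPoly y = ∑ s : Finset (Fin k), C (∏ i ∈ s, -y i) * X ^ s.card := by
    rw [qPoly]
    simp_rw [sub_eq_add_neg]
    rw [Finset.prod_one_add, Finset.powerset_univ]
    refine Finset.sum_congr rfl fun s _ => ?_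
    rw [map_prod, ← Finset.prod_const, ← Finset.prod_mul_distrib]
    simp
  rw [h, finsetSum_coeff, Finset.esymm_map_val, Finset.mul_sum, Finset.powersetCard_eq_filter,
    Finset.powerset_univ, Finset.sum_filter]
  refine Finset.sum_congr rfl fun s _ => ?_
  rw [coeff_C_mul_X_pow, Finset.prod_neg]
  by_cases hs : s.card = r
  · rw [if_pos hs.symm, if_pos hs, hs]
  · rw [if_neg (Ne.symm hs), if_neg hs]

theorem qPoly_coeff_zero (y : Fin k → K) : (qPoly y).coeff 0 = 1 := by
  rw [coeff_zero_eq_eval_zero, qPoly_eval]; simp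

theorem qPoly_ne_zero (y : Fin k → K) : qPoly y ≠ 0 := fun h => by
  have := qPoly_coeff_zero y
  rw [h] at this
  simp at this

theorem qPoly_natDegree_le (y : Fin k → K) : (qPoly y).natDegree ≤ k := by
  refine (natDegree_prod_le _ _).trans ((Finset.sum_le_card_nsmul _ _ 1 fun i _ => ?_).trans
    (by simp))
  exact (natDegree_sub_le _ _).trans (by
    rw [natDegree_one, Nat.zero_max]
    exact (natDegree_mul_le).trans (by simp))

theorem qPoly_coeff_top {y : Fin k → K} (hy : ∀ i, y i ≠ 0) : (qPoly y).coeff k ≠ 0 := by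
  rw [qPoly_coeff, Finset.esymm_map_val]
  have : Finset.powersetCard k (Finset.univ : Finset (Fin k)) = {Finset.univ} := by
    simpa using Finset.powersetCard_self (Finset.univ : Finset (Fin k))
  rw [this, Finset.sum_singleton]
  exact mul_ne_zero (pow_ne_zero _ (by simp)) (Finset.prod_ne_zero_iff.2 fun i _ => hy i)

/-- The `y_i` are non-zero and distinct, so the linear factors of `q` are pairwise coprime and may
be divided out separately. -/
theorem qPoly_dvd {y : Fin k → K} (hy : ∀ i, y i ≠ 0) (hinj : Function.Injective y)
    {p : K[X]} (hp : ∀ i, p.eval (y i)⁻¹ = 0) : qPoly y ∣ p := by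
  have h : ∀ i, 1 - C (y i) * X = C (-y i) * (X - C (y i)⁻¹) := fun i => by
    rw [mul_sub, ← C_mul, neg_mul, mul_inv_cancel₀ (hy i)]
    simp only [map_neg, map_one]
    ring
  refine Fintype.prod_dvd_of_coprime ?_ fun i => ?_
  · intro i j hij
    have h1 := pairwise_coprime_X_sub_C (inv_injective.comp hinj) hij
    simp only [Function.onFun, h, Function.comp] at h1 ⊢
    refine (isCoprime_mul_unit_left_left (isUnit_C.2 (by simpa using hy i)) _ _).2
      ((isCoprime_mul_unit_left_right (isUnit_C.2 (by simpa using hy j)) _ _).2 h1)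
  · rw [h, (isUnit_C.2 (by simpa using hy i)).mul_left_dvd, dvd_iff_isRoot]
    exact hp i

/-- The right-hand side of the functional equation. -/
def tqRhs (t : K) (n k : ℕ) (q : K[X]) : K[X] :=
  q.comp (C t * X) + C (t ^ k) * X ^ n * q.comp (C t⁻¹ * X)

theorem coeff_tqRhs (t : K) (n k : ℕ) (q : K[X]) (r : ℕ) :
    (tqRhs t n k q).coeff r = q.coeff r * t ^ r +
      t ^ k * if n ≤ r then q.coeff (r - n) * t⁻¹ ^ (r - n) else 0 := by
  rw [tqRhs, coeff_add, comp_C_mul_X_coeff, mul_assoc, coeff_C_mul, coeff_X_pow_mul',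
    comp_C_mul_X_coeff]

/-- At `u = y_i⁻¹` the factors `j = i` of the two products become `1 - t` and `(t - 1)/t`. What
remains, cleared of denominators, is the difference of the two sides of the `i`-th Bethe equation.
-/
theorem tqRhs_eval_eq_zero {t : K} (ht : t ≠ 0) {n : ℕ} {y : Fin k → K} (hy : ∀ i, y i ≠ 0)
    (h : ∀ i, y i ^ n * ∏ j ∈ Finset.univ.erase i, (y i - t * y j) =
      ∏ j ∈ Finset.univ.erase i, (t * y i - y j)) (i : Fin k) :
    (tqRhs t n k (qPoly y)).eval (y i)⁻¹ = 0 := by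
  have hyi := hy i
  have h1 : ∏ j, (1 - (y i)⁻¹ * (t * y j)) * y i =
      (1 - t) * y i * ∏ j ∈ Finset.univ.erase i, (y i - t * y j) := by
    rw [← Finset.mul_prod_erase _ _ (Finset.mem_univ i)]
    congr 1
    · field_simp
    · exact Finset.prod_congr rfl fun j _ => by field_simp
  have h2 : ∏ j, (1 - (y i)⁻¹ * (t⁻¹ * y j)) * (y i * t) =
      (t - 1) * y i * ∏ j ∈ Finset.univ.erase i, (t * y i - y j) := by
    rw [← Finset.mul_prod_erase _ _ (Finset.mem_univ i)]
    congr 1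
    · field_simp
    · exact Finset.prod_congr rfl fun j _ => by field_simp
  rw [Finset.prod_mul_distrib, Finset.prod_const, Finset.card_univ, Fintype.card_fin] at h1 h2
  rw [← h i, mul_pow] at h2
  rw [tqRhs, eval_add, eval_mul, eval_mul, eval_C, eval_pow, eval_X, qPoly_comp, qPoly_comp,
    qPoly_eval, qPoly_eval]
  have h3 : (y i ^ k * y i ^ n) * (∏ j, (1 - (y i)⁻¹ * (t * y j)) +
      t ^ k * (y i)⁻¹ ^ n * ∏ j, (1 - (y i)⁻¹ * (t⁻¹ * y j))) = 0 := by
    have h4 : y i ^ n * (y i)⁻¹ ^ n = 1 := by rw [← mul_pow, mul_inv_cancel₀ hyi, one_pow]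
    linear_combination y i ^ n * h1 + y i ^ n * (y i)⁻¹ ^ n * h2 + (t - 1) * y i *
      (y i ^ n * ∏ j ∈ Finset.univ.erase i, (y i - t * y j)) * h4
  exact (mul_eq_zero.1 h3).resolve_left (mul_ne_zero (pow_ne_zero _ hyi) (pow_ne_zero _ hyi))

theorem tq_coeff_zero {t : K} {n : ℕ} (hn : 0 < n) {y : Fin k → K} {L : K[X]}
    (hL : tqRhs t n k (qPoly y) = qPoly y * L) : L.coeff 0 = 1 := by
  have h := congrArg (coeff · 0) hL
  simp only [coeff_tqRhs, mul_coeff_zero, qPoly_coeff_zero] at h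
  rw [if_neg (by lia)] at h
  simpa using h.symm

theorem tq_natDegree_le {t : K} {n : ℕ} {y : Fin k → K} (hy : ∀ i, y i ≠ 0) {L : K[X]}
    (hL : tqRhs t n k (qPoly y) = qPoly y * L) : L.natDegree ≤ n := by
  rcases eq_or_ne L 0 with rfl | hL0
  · simp
  have hdeg : (qPoly y).natDegree = k :=
    le_antisymm (qPoly_natDegree_le y) (le_natDegree_of_ne_zero (qPoly_coeff_top hy))
  have h1 : (tqRhs t n k (qPoly y)).natDegree ≤ n + k := by
    refine natDegree_le_iff_coeff_eq_zero.2 fun r hr => ?_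
    rw [coeff_tqRhs, coeff_eq_zero_of_natDegree_lt (by lia), if_pos (by lia),
      coeff_eq_zero_of_natDegree_lt (by lia)]
    ring
  rw [hL, natDegree_mul (qPoly_ne_zero y) hL0, hdeg] at h1
  lia

/-- In degree `k + n` only `t^k u^n q(t⁻¹u)` contributes, and its factor `t^k` cancels the `t^{-k}`
on the leading coefficient of `q`. -/
theorem tq_coeff_top {t : K} (ht : t ≠ 0) {n : ℕ} (hn : 0 < n) {y : Fin k → K} (hy : ∀ i, y i ≠ 0)
    {L : K[X]} (hL : tqRhs t n k (qPoly y) = qPoly y * L) : L.coeff n = 1 := by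
  have h := congrArg (coeff · (k + n)) hL
  simp only [coeff_tqRhs] at h
  rw [coeff_mul_add_eq_of_natDegree_le (qPoly_natDegree_le y) (tq_natDegree_le hy hL),
    coeff_eq_zero_of_natDegree_lt ((qPoly_natDegree_le y).trans_lt (by lia)), if_pos (by lia),
    Nat.add_sub_cancel, zero_mul, zero_add, mul_left_comm, ← mul_pow,
    mul_inv_cancel₀ ht, one_pow, mul_one] at h
  exact (mul_left_cancel₀ (qPoly_coeff_top hy) (by rw [mul_one]; exact h)).symm

/-- For fixed `L` the equation is linear in `q`. As `L` has constant term `1`, the coefficient of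
`u^r` gives `(t^r - 1) q_r` in terms of lower coefficients. So the constant term of `q` determines
`q`, since no positive power of `t` is `1`. -/
theorem qPoly_eq_of_tq {t : K} (htr : ∀ r, r ≠ 0 → 1 - t ^ r ≠ 0) {n : ℕ} (hn : 0 < n)
    {y y' : Fin k → K} {L : K[X]} (hL : tqRhs t n k (qPoly y) = qPoly y * L)
    (hL' : tqRhs t n k (qPoly y') = qPoly y' * L) : qPoly y = qPoly y' := by
  rw [← sub_eq_zero]
  set d := qPoly y - qPoly y' with hd
  have hdL : tqRhs t n k d = d * L := by
    rw [hd, sub_mul, ← hL, ← hL', tqRhs, tqRhs, tqRhs, sub_comp, sub_comp]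
    ring
  refine Polynomial.ext fun r => ?_
  rw [coeff_zero]
  induction r using Nat.strong_induction_on with
  | _ r ih =>
    rcases Nat.eq_zero_or_pos r with rfl | hr
    · rw [hd, coeff_sub, qPoly_coeff_zero, qPoly_coeff_zero, sub_self]
    have h := congrArg (coeff · r) hdL
    simp only [coeff_tqRhs, coeff_mul] at h
    rw [Finset.sum_eq_single (r, 0), tq_coeff_zero hn hL, mul_one] at h
    · have h2 : (if n ≤ r then d.coeff (r - n) * t⁻¹ ^ (r - n) else 0) = 0 := by
        split_ifs
        · rw [ih _ (by lia), zero_mul]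
        · rfl
      rw [h2, mul_zero, add_zero] at h
      have h3 : d.coeff r * (1 - t ^ r) = 0 := by linear_combination -h
      exact (mul_eq_zero.1 h3).resolve_right (htr r hr.ne')
    · rintro ⟨a, b⟩ hab hne
      rw [Finset.HasAntidiagonal.mem_antidiagonal] at hab
      have : a < r := by
        rcases Nat.eq_zero_or_pos b with rfl | hb
        · exact absurd (by simpa using hab) fun h => hne (by rw [h])
        · simp only at hab; lia
      rw [ih a this, zero_mul]
    · intro h
      exact absurd (by simp) h

theorem exists_perm_of_qPoly_eq {y y' : Fin k → K} (hy' : ∀ i, y' i ≠ 0)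
    (hinj : Function.Injective y') (h : qPoly y = qPoly y') :
    ∃ w : Equiv.Perm (Fin k), y' = y ∘ w := by
  have h1 : ∀ i, ∃ j, y' i = y j := fun i => by
    have h2 := congrArg (eval (y' i)⁻¹) h
    rw [qPoly_eval, qPoly_eval, Finset.prod_eq_zero (f := fun j => 1 - (y' i)⁻¹ * y' j)
      (Finset.mem_univ i) (by rw [inv_mul_cancel₀ (hy' i), sub_self]),
      Finset.prod_eq_zero_iff] at h2
    obtain ⟨j, -, hj⟩ := h2
    refine ⟨j, ?_⟩
    linear_combination y' i * hj + y j * mul_inv_cancel₀ (hy' i)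
  choose w hw using h1
  have hwi : Function.Injective w := fun a b hab => hinj (by rw [hw, hw, hab])
  exact ⟨Equiv.ofBijective w (Finite.injective_iff_bijective.1 hwi), funext hw⟩

theorem tq_eval {t : K} (ht : t ≠ 0) {n : ℕ} {y : Fin k → K} {L : K[X]}
    (hL : tqRhs t n k (qPoly y) = qPoly y * L) {u : K} (hu : ∀ i, 1 - u * y i ≠ 0) :
    L.eval u = ∏ i, (1 - u * y i * t) / (1 - u * y i) +
        t ^ k * u ^ n * ∏ i, (1 - u * t⁻¹ * y i) / (1 - u * y i) := by
  have h := congrArg (eval u) hL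
  rw [eval_mul, tqRhs, eval_add, eval_mul, eval_mul, eval_C, eval_pow, eval_X, qPoly_comp,
    qPoly_comp, qPoly_eval, qPoly_eval, qPoly_eval] at h
  have h0 : ∏ i, (1 - u * y i) ≠ 0 := Finset.prod_ne_zero_iff.2 fun i _ => hu i
  rw [Finset.prod_div_distrib, Finset.prod_div_distrib]
  field_simp
  rw [mul_comm (L.eval u), ← h]
  congr 1
  · exact Finset.prod_congr rfl fun i _ => by ring
  · congr 1
    exact Finset.prod_congr rfl fun i _ => by field_simp

end TQ

/-! ### Bethe solutions as zeros of the Bethe ideal -/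

section Bethe

open Polynomial

variable {k : ℕ}

theorem betheEquation_clear {n : ℕ} {y : Fin k → Puiseux} (hy : IsBetheSolution n y) (i : Fin k) :
    y i ^ n * ∏ j ∈ Finset.univ.erase i, (y i - tVar * y j) =
      ∏ j ∈ Finset.univ.erase i, (tVar * y i - y j) := by
  have h := hy.2.2 i
  have h0 : ∏ j ∈ Finset.univ.erase i, (y i - y j) ≠ 0 :=
    Finset.prod_ne_zero_iff.2 fun j hj =>
      sub_ne_zero.2 fun hij => (Finset.ne_of_mem_erase hj) (hy.2.1 hij).symm
  rw [Finset.prod_div_distrib, Finset.prod_div_distrib] at h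
  rw [← mul_div_assoc] at h
  exact (div_left_inj' h0).1 h

/-- The eigenvalue polynomial `Λ` of a Bethe solution. -/
theorem exists_tq {n : ℕ} {y : Fin k → Puiseux} (hy : IsBetheSolution n y) :
    ∃ L : Puiseux[X], tqRhs tVar n k (qPoly y) = qPoly y * L :=
  qPoly_dvd hy.1 hy.2.1 (tqRhs_eval_eq_zero tVar_ne_zero hy.1 (betheEquation_clear hy))

/-- Evaluation of the generating series of the `g_r` at the point `(e_1(y), …, e_k(y))`. -/
theorem map_eSeries (y : Fin k → Puiseux) (s : Puiseux) :
    PowerSeries.map (MvPolynomial.aeval (esymmPoint y)).toRingHom (eSeries k s) =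
      ((qPoly fun i => s * y i : Puiseux[X]) : PowerSeries Puiseux) := by
  refine PowerSeries.ext fun r => ?_
  rw [PowerSeries.coeff_map, eSeries, PowerSeries.coeff_mk, Polynomial.coeff_coe, ← qPoly_comp,
    comp_C_mul_X_coeff, qPoly_coeff, map_mul, neg_pow]
  have h : (MvPolynomial.aeval (esymmPoint y)).toRingHom (eVar k r) =
      (Finset.univ.val.map y).esymm r := by
    rcases Nat.eq_zero_or_pos r with rfl | hr
    · rw [eVar_zero, map_one, Finset.esymm_map_val]; simp
    · rcases le_or_gt r k with h | h
      · obtain ⟨r, rfl⟩ := Nat.exists_eq_add_one_of_ne_zero hr.ne'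
        have := eVar_succ (k := k) ⟨r, h⟩
        simp only at this
        rw [this]
        simp [esymmPoint]
      · rw [eVar_eq_zero h, map_zero, Finset.esymm_map_val, Finset.powersetCard_eq_empty.2 (by simpa),
          Finset.sum_empty]
  have hC : ∀ c, (MvPolynomial.aeval (esymmPoint y)).toRingHom
      (MvPolynomial.C c : MvPolynomial (Fin k) Puiseux) = c := fun c =>
    MvPolynomial.aeval_C (esymmPoint y) c
  rw [h, hC]
  ring

theorem map_gSeries (y : Fin k → Puiseux) (s : Puiseux) :
    ((qPoly y : Puiseux[X]) : PowerSeries Puiseux) *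
      PowerSeries.map (MvPolynomial.aeval (esymmPoint y)).toRingHom (gSeries (eVar k) k s) =
      ((qPoly fun i => s * y i : Puiseux[X]) : PowerSeries Puiseux) := by
  have h := congrArg (PowerSeries.map (MvPolynomial.aeval (esymmPoint y)).toRingHom)
    (truncESeries_mul_gSeries (eVar_zero k) k s)
  rw [map_mul, truncESeries_eVar, truncESeries_eVar, map_eSeries, map_eSeries] at h
  simpa using h

/-- Divided by `q`, the functional equation becomes `L(u) = ∑ g_r(t) u^r + t^k u^n ∑ g_r(t⁻¹) u^r`
at the point of `y`. The coefficient of `u^n` in `L` is `1` and all later ones vanish, which are the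
equations of the ideal. -/
theorem aeval_gTilde {n : ℕ} (hn : 0 < n) {y : Fin k → Puiseux} (hy : IsBetheSolution n y)
    (r : ℕ) : MvPolynomial.aeval (esymmPoint y) (gTilde k n r) = 0 := by
  obtain ⟨L, hL⟩ := exists_tq hy
  have h : (L : PowerSeries Puiseux) =
      PowerSeries.map (MvPolynomial.aeval (esymmPoint y)).toRingHom (gSeries (eVar k) k tVar) +
      PowerSeries.C (tVar ^ k) * PowerSeries.X ^ n *
      PowerSeries.map (MvPolynomial.aeval (esymmPoint y)).toRingHom
        (gSeries (eVar k) k tVar⁻¹) := by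
    refine mul_left_cancel₀ (a := ((qPoly y : Puiseux[X]) : PowerSeries Puiseux))
      (by simpa using qPoly_ne_zero y) ?_
    rw [← Polynomial.coe_mul, ← hL, mul_add, mul_left_comm, map_gSeries, map_gSeries, tqRhs,
      qPoly_comp, qPoly_comp]
    simp
  have hc := congrArg (PowerSeries.coeff (n + r)) h
  rw [Polynomial.coeff_coe, map_add, PowerSeries.coeff_map, coeff_gSeries_eVar, mul_assoc,
    PowerSeries.coeff_C_mul, PowerSeries.coeff_X_pow_mul', if_pos (by lia), Nat.add_sub_cancel_left,
    PowerSeries.coeff_map, coeff_gSeries_eVar] at hc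
  have hev : ∀ p : MvPolynomial (Fin k) Puiseux, (MvPolynomial.aeval (esymmPoint y)).toRingHom p =
    MvPolynomial.aeval (esymmPoint y) p := fun _ => rfl
  rw [hev, hev] at hc
  rw [gTilde]
  split_ifs with h0
  · subst h0
    rw [add_zero, tq_coeff_top tVar_ne_zero hn hy.1 hL, ← coeff_gSeries_eVar k tVar⁻¹,
      coeff_zero_gSeries (eVar_zero k), map_one, mul_one] at hc
    rw [map_sub, MvPolynomial.aeval_C, Algebra.algebraMap_self_apply]
    linear_combination -hc
  · rw [coeff_eq_zero_of_natDegree_lt ((tq_natDegree_le hy.1 hL).trans_lt (by lia))] at hc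
    rw [map_add, map_mul, MvPolynomial.aeval_C, Algebra.algebraMap_self_apply, ← hc]

theorem esymmPoint_mem_zeroLocus {n : ℕ} (hn : 0 < n) {y : Fin k → Puiseux}
    (hy : IsBetheSolution n y) :
    esymmPoint y ∈ MvPolynomial.zeroLocus Puiseux (betheIdeal k n) := by
  rw [betheIdeal, MvPolynomial.zeroLocus_span]
  rintro _ ⟨r, rfl⟩
  exact aeval_gTilde hn hy r

theorem qPoly_eq_of_esymmPoint_eq {y y' : Fin k → Puiseux} (h : esymmPoint y = esymmPoint y') :
    qPoly y = qPoly y' := by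
  apply Polynomial.coe_injective
  have h1 := map_eSeries y 1
  rw [h, map_eSeries] at h1
  simpa using h1.symm

theorem esymmPoint_comp_perm (y : Fin k → Puiseux) (w : Equiv.Perm (Fin k)) :
    esymmPoint (y ∘ w) = esymmPoint y := by
  funext i
  rw [esymmPoint, esymmPoint, ← Multiset.map_map]
  congr 2
  exact congrArg Finset.val (Finset.map_univ_equiv w)

end Bethe

/-! ### The Yang-Baxter algebra -/

section YangBaxter

variable {K E : Type*} [Field K] [Ring E] [Algebra K E]

/-- The product of `M ⊗ 1` and `1 ⊗ N`, in this order. -/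
def tensorLeft (M N : Matrix (Fin 2) (Fin 2) E) : Matrix (Fin 2 × Fin 2) (Fin 2 × Fin 2) E :=
  fun p q => M p.1 q.1 * N p.2 q.2

/-- The product of `1 ⊗ N` and `M ⊗ 1`, in this order. -/
def tensorRight (M N : Matrix (Fin 2) (Fin 2) E) : Matrix (Fin 2 × Fin 2) (Fin 2 × Fin 2) E :=
  fun p q => N p.2 q.2 * M p.1 q.1

theorem tensorLeft_mul {M M' N N' : Matrix (Fin 2) (Fin 2) E}
    (h : ∀ a b c d, Commute (N a b) (M' c d)) :
    tensorLeft (M * M') (N * N') = tensorLeft M N * tensorLeft M' N' := by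
  ext p q
  simp only [tensorLeft, Matrix.mul_apply, Fintype.sum_prod_type, Finset.sum_mul_sum]
  refine Finset.sum_congr rfl fun i _ => Finset.sum_congr rfl fun j _ => ?_
  rw [mul_assoc, ← mul_assoc (M' i q.1), ← (h p.2 j i q.1).eq, mul_assoc, mul_assoc]

theorem tensorRight_mul {M M' N N' : Matrix (Fin 2) (Fin 2) E}
    (h : ∀ a b c d, Commute (M a b) (N' c d)) :
    tensorRight (M * M') (N * N') = tensorRight M N * tensorRight M' N' := by
  ext p q
  simp only [tensorRight, Matrix.mul_apply, Fintype.sum_prod_type, Finset.sum_mul_sum]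
  rw [Finset.sum_comm]
  refine Finset.sum_congr rfl fun i _ => Finset.sum_congr rfl fun j _ => ?_
  rw [mul_assoc, ← mul_assoc (N' j q.2), ← (h p.1 i j q.2).eq, mul_assoc, mul_assoc]

/-- The `R`-matrix of the six-vertex model. -/
def rMatrix (t u v : K) : Matrix (Fin 2 × Fin 2) (Fin 2 × Fin 2) K := fun p q =>
  if p = q then if p.1 = p.2 then u - t * v else if p.1 = 0 then t * (u - v) else u - v
  else if p = q.swap then if p.1 = 0 then (1 - t) * u else (1 - t) * v
  else 0

/-- The relation `R T₁(u) T₂(v) = T₂(v) T₁(u) R`. -/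
def IsRTT (t u v : K) (M N : Matrix (Fin 2) (Fin 2) E) : Prop :=
  (rMatrix t u v).map (algebraMap K E) * tensorLeft M N =
    tensorRight M N * (rMatrix t u v).map (algebraMap K E)

/-- Coproduct property: entries belonging to different sites commute, so the `R`-matrix can be moved
through the factors one at a time. -/
theorem IsRTT.mul {t u v : K} {M M' N N' : Matrix (Fin 2) (Fin 2) E} (h : IsRTT t u v M N)
    (h' : IsRTT t u v M' N') (h₁ : ∀ a b c d, Commute (N a b) (M' c d))
    (h₂ : ∀ a b c d, Commute (M a b) (N' c d)) : IsRTT t u v (M * M') (N * N') := by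
  rw [IsRTT, tensorLeft_mul h₁, tensorRight_mul h₂, ← mul_assoc, h, mul_assoc, h', mul_assoc]

theorem isRTT_one (t u v : K) : IsRTT t u v (1 : Matrix (Fin 2) (Fin 2) E) 1 := by
  have h1 : tensorLeft (1 : Matrix (Fin 2) (Fin 2) E) 1 = 1 := by
    ext ⟨a, b⟩ ⟨c, d⟩
    by_cases h : a = c <;> by_cases h' : b = d <;> simp [tensorLeft, Matrix.one_apply, h, h']
  have h2 : tensorRight (1 : Matrix (Fin 2) (Fin 2) E) 1 = 1 := by
    ext ⟨a, b⟩ ⟨c, d⟩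
    by_cases h : a = c <;> by_cases h' : b = d <;> simp [tensorRight, Matrix.one_apply, h, h']
  rw [IsRTT, h1, h2, one_mul, mul_one]

/-- Sixteen scalar identities; the only relation between the two operators that enters is the
`q`-boson relation `h`. -/
theorem isRTT_lOp {t : K} (u v : K) {c a : E} (h : a * c = t • (c * a) + (1 - t) • 1) :
    IsRTT t u v !![1, u • c; a, u • 1] !![1, v • c; a, v • 1] := by
  have h' : ∀ x : K, algebraMap K E x = x • (1 : E) := Algebra.algebraMap_eq_smul_one
  ext ⟨p, p'⟩ ⟨q, q'⟩
  fin_cases p <;> fin_cases p' <;> fin_cases q <;> fin_cases q' <;>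
  · simp [Matrix.mul_apply, Fintype.sum_prod_type, rMatrix, tensorLeft, tensorRight, h', h,
      -map_sub, -map_mul]
    try module

variable {t u v : K} {M N : Matrix (Fin 2) (Fin 2) E}

theorem IsRTT.comm_B (h : IsRTT t u v M N) :
    (u - t * v) • (M 0 1 * N 0 1) = (u - t * v) • (N 0 1 * M 0 1) := by
  have := congrFun (congrFun h (0, 0)) (1, 1)
  simpa [Matrix.mul_apply, Fintype.sum_prod_type, rMatrix, tensorLeft, tensorRight,
      Algebra.algebraMap_eq_smul_one, -map_sub, -map_mul] using this

theorem IsRTT.comm_A (h : IsRTT t u v M N) :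
    (u - t * v) • (M 0 1 * N 0 0) = (u - v) • (N 0 0 * M 0 1) + ((1 - t) * u) • (N 0 1 * M 0 0) := by
  have := congrFun (congrFun h (0, 0)) (1, 0)
  simpa [Matrix.mul_apply, Fintype.sum_prod_type, rMatrix, tensorLeft, tensorRight,
      Algebra.algebraMap_eq_smul_one, -map_sub, -map_mul, add_comm] using this

theorem IsRTT.comm_D (h : IsRTT t u v M N) :
    (v - u) • (M 1 1 * N 0 1) =
      (t * v - u) • (N 0 1 * M 1 1) + ((1 - t) * v) • (M 0 1 * N 1 1) := by
  have h1 : (u - v) • (M 1 1 * N 0 1) + ((1 - t) * v) • (M 0 1 * N 1 1) =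
      (u - t * v) • (N 0 1 * M 1 1) := by
    have := congrFun (congrFun h (1, 0)) (1, 1)
    simpa [Matrix.mul_apply, Fintype.sum_prod_type, rMatrix, tensorLeft, tensorRight,
      Algebra.algebraMap_eq_smul_one, -map_sub, -map_mul, add_comm] using this
  rw [← neg_sub u v, ← neg_sub u, neg_smul, neg_smul, ← h1]
  abel

end YangBaxter

/-! ### The operators on the Fock space -/

section Fock

variable {n : ℕ}

/-- Operators are handled through coordinates of the image, which makes the commutation relations
pointwise. At `m i = 0` the truncated subtraction is harmless, since the factor is `1 - t^0 = 0`. -/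
theorem create_apply (i : Fin n) (v : Fock n) (m : Fin n → ℕ) :
    create i v m = (1 - tVar ^ m i) * v (Function.update m i (m i - 1)) := by
  induction v using Finsupp.induction_linear with
  | zero => rw [map_zero, Finsupp.zero_apply, Finsupp.zero_apply, mul_zero]
  | add v w hv hw => rw [map_add, Finsupp.add_apply, hv, hw, Finsupp.add_apply, mul_add]
  | single a c =>
    rw [create, Finsupp.linearCombination_single, Finsupp.smul_apply, Finsupp.smul_apply, ket,
      smul_eq_mul, smul_eq_mul]
    by_cases h : m i = 0
    · have h1 : Function.update a i (a i + 1) ≠ m := fun h2 => by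
        rw [← h2, Function.update_self] at h; lia
      rw [Finsupp.single_eq_of_ne' h1, h, pow_zero, sub_self, mul_zero, mul_zero, zero_mul]
    · by_cases h1 : a = Function.update m i (m i - 1)
      · have h2 : Function.update a i (a i + 1) = m := by
          rw [h1, Function.update_self, Function.update_idem, Nat.sub_add_cancel (by lia),
            Function.update_eq_self]
        have h3 : a i + 1 = m i := by rw [h1, Function.update_self]; lia
        rw [h2, h3, ← h1, Finsupp.single_eq_same, Finsupp.single_eq_same]
        ring
      · have h2 : Function.update a i (a i + 1) ≠ m := fun h2 => h1 (by
          rw [← h2, Function.update_self, Function.update_idem, Nat.add_sub_cancel,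
            Function.update_eq_self])
        rw [Finsupp.single_eq_of_ne' h2, Finsupp.single_eq_of_ne' h1]
        ring

theorem annihilate_apply (i : Fin n) (v : Fock n) (m : Fin n → ℕ) :
    annihilate i v m = v (Function.update m i (m i + 1)) := by
  induction v using Finsupp.induction_linear with
  | zero => rw [map_zero, Finsupp.zero_apply, Finsupp.zero_apply]
  | add v w hv hw => rw [map_add, Finsupp.add_apply, hv, hw, Finsupp.add_apply]
  | single a c =>
    rw [annihilate, Finsupp.linearCombination_single, Finsupp.smul_apply, smul_eq_mul]
    split_ifs with h
    · have h1 : a ≠ Function.update m i (m i + 1) := fun h1 => by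
        rw [h1, Function.update_self] at h; lia
      rw [Finsupp.single_eq_of_ne' h1, Finsupp.zero_apply, mul_zero]
    · by_cases h1 : a = Function.update m i (m i + 1)
      · have h2 : Function.update a i (a i - 1) = m := by
          rw [h1, Function.update_self, Function.update_idem, Nat.add_sub_cancel,
            Function.update_eq_self]
        rw [ket, h2, ← h1, Finsupp.single_eq_same, Finsupp.single_eq_same, mul_one]
      · have h2 : Function.update a i (a i - 1) ≠ m := fun h2 => h1 (by
          rw [← h2, Function.update_self, Function.update_idem, Nat.sub_add_cancel (by lia),
            Function.update_eq_self])
        rw [ket, Finsupp.single_eq_of_ne' h2, Finsupp.single_eq_of_ne' h1, mul_zero]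

theorem annihilate_mul_create (i : Fin n) :
    annihilate i * create i = tVar • (create i * annihilate i) + (1 - tVar) • 1 := by
  refine LinearMap.ext fun v => Finsupp.ext fun m => ?_
  rw [Module.End.mul_apply, LinearMap.add_apply, LinearMap.smul_apply, LinearMap.smul_apply,
    Module.End.mul_apply, Module.End.one_apply, Finsupp.add_apply, Finsupp.smul_apply,
    Finsupp.smul_apply, annihilate_apply, create_apply, create_apply, annihilate_apply,
    Function.update_self, Function.update_self, Function.update_idem, Function.update_idem,
    Nat.add_sub_cancel, Function.update_eq_self, smul_eq_mul, smul_eq_mul]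
  rcases Nat.eq_zero_or_pos (m i) with h | h
  · rw [h]; ring
  · rw [Nat.sub_add_cancel h, Function.update_eq_self]; ring

theorem commute_create_create {i j : Fin n} (h : i ≠ j) : Commute (create i) (create j) := by
  refine LinearMap.ext fun v => Finsupp.ext fun m => ?_
  simp only [Module.End.mul_apply, create_apply, Function.update_of_ne h, Function.update_of_ne h.symm]
  rw [Function.update_comm h]
  ring

theorem commute_annihilate_annihilate {i j : Fin n} (h : i ≠ j) :
    Commute (annihilate i) (annihilate j) := by
  refine LinearMap.ext fun v => Finsupp.ext fun m => ?_
  simp only [Module.End.mul_apply, annihilate_apply, Function.update_of_ne h,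
    Function.update_of_ne h.symm]
  rw [Function.update_comm h]

theorem commute_create_annihilate {i j : Fin n} (h : i ≠ j) :
    Commute (create i) (annihilate j) := by
  refine LinearMap.ext fun v => Finsupp.ext fun m => ?_
  simp only [Module.End.mul_apply, create_apply, annihilate_apply, Function.update_of_ne h,
    Function.update_of_ne h.symm]
  rw [Function.update_comm h]

theorem commute_lOp {i j : Fin n} (h : i ≠ j) (u v : Puiseux) (a b c d : Fin 2) :
    Commute (lOp u i a b) (lOp v j c d) := by
  have h1 := commute_create_create h
  have h2 := commute_annihilate_annihilate h
  have h3 := commute_create_annihilate h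
  have h4 := (commute_create_annihilate h.symm).symm
  have e : ∀ (w : Puiseux) (l : Fin n), lOp w l = !![1, w • create l; annihilate l, w • 1] :=
    fun _ _ => rfl
  rw [e, e]
  fin_cases a <;> fin_cases b <;> fin_cases c <;> fin_cases d <;>
  simp [Commute.one_left, Commute.one_right, Commute.smul_left, Commute.smul_right, h1, h2, h3, h4]

/-- The ordered product of the `L`-operators of a list of sites. -/
def lProd (l : List (Fin n)) (u : Puiseux) : Matrix (Fin 2) (Fin 2) (Module.End Puiseux (Fock n)) :=
  (l.map (lOp u)).prod

theorem lProd_nil (u : Puiseux) : lProd ([] : List (Fin n)) u = 1 := rfl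

theorem lProd_cons (i : Fin n) (l : List (Fin n)) (u : Puiseux) :
    lProd (i :: l) u = lOp u i * lProd l u := List.prod_cons

theorem monodromy_eq_lProd (u : Puiseux) :
    monodromy n u = lProd (List.ofFn (Fin.rev : Fin n → Fin n)) u := by
  rw [monodromy, lProd, List.map_ofFn]
  rfl

theorem nodup_ofFn_rev : (List.ofFn (Fin.rev : Fin n → Fin n)).Nodup :=
  List.nodup_ofFn.2 Fin.rev_injective

theorem commute_lProd {X : Module.End Puiseux (Fock n)} {l : List (Fin n)} {u : Puiseux}
    (h : ∀ i ∈ l, ∀ a b, Commute X (lOp u i a b)) (a b : Fin 2) :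
    Commute X (lProd l u a b) := by
  induction l generalizing a b with
  | nil =>
    rw [lProd_nil, Matrix.one_apply]
    split_ifs
    exacts [Commute.one_right _, Commute.zero_right _]
  | cons i l ih =>
    rw [lProd_cons, Matrix.mul_apply]
    exact Commute.sum_right _ _ _ fun c _ => (h i List.mem_cons_self a c).mul_right
      (ih (fun j hj => h j (List.mem_cons_of_mem _ hj)) c b)

theorem isRTT_lProd {l : List (Fin n)} (hl : l.Nodup) (u v : Puiseux) :
    IsRTT tVar u v (lProd l u) (lProd l v) := by
  induction l with
  | nil => exact isRTT_one _ _ _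
  | cons i l ih =>
    rw [List.nodup_cons] at hl
    rw [lProd_cons, lProd_cons]
    have h : ∀ (x y : Puiseux) (a b c d : Fin 2), Commute (lOp x i a b) (lProd l y c d) :=
      fun x y a b => commute_lProd fun j hj => commute_lOp (ne_of_mem_of_not_mem hj hl.1).symm x y a b
    exact (isRTT_lOp u v (annihilate_mul_create i)).mul (ih hl.2) (h v u) (h u v)

theorem isRTT_monodromy (u v : Puiseux) :
    IsRTT tVar u v (monodromy n u) (monodromy n v) := by
  rw [monodromy_eq_lProd, monodromy_eq_lProd]
  exact isRTT_lProd nodup_ofFn_rev u v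

theorem annihilate_ket_zero (i : Fin n) : annihilate i (ket 0) = 0 := by
  refine Finsupp.ext fun m => ?_
  rw [annihilate_apply, ket, Finsupp.single_eq_of_ne', Finsupp.zero_apply]
  intro h
  have := congrFun h i
  simp at this

theorem lProd_ket_zero {l : List (Fin n)} (hl : l.Nodup) (u : Puiseux) :
    lProd l u 0 0 (ket 0) = ket 0 ∧ lProd l u 1 0 (ket 0) = 0 ∧
      lProd l u 1 1 (ket 0) = u ^ l.length • ket 0 := by
  induction l with
  | nil => simp [lProd_nil]
  | cons i l ih =>
    rw [List.nodup_cons] at hl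
    obtain ⟨h1, h2, h3⟩ := ih hl.2
    -- The annihilation operator at site `i` passes through the entries of the other sites and
    -- reaches the vacuum, which it kills.
    have hc : Commute (annihilate i) (lProd l u 0 1) := commute_lProd (fun j hj =>
      commute_lOp (ne_of_mem_of_not_mem hj hl.1).symm u u 1 0) 0 1
    have h4 := LinearMap.congr_fun hc.eq (ket 0)
    rw [Module.End.mul_apply, Module.End.mul_apply, annihilate_ket_zero, map_zero] at h4
    simp only [lProd_cons, Matrix.mul_apply, Fin.sum_univ_two, LinearMap.add_apply,
      Module.End.mul_apply, h1, h2, h3, lOp, List.length_cons]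
    simp [h4, annihilate_ket_zero, pow_succ, mul_smul]

theorem monodromy_ket_zero (u : Puiseux) :
    monodromy n u 0 0 (ket 0) = ket 0 ∧ monodromy n u 1 1 (ket 0) = u ^ n • ket 0 := by
  rw [monodromy_eq_lProd]
  obtain ⟨h1, -, h3⟩ := lProd_ket_zero nodup_ofFn_rev u
  rw [List.length_ofFn] at h3
  exact ⟨h1, h3⟩

/-- The `RTT` relation gives commutation up to the factor `u - tv`, or `v - tu` with the roles
exchanged. Both vanish only for `u = v = 0`, because `t² ≠ 1`, and then there is nothing to prove.
-/
theorem opB_comm (u v : Puiseux) : opB n u * opB n v = opB n v * opB n u := by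
  have h1 := (isRTT_monodromy (n := n) u v).comm_B
  have h2 := (isRTT_monodromy (n := n) v u).comm_B
  by_cases h : u - tVar * v = 0
  · by_cases h' : v - tVar * u = 0
    · have hu : (1 - tVar ^ 2) * u = 0 := by linear_combination h + tVar * h'
      have hu0 := (mul_eq_zero.1 hu).resolve_left (one_sub_tVar_pow_ne_zero two_ne_zero)
      have hv0 : v = 0 := by rw [hu0, mul_zero, sub_zero] at h'; exact h'
      rw [hu0, hv0]
    · exact (smul_right_injective _ h' h2).symm
  · exact smul_right_injective _ h h1

theorem opA_opB {u v : Puiseux} (h : u ≠ v) :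
    monodromy n u 0 0 * opB n v =
      ((v - tVar * u) / (v - u)) • (opB n v * monodromy n u 0 0) +
        ((tVar - 1) * v / (v - u)) • (opB n u * monodromy n v 0 0) := by
  have h1 := (isRTT_monodromy (n := n) v u).comm_A
  have h2 : v - u ≠ 0 := sub_ne_zero.2 h.symm
  refine smul_right_injective _ h2 ?_
  simp only [smul_add, smul_smul, mul_div_cancel₀ _ h2]
  rw [opB, opB, h1]
  module

theorem opD_opB {u v : Puiseux} (h : u ≠ v) :
    monodromy n u 1 1 * opB n v =
      ((tVar * v - u) / (v - u)) • (opB n v * monodromy n u 1 1) +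
        (-((tVar - 1) * v / (v - u))) • (opB n u * monodromy n v 1 1) := by
  have h1 := (isRTT_monodromy (n := n) u v).comm_D
  have h2 : v - u ≠ 0 := sub_ne_zero.2 h.symm
  refine smul_right_injective _ h2 ?_
  simp only [smul_add, smul_smul, mul_neg, mul_div_cancel₀ _ h2]
  rw [opB, opB, h1]
  module

instance : LeftCommutative fun (u : Puiseux) (x : Fock n) => opB n u x where
  left_comm u v x := by
    rw [← Module.End.mul_apply, opB_comm, Module.End.mul_apply]

/-- The vector `∏_{v ∈ S} B(v) |∅⟩`. -/
def bVector (n : ℕ) (S : Multiset Puiseux) : Fock n :=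
  S.foldr (fun u x => opB n u x) (ket 0)

theorem bVector_cons (u : Puiseux) (S : Multiset Puiseux) :
    bVector n (u ::ₘ S) = opB n u (bVector n S) := Multiset.foldr_cons _ _ _ _

theorem betheVector_eq_bVector {k : ℕ} (y : Fin k → Puiseux) :
    betheVector n y = bVector n (Finset.univ.val.map fun i => (y i)⁻¹) := by
  have h : ∀ l : List Puiseux, (l.map (opB n)).prod (ket 0) = bVector n (l : Multiset Puiseux) := by
    intro l
    induction l with
    | nil => rfl
    | cons u l ih =>
      rw [List.map_cons, List.prod_cons, Module.End.mul_apply, ih, ← Multiset.cons_coe, bVector_cons]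
  have h2 : (List.ofFn fun i => opB n (y i)⁻¹) = (List.ofFn fun i => (y i)⁻¹).map (opB n) :=
    List.ofFn_comp' (fun i => (y i)⁻¹) (opB n)
  rw [betheVector, h2, h]
  congr 1
  simp

end Fock

/-! ### The algebraic Bethe ansatz -/

section BetheAnsatz

variable {n : ℕ}

/-- The off-shell action of an operator which satisfies an exchange relation with `B`. -/
theorem offShell [DecidableEq Puiseux]
    {X : Puiseux → Module.End Puiseux (Fock n)} {α : Puiseux → Puiseux}
    {f g : Puiseux → Puiseux → Puiseux}
    (hX : ∀ u v, u ≠ v → X u * opB n v = f u v • (opB n v * X u) + g u v • (opB n u * X v))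
    (h0 : ∀ u, X u (ket 0) = α u • ket 0)
    (hfg : ∀ u a w, u ≠ a → u ≠ w → a ≠ w → f u a * g u w + g u a * g a w = g u w * f w a)
    (S : Finset Puiseux) (u : Puiseux) (hu : u ∉ S) :
    X u (bVector n S.val) = (α u * ∏ v ∈ S, f u v) • bVector n S.val +
      ∑ j ∈ S, (α j * g u j * ∏ v ∈ S.erase j, f j v) •
        opB n u (bVector n (S.erase j).val) := by
  induction S using Finset.induction_on generalizing u with
  | empty => simp [bVector, h0]
  | insert a S ha ih =>
    rw [Finset.mem_insert, not_or] at hu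
    have h1 := LinearMap.congr_fun (hX u a hu.1) (bVector n S.val)
    rw [LinearMap.add_apply, LinearMap.smul_apply, LinearMap.smul_apply, Module.End.mul_apply,
      Module.End.mul_apply, Module.End.mul_apply, ih u hu.2, ih a ha] at h1
    rw [Finset.insert_val_of_notMem ha, bVector_cons, h1, Finset.sum_insert ha,
      Finset.prod_insert ha, Finset.erase_insert ha]
    simp only [map_add, map_smul, map_sum, smul_add, smul_smul, Finset.smul_sum]
    -- The term in which `j` is replaced by `u` arises in two ways: `X u` passes `B(a)` and is later
    -- exchanged at `j`, or it is exchanged at `a` and the resulting `X a` is exchanged at `j`. The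
    -- three-term identity `hfg` adds the two contributions.
    have h2 : ∑ j ∈ S, (α j * g u j * ∏ v ∈ (insert a S).erase j, f j v) •
          opB n u (bVector n ((insert a S).erase j).val) =
        ∑ j ∈ S, (f u a * (α j * g u j * ∏ v ∈ S.erase j, f j v)) •
          opB n a (opB n u (bVector n (S.erase j).val)) +
        ∑ j ∈ S, (g u a * (α j * g a j * ∏ v ∈ S.erase j, f j v)) •
          opB n u (opB n a (bVector n (S.erase j).val)) := by
      rw [← Finset.sum_add_distrib]
      refine Finset.sum_congr rfl fun j hj => ?_
      have haj : a ≠ j := fun h => ha (h ▸ hj)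
      have huj : u ≠ j := fun h => hu.2 (h ▸ hj)
      have haS : a ∉ S.erase j := fun h => ha (Finset.mem_of_mem_erase h)
      rw [Finset.erase_insert_of_ne haj, Finset.prod_insert haS, Finset.insert_val_of_notMem haS,
        bVector_cons, ← Module.End.mul_apply (opB n a), opB_comm, Module.End.mul_apply, ← add_smul]
      congr 1
      linear_combination (-α j * ∏ v ∈ S.erase j, f j v) * hfg u a j hu.1 huj haj
    rw [h2]
    have h3 : f u a * (α u * ∏ v ∈ S, f u v) = α u * (f u a * ∏ v ∈ S, f u v) := by ring
    have h4 : g u a * (α a * ∏ v ∈ S, f a v) = α a * g u a * ∏ v ∈ S, f a v := by ring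
    rw [h3, h4]
    abel

theorem opA_bVector [DecidableEq Puiseux] (S : Finset Puiseux) (u : Puiseux) (hu : u ∉ S) :
    monodromy n u 0 0 (bVector n S.val) =
      (∏ v ∈ S, (v - tVar * u) / (v - u)) • bVector n S.val +
      ∑ j ∈ S, ((tVar - 1) * j / (j - u) * ∏ v ∈ S.erase j, (v - tVar * j) / (v - j)) •
        opB n u (bVector n (S.erase j).val) := by
  have h := offShell (n := n) (X := fun u => monodromy n u 0 0) (α := fun _ => 1)
    (f := fun u v => (v - tVar * u) / (v - u)) (g := fun u v => (tVar - 1) * v / (v - u))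
    (fun u v => opA_opB) (fun u => by rw [one_smul]; exact (monodromy_ket_zero u).1)
    (fun u a w h1 h2 h3 => by
      have h4 := sub_ne_zero.2 h1.symm
      have h5 := sub_ne_zero.2 h2.symm
      have h6 := sub_ne_zero.2 h3
      have h7 := sub_ne_zero.2 h3.symm
      rw [show w - a = -(a - w) by ring]
      field_simp
      ring) S u hu
  simpa only [one_mul] using h

theorem opD_bVector [DecidableEq Puiseux] (S : Finset Puiseux) (u : Puiseux) (hu : u ∉ S) :
    monodromy n u 1 1 (bVector n S.val) =
      (u ^ n * ∏ v ∈ S, (tVar * v - u) / (v - u)) • bVector n S.val +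
      ∑ j ∈ S, (j ^ n * -((tVar - 1) * j / (j - u)) *
        ∏ v ∈ S.erase j, (tVar * v - j) / (v - j)) • opB n u (bVector n (S.erase j).val) :=
  offShell (n := n) (X := fun u => monodromy n u 1 1) (α := fun u => u ^ n)
    (f := fun u v => (tVar * v - u) / (v - u)) (g := fun u v => -((tVar - 1) * v / (v - u)))
    (fun u v => opD_opB) (fun u => (monodromy_ket_zero u).2)
    (fun u a w h1 h2 h3 => by
      have h4 := sub_ne_zero.2 h1.symm
      have h5 := sub_ne_zero.2 h2.symm
      have h6 := sub_ne_zero.2 h3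
      have h7 := sub_ne_zero.2 h3.symm
      rw [show w - a = -(a - w) by ring]
      field_simp
      ring) S u hu

variable {k : ℕ}

theorem betheVector_eq_bVector_image [DecidableEq Puiseux] {y : Fin k → Puiseux}
    (hinj : Function.Injective y) :
    betheVector n y = bVector n (Finset.univ.image fun i => (y i)⁻¹).val := by
  rw [betheVector_eq_bVector, Finset.image_val_of_injOn]
  exact (inv_injective.comp hinj).injOn

/-- The unwanted terms of `A(u)` and `D(u)` have opposite signs, and their sum vanishes exactly when
the Bethe equation of the corresponding root holds. The spectral parameters are `y_i⁻¹`, so the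
equation is first rewritten in the inverse variables. -/
theorem bethe_eigen_of_ne {y : Fin k → Puiseux} (hy : IsBetheSolution n y) {u : Puiseux}
    (hu : ∀ i, 1 - u * y i ≠ 0) :
    transferMatrix n u (betheVector n y) =
      (∏ i, (1 - u * y i * tVar) / (1 - u * y i) +
        tVar ^ k * u ^ n * ∏ i, (1 - u * tVar⁻¹ * y i) / (1 - u * y i)) • betheVector n y := by
  classical
  have hinj : Function.Injective fun i => (y i)⁻¹ := inv_injective.comp hy.2.1
  have huS : u ∉ Finset.univ.image fun i => (y i)⁻¹ := by
    intro h
    obtain ⟨i, -, rfl⟩ := Finset.mem_image.1 h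
    exact hu i (by rw [inv_mul_cancel₀ (hy.1 i), sub_self])
  rw [betheVector_eq_bVector_image hy.2.1, transferMatrix, LinearMap.add_apply,
    opA_bVector _ _ huS, opD_bVector _ _ huS, add_add_add_comm, ← add_smul,
    ← Finset.sum_add_distrib, Finset.sum_eq_zero, add_zero]
  · congr 1
    rw [Finset.prod_image hinj.injOn, Finset.prod_image hinj.injOn]
    have ht := tVar_ne_zero
    congr 1
    · refine Finset.prod_congr rfl fun i _ => ?_
      have h1 := hy.1 i
      have h2 : (y i)⁻¹ - u = (1 - u * y i) * (y i)⁻¹ := by field_simp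
      have h3 := hu i
      rw [h2]
      field_simp
    · have h5 : tVar ^ k = ∏ _i : Fin k, tVar := by simp
      rw [mul_comm (tVar ^ k), mul_assoc, h5, ← Finset.prod_mul_distrib]
      congr 1
      refine Finset.prod_congr rfl fun i _ => ?_
      have h1 := hy.1 i
      have h2 : (y i)⁻¹ - u = (1 - u * y i) * (y i)⁻¹ := by field_simp
      have h3 := hu i
      rw [h2]
      field_simp
  · intro j hj
    obtain ⟨i, -, rfl⟩ := Finset.mem_image.1 hj
    rw [← add_smul]
    have h1 : ∀ F : Puiseux → Puiseux,
        ∏ v ∈ (Finset.univ.image fun i => (y i)⁻¹).erase (y i)⁻¹, F v =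
          ∏ l ∈ Finset.univ.erase i, F (y l)⁻¹ := fun F => by
      rw [← Finset.image_erase hinj, Finset.prod_image hinj.injOn]
    rw [h1, h1]
    have h2 : (y i)⁻¹ ^ n * ∏ l ∈ Finset.univ.erase i,
          (tVar * (y l)⁻¹ - (y i)⁻¹) / ((y l)⁻¹ - (y i)⁻¹) =
        ∏ l ∈ Finset.univ.erase i, ((y l)⁻¹ - tVar * (y i)⁻¹) / ((y l)⁻¹ - (y i)⁻¹) := by
      have h3 : ∀ l ∈ Finset.univ.erase i,
          (tVar * (y l)⁻¹ - (y i)⁻¹) / ((y l)⁻¹ - (y i)⁻¹) =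
            (tVar * y i - y l) / (y i - y l) := fun l hl => by
        have h4 := sub_ne_zero.2 (hy.2.1.ne (Finset.ne_of_mem_erase hl).symm)
        have h5 := hy.1 i
        have h6 := hy.1 l
        have h7 : (y l)⁻¹ - (y i)⁻¹ = (y i - y l) * ((y i)⁻¹ * (y l)⁻¹) := by field_simp
        rw [h7]
        field_simp
      have h3' : ∀ l ∈ Finset.univ.erase i,
          ((y l)⁻¹ - tVar * (y i)⁻¹) / ((y l)⁻¹ - (y i)⁻¹) =
            (y i - tVar * y l) / (y i - y l) := fun l hl => by
        have h4 := sub_ne_zero.2 (hy.2.1.ne (Finset.ne_of_mem_erase hl).symm)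
        have h5 := hy.1 i
        have h6 := hy.1 l
        have h7 : (y l)⁻¹ - (y i)⁻¹ = (y i - y l) * ((y i)⁻¹ * (y l)⁻¹) := by field_simp
        rw [h7]
        field_simp
      rw [Finset.prod_congr rfl h3, Finset.prod_congr rfl h3', ← hy.2.2 i, ← mul_assoc, ← mul_pow,
        inv_mul_cancel₀ (hy.1 i), one_pow, one_mul]
    rw [← h2]
    convert zero_smul Puiseux _ using 2
    ring

-- Polynomial dependence on `u`, coordinate by coordinate, is what extends the eigenvalue equation
-- to the excluded values `u = y_i⁻¹`.
open Polynomial in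
theorem exists_poly_lProd (l : List (Fin n)) (a b : Fin 2) (v : Fock n) (m : Fin n → ℕ) :
    ∃ p : Puiseux[X], ∀ u, lProd l u a b v m = p.eval u := by
  induction l generalizing a m with
  | nil =>
    refine ⟨C ((1 : Matrix (Fin 2) (Fin 2) (Module.End Puiseux (Fock n))) a b v m), fun u => ?_⟩
    rw [lProd_nil, eval_C]
  | cons i l ih =>
    have hmul : ∀ u, lProd (i :: l) u a b v =
        lOp u i a 0 (lProd l u 0 b v) + lOp u i a 1 (lProd l u 1 b v) := fun u => by
      rw [lProd_cons, Matrix.mul_apply, Fin.sum_univ_two, LinearMap.add_apply,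
        Module.End.mul_apply, Module.End.mul_apply]
    simp_rw [hmul]
    fin_cases a
    · obtain ⟨p, hp⟩ := ih 0 m
      obtain ⟨p', hp'⟩ := ih 1 (Function.update m i (m i - 1))
      refine ⟨p + X * (C (1 - tVar ^ m i) * p'), fun u => ?_⟩
      rw [eval_add, eval_mul, eval_X, eval_mul, eval_C, ← hp, ← hp']
      simp [lOp, create_apply]
    · obtain ⟨p, hp⟩ := ih 0 (Function.update m i (m i + 1))
      obtain ⟨p', hp'⟩ := ih 1 m
      refine ⟨p + X * p', fun u => ?_⟩
      rw [eval_add, eval_mul, eval_X, ← hp, ← hp']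
      simp [lOp, annihilate_apply]

open Polynomial in
theorem bethe_eigen {y : Fin k → Puiseux} (hy : IsBetheSolution n y) {L : Puiseux[X]}
    (hL : tqRhs tVar n k (qPoly y) = qPoly y * L) (u : Puiseux) :
    transferMatrix n u (betheVector n y) = L.eval u • betheVector n y := by
  refine Finsupp.ext fun m => ?_
  obtain ⟨p, hp⟩ := exists_poly_lProd (List.ofFn (Fin.rev : Fin n → Fin n)) 0 0 (betheVector n y) m
  obtain ⟨p', hp'⟩ := exists_poly_lProd (List.ofFn (Fin.rev : Fin n → Fin n)) 1 1
    (betheVector n y) m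
  have h1 : ∀ u, transferMatrix n u (betheVector n y) m = (p + p').eval u := fun u => by
    rw [transferMatrix, monodromy_eq_lProd, LinearMap.add_apply, Finsupp.add_apply, hp, hp',
      eval_add]
  -- Two polynomials that agree off the finite set of the `y_i⁻¹` are equal.
  have h2 : p + p' = L * C (betheVector n y m) := by
    refine eq_of_infinite_eval_eq _ _
      ((Set.Finite.infinite_compl (Set.finite_range fun i => (y i)⁻¹)).mono ?_)
    intro u hu
    have hu' : ∀ i, 1 - u * y i ≠ 0 := fun i h => hu ⟨i,
      (eq_inv_of_mul_eq_one_left (by linear_combination -h)).symm⟩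
    rw [Set.mem_ofPred_eq, ← h1, bethe_eigen_of_ne hy hu', ← tq_eval tVar_ne_zero hL hu', eval_mul,
      eval_C, Finsupp.smul_apply, smul_eq_mul]
  rw [h1, h2, eval_mul, eval_C, Finsupp.smul_apply, smul_eq_mul]

/-- No path that creates a particle at a site of `l` contributes to a coordinate where this site is
empty, by the factor `1 - t^0`. Only creation at `i₀` remains. -/
theorem lProd_append_apply {i₀ : Fin n} (l : List (Fin n)) (u : Puiseux) (v : Fock n)
    (m : Fin n → ℕ) (hm : ∀ i ∈ l, m i = 0) :
    lProd (l ++ [i₀]) u 0 1 v m =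
      u * (1 - tVar ^ m i₀) * v (Function.update m i₀ (m i₀ - 1)) := by
  induction l with
  | nil =>
    rw [List.nil_append, lProd_cons, lProd_nil, mul_one]
    simp [lOp, create_apply, mul_assoc]
  | cons i l ih =>
    rw [List.cons_append, lProd_cons, Matrix.mul_apply, Fin.sum_univ_two, LinearMap.add_apply,
      Module.End.mul_apply, Module.End.mul_apply, Finsupp.add_apply]
    have h1 : lOp u i 0 0 = 1 := rfl
    have h2 : lOp u i 0 1 = u • create i := rfl
    rw [h1, h2, Module.End.one_apply, ih fun j hj => hm j (List.mem_cons_of_mem _ hj),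
      LinearMap.smul_apply, Finsupp.smul_apply, create_apply, hm i List.mem_cons_self]
    simp

theorem opB_apply_single {n : ℕ} (u : Puiseux) (v : Fock (n + 1)) (r : ℕ) :
    opB (n + 1) u v (Pi.single 0 (r + 1)) = u * (1 - tVar ^ (r + 1)) * v (Pi.single 0 r) := by
  have h : List.ofFn (Fin.rev : Fin (n + 1) → Fin (n + 1)) =
      (List.ofFn fun i : Fin n => i.rev.succ) ++ [0] := by
    rw [List.ofFn_succ', List.concat_eq_append, Fin.rev_last]
    simp only [Fin.rev_castSucc]
  rw [opB, monodromy_eq_lProd, h, lProd_append_apply]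
  · rw [Pi.single_eq_same, Nat.add_sub_cancel]
    congr 2
    ext i
    by_cases hi : i = 0
    · subst hi; simp
    · simp [hi]
  · intro i hi
    rw [List.mem_ofFn] at hi
    obtain ⟨j, rfl⟩ := hi
    simp

/-- The coordinate with all `k` particles at the first site is computed one factor `B(u)` at a time;
each contributes a factor `u (1 - t^{r+1})`, which is non-zero. -/
theorem betheVector_ne_zero (hn : 0 < n) {y : Fin k → Puiseux} (hy : ∀ i, y i ≠ 0) :
    betheVector n y ≠ 0 := by
  obtain ⟨n, rfl⟩ := Nat.exists_eq_add_one_of_ne_zero hn.ne'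
  have h : ∀ S : Multiset Puiseux, (∀ u ∈ S, u ≠ 0) →
      bVector (n + 1) S (Pi.single 0 S.card) ≠ 0 := by
    intro S
    induction S using Multiset.induction_on with
    | empty => intro _; simp [bVector, ket]
    | cons u S ih =>
      intro hS
      rw [bVector_cons, Multiset.card_cons, opB_apply_single]
      exact mul_ne_zero (mul_ne_zero (hS u (Multiset.mem_cons_self u S))
        (one_sub_tVar_pow_ne_zero (Nat.succ_ne_zero _)))
        (ih fun v hv => hS v (Multiset.mem_cons_of_mem hv))
  rw [betheVector_eq_bVector]
  intro h0
  refine h (Finset.univ.val.map fun i => (y i)⁻¹) ?_ (by rw [h0, Finsupp.zero_apply])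
  intro u hu
  obtain ⟨i, -, rfl⟩ := Multiset.mem_map.1 hu
  exact inv_ne_zero (hy i)

end BetheAnsatz

/-! ### Formal fixed points and lifting of the solutions at `t = 0` -/

section FixedPoint

open PowerSeries

theorem eq_of_forall_X_pow_dvd {R : Type*} [CommRing R] {f g : R⟦X⟧}
    (h : ∀ m, X ^ m ∣ f - g) : f = g := by
  ext m
  have := X_pow_dvd_iff.1 (h (m + 1)) m (Nat.lt_succ_self m)
  rwa [map_sub, sub_eq_zero] at this

variable {R ι : Type*} [CommRing R] {Ψ : (ι → R⟦X⟧) → (ι → R⟦X⟧)}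

/-- `Ψ` is a contraction, for the `X`-adic metric, of the tuples of series with constant
coefficient `1`. -/
structure IsContraction (Ψ : (ι → R⟦X⟧) → (ι → R⟦X⟧)) : Prop where
  mapsTo : ∀ w, (∀ i, X ∣ w i - 1) → ∀ i, X ∣ Ψ w i - 1
  contract : ∀ m w w', (∀ i, X ∣ w i - 1) → (∀ i, X ∣ w' i - 1) →
    (∀ i, X ^ (m + 1) ∣ w i - w' i) → ∀ i, X ^ (m + 2) ∣ Ψ w i - Ψ w' i

theorem IsContraction.eq (h : IsContraction Ψ) {w w' : ι → R⟦X⟧} (hw : ∀ i, X ∣ w i - 1)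
    (hw' : ∀ i, X ∣ w' i - 1) (e : Ψ w = w) (e' : Ψ w' = w') : w = w' := by
  have key : ∀ m, ∀ i, X ^ (m + 1) ∣ w i - w' i := by
    intro m
    induction m with
    | zero =>
      intro i
      rw [zero_add, pow_one, ← sub_sub_sub_cancel_right _ _ 1]
      exact dvd_sub (hw i) (hw' i)
    | succ m ih =>
      intro i
      have := h.contract m w w' hw hw' ih i
      rwa [e, e'] at this
  exact funext fun i => eq_of_forall_X_pow_dvd fun m =>
    (pow_dvd_pow X (Nat.le_succ m)).trans (key m i)

/-- Banach's argument: the iterates starting from `1` converge `X`-adically, the `m`-th iterate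
being correct modulo `X^(m+1)`. Hence the `m`-th coefficient of the limit is read off from the
`m`-th iterate. -/
theorem IsContraction.exists_fixed (h : IsContraction Ψ) :
    ∃ w, (∀ i, X ∣ w i - 1) ∧ Ψ w = w := by
  set W : ℕ → ι → R⟦X⟧ := fun m => Ψ^[m] 1 with hW
  have hsucc : ∀ m, W (m + 1) = Ψ (W m) := fun m => Function.iterate_succ_apply' Ψ m 1
  have h1 : ∀ m i, X ∣ W m i - 1 := by
    intro m
    induction m with
    | zero => intro i; simp [hW]
    | succ m ih => rw [hsucc]; exact h.mapsTo _ ih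
  have h2 : ∀ m i, X ^ (m + 1) ∣ W (m + 1) i - W m i := by
    intro m
    induction m with
    | zero => intro i; rw [zero_add, pow_one]; exact h1 1 i
    | succ m ih =>
      intro i
      rw [hsucc (m + 1), hsucc m]
      exact h.contract m _ _ (by rw [← hsucc]; exact h1 _) (h1 m) (by rw [← hsucc]; exact ih) i
  have h3 : ∀ m m' i, m ≤ m' → X ^ (m + 1) ∣ W m' i - W m i := by
    intro m m' i hm
    induction m', hm using Nat.le_induction with
    | base => simp
    | succ m' hm ih =>
      rw [← sub_add_sub_cancel]
      exact dvd_add ((pow_dvd_pow X (by lia)).trans (h2 m' i)) ih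
  set w : ι → R⟦X⟧ := fun i => PowerSeries.mk fun m => coeff m (W m i) with hw
  have h4 : ∀ m i, X ^ (m + 1) ∣ w i - W m i := by
    intro m i
    rw [X_pow_dvd_iff]
    intro j hj
    have := X_pow_dvd_iff.1 (h3 j m i (by lia)) j (Nat.lt_succ_self j)
    rw [map_sub, sub_eq_zero] at this
    rw [map_sub, hw, coeff_mk, this, sub_self]
  have h5 : ∀ i, X ∣ w i - 1 := fun i => by simpa [hW] using h4 0 i
  refine ⟨w, h5, funext fun i => eq_of_forall_X_pow_dvd fun m => ?_⟩
  refine (pow_dvd_pow X (by lia : m ≤ m + 2)).trans ?_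
  have h6 := h.contract m w (W m) h5 (h1 m) (h4 m) i
  rw [← hsucc] at h6
  rw [← sub_sub_sub_cancel_right _ _ (W (m + 1) i)]
  exact dvd_sub h6 (h4 (m + 1) i)

end FixedPoint

/-! ### The Bethe equations over `F⟦t⟧` -/

section Lift

open PowerSeries

variable {F : Type*} [Field F]

theorem constantCoeff_eq_one {w : F⟦X⟧} (h : X ∣ w - 1) : constantCoeff w = 1 := by
  have := X_dvd_iff.1 h
  rwa [map_sub, map_one, sub_eq_zero] at this

theorem X_dvd_sub_one {w : F⟦X⟧} (h : constantCoeff w = 1) : X ∣ w - 1 := by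
  rw [X_dvd_iff, map_sub, h, map_one, sub_self]

theorem mul_inv_of_X_dvd {w : F⟦X⟧} (h : X ∣ w - 1) : w * w⁻¹ = 1 :=
  PowerSeries.mul_inv_cancel _ (by rw [constantCoeff_eq_one h]; exact one_ne_zero)

theorem dvd_mul_sub_mul' {A : Type*} [CommRing A] {d a b a' b' : A} (h : d ∣ a - a')
    (h' : d ∣ b - b') : d ∣ a * b - a' * b' := by
  have : a * b - a' * b' = (a - a') * b + a' * (b - b') := by ring
  rw [this]
  exact dvd_add (h.mul_right _) (h'.mul_left _)

theorem dvd_prod_sub_prod {A ι : Type*} [CommRing A] {d : A} (s : Finset ι) {f g : ι → A}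
    (h : ∀ i ∈ s, d ∣ f i - g i) : d ∣ ∏ i ∈ s, f i - ∏ i ∈ s, g i := by
  classical
  induction s using Finset.induction_on with
  | empty => simp
  | insert a s ha ih =>
    rw [Finset.prod_insert ha, Finset.prod_insert ha]
    exact dvd_mul_sub_mul' (h a (Finset.mem_insert_self a s))
      (ih fun i hi => h i (Finset.mem_insert_of_mem hi))

theorem dvd_inv_sub_inv {d w w' : F⟦X⟧} (hw : X ∣ w - 1) (hw' : X ∣ w' - 1) (h : d ∣ w - w') :
    d ∣ w⁻¹ - w'⁻¹ := by
  have h1 := mul_inv_of_X_dvd hw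
  have h2 := mul_inv_of_X_dvd hw'
  have : w⁻¹ - w'⁻¹ = (w - w') * (-(w⁻¹ * w'⁻¹)) := by
    linear_combination (-w⁻¹) * h2 + w'⁻¹ * h1
  rw [this]
  exact h.mul_right _

/-- The cofactor `1 + w + ⋯ + w^{N-1}` of `w - 1` has constant term `N ≠ 0`, so it cannot vanish. -/
theorem eq_one_of_pow_eq_one [CharZero F] {w : F⟦X⟧} (hw : X ∣ w - 1) {N : ℕ} (hN : N ≠ 0)
    (h : w ^ N = 1) : w = 1 := by
  have h1 := geom_sum_mul w N
  rw [h, sub_self, mul_eq_zero] at h1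
  refine sub_eq_zero.1 (h1.resolve_left fun h2 => ?_)
  have h3 := congrArg constantCoeff h2
  rw [map_sum] at h3
  simp [constantCoeff_eq_one hw, hN] at h3

variable {k : ℕ}

/-- The series `1 - t y_i / y_j` for `y_i = a_i w_i`. -/
def alphaSeries (a : Fin k → F) (w : Fin k → F⟦X⟧) (i j : Fin k) : F⟦X⟧ :=
  1 - X * (C (a i * (a j)⁻¹) * (w i * (w j)⁻¹))

/-- The right-hand side `∏ (1 - t y_i / y_j) / (1 - t y_j / y_i)` of the Bethe equations. -/
def betheSeries (a : Fin k → F) (w : Fin k → F⟦X⟧) (i : Fin k) : F⟦X⟧ :=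
  ∏ j ∈ Finset.univ.erase i, alphaSeries a w i j * (alphaSeries a w j i)⁻¹

theorem X_dvd_alphaSeries (a : Fin k → F) (w : Fin k → F⟦X⟧) (i j : Fin k) :
    X ∣ alphaSeries a w i j - 1 := by
  rw [alphaSeries, sub_sub_cancel_left, dvd_neg]
  exact dvd_mul_right _ _

theorem X_dvd_inv {w : F⟦X⟧} (h : X ∣ w - 1) : X ∣ w⁻¹ - 1 := by
  have := dvd_inv_sub_inv h (w' := 1) (by simp) h
  rwa [(PowerSeries.inv_eq_iff_mul_eq_one (by simp)).2 (one_mul (1 : F⟦X⟧))] at this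

theorem X_dvd_betheSeries (a : Fin k → F) (w : Fin k → F⟦X⟧) (i : Fin k) :
    X ∣ betheSeries a w i - 1 := by
  have := dvd_prod_sub_prod (d := (X : F⟦X⟧)) (Finset.univ.erase i)
    (f := fun j => alphaSeries a w i j * (alphaSeries a w j i)⁻¹) (g := fun _ => 1 * 1)
    fun j _ => dvd_mul_sub_mul' (X_dvd_alphaSeries a w i j) (X_dvd_inv (X_dvd_alphaSeries a w j i))
  simpa [betheSeries] using this

/-- The explicit factor `X` in front of `y_i / y_j` gains one order of precision. This makes the
right-hand side of the Bethe equations contracting. -/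
theorem alphaSeries_congr (a : Fin k → F) {w w' : Fin k → F⟦X⟧} {m : ℕ}
    (hw : ∀ i, X ∣ w i - 1) (hw' : ∀ i, X ∣ w' i - 1) (h : ∀ i, X ^ m ∣ w i - w' i)
    (i j : Fin k) : X ^ (m + 1) ∣ alphaSeries a w i j - alphaSeries a w' i j := by
  have h1 := dvd_mul_sub_mul' (h i) (dvd_inv_sub_inv (hw j) (hw' j) (h j))
  have h2 : alphaSeries a w i j - alphaSeries a w' i j =
      X * ((w i * (w j)⁻¹ - w' i * (w' j)⁻¹) * -C (a i * (a j)⁻¹)) := by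
    rw [alphaSeries, alphaSeries]; ring
  rw [h2, pow_succ']
  exact mul_dvd_mul_left _ (h1.mul_right _)

theorem betheSeries_congr (a : Fin k → F) {w w' : Fin k → F⟦X⟧} {m : ℕ}
    (hw : ∀ i, X ∣ w i - 1) (hw' : ∀ i, X ∣ w' i - 1) (h : ∀ i, X ^ m ∣ w i - w' i)
    (i : Fin k) : X ^ (m + 1) ∣ betheSeries a w i - betheSeries a w' i :=
  dvd_prod_sub_prod _ fun j _ => dvd_mul_sub_mul' (alphaSeries_congr a hw hw' h i j)
    (dvd_inv_sub_inv (X_dvd_alphaSeries _ _ _ _) (X_dvd_alphaSeries _ _ _ _)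
      (alphaSeries_congr a hw hw' h j i))

/-- A Newton step for `w_i ^ N = betheSeries a w i`. -/
def newtonStep (N : ℕ) (a : Fin k → F) (w : Fin k → F⟦X⟧) (i : Fin k) : F⟦X⟧ :=
  w i - C (N : F)⁻¹ * (w i ^ N - betheSeries a w i)

theorem newtonStep_eq_iff [CharZero F] {N : ℕ} (hN : N ≠ 0) (a : Fin k → F) (w : Fin k → F⟦X⟧) :
    newtonStep N a w = w ↔ ∀ i, w i ^ N = betheSeries a w i := by
  have hC : (C (N : F)⁻¹ : F⟦X⟧) ≠ 0 := by simpa using hN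
  rw [funext_iff]
  refine forall_congr' fun i => ?_
  rw [newtonStep, sub_eq_self, mul_eq_zero, or_iff_right hC, sub_eq_zero]

/-- For `w`, `w'` with constant terms `1`, the difference `w^N - w'^N` is `w - w'` times a series
congruent to `N` modulo `X`. The factor `N⁻¹` thus cancels the linear part and leaves an error of
one higher order, as does the `betheSeries` term. -/
theorem isContraction_newtonStep [CharZero F] {N : ℕ} (hN : N ≠ 0) (a : Fin k → F) :
    IsContraction (newtonStep N a) where
  mapsTo w hw i := by
    have h1 : X ∣ w i ^ N - 1 := (hw i).trans (sub_one_dvd_pow_sub_one _ _)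
    have h2 := dvd_sub h1 (X_dvd_betheSeries a w i)
    rw [sub_sub_sub_cancel_right] at h2
    rw [newtonStep, sub_right_comm]
    exact dvd_sub (hw i) (h2.mul_left _)
  contract m w w' hw hw' h i := by
    have h1 := betheSeries_congr a hw hw' h i
    have h2 := (Commute.all (w i) (w' i)).geom_sum₂_mul N
    have h3 : X ∣ ∑ l ∈ Finset.range N, w i ^ l * w' i ^ (N - 1 - l) - C (N : F) := by
      rw [X_dvd_iff, map_sub, map_sum]
      simp [constantCoeff_eq_one (hw i), constantCoeff_eq_one (hw' i)]
    have hC : (C (N : F)⁻¹ : F⟦X⟧) * C (N : F) = 1 := by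
      rw [← map_mul, inv_mul_cancel₀ (by exact_mod_cast hN), map_one]
    have h4 : newtonStep N a w i - newtonStep N a w' i =
        C (N : F)⁻¹ * (betheSeries a w i - betheSeries a w' i) -
        C (N : F)⁻¹ * ((w i - w' i) *
          (∑ l ∈ Finset.range N, w i ^ l * w' i ^ (N - 1 - l) - C (N : F))) := by
      rw [newtonStep, newtonStep]
      linear_combination C (N : F)⁻¹ * h2 - (w i - w' i) * hC
    rw [h4]
    refine dvd_sub (h1.mul_left _) (Dvd.dvd.mul_left ?_ _)
    rw [pow_succ]
    exact mul_dvd_mul (h i) h3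

/-- The factors for `(i, j)` and `(j, i)` are inverse to each other. Hence the product of the `w_i`
is a root of unity, and so constant. -/
theorem prod_betheSeries (a : Fin k → F) (w : Fin k → F⟦X⟧) : ∏ i, betheSeries a w i = 1 := by
  have h : ∀ f : Fin k → Fin k → F⟦X⟧, ∏ i, ∏ j ∈ Finset.univ.erase i, f i j =
      ∏ i, ∏ j ∈ Finset.univ.erase i, f j i := fun f =>
    Finset.prod_comm' fun i j => by simp [ne_comm]
  simp only [betheSeries, Finset.prod_mul_distrib]
  rw [h fun i j => (alphaSeries a w j i)⁻¹, ← Finset.prod_mul_distrib]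
  refine Finset.prod_eq_one fun i _ => ?_
  rw [← Finset.prod_mul_distrib]
  exact Finset.prod_eq_one fun j _ => mul_inv_of_X_dvd (X_dvd_alphaSeries a w i j)

/-- Lifting of a solution `a` at `t = 0` to a solution over `F⟦t⟧`. -/
theorem lift_equation [CharZero F] {n : ℕ} {a : Fin k → F} (ha : ∀ i, a i ≠ 0)
    (h : ∀ i, a i ^ (n + k) = (-1) ^ (k - 1) * ∏ j, a j) {w : Fin k → F⟦X⟧}
    (hw : ∀ i, X ∣ w i - 1) (hfix : ∀ i, w i ^ (n + k) = betheSeries a w i) (i : Fin k) :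
    (C (a i) * w i) ^ n * ∏ j ∈ Finset.univ.erase i, (C (a i) * w i - X * (C (a j) * w j)) =
      ∏ j ∈ Finset.univ.erase i, (X * (C (a i) * w i) - C (a j) * w j) := by
  have hk : 0 < k := i.pos
  have hwinv : ∀ j, w j * (w j)⁻¹ = 1 := fun j => mul_inv_of_X_dvd (hw j)
  have hainv : ∀ j, (C (a j) : F⟦X⟧) * C (a j)⁻¹ = 1 := fun j => by
    rw [← map_mul, mul_inv_cancel₀ (ha j), map_one]
  -- The product of all roots does not move under the lift, so the constant `∏ a_j` of the equation
  -- at `t = 0` is also the product of the lifted roots.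
  have hprod : ∏ j, w j = 1 := by
    refine eq_one_of_pow_eq_one ?_ (by lia : n + k ≠ 0) ?_
    · have := dvd_prod_sub_prod (d := (X : F⟦X⟧)) Finset.univ (f := w) (g := fun _ => 1)
        fun j _ => hw j
      simpa using this
    · rw [← Finset.prod_pow, Finset.prod_congr rfl fun j _ => hfix j, prod_betheSeries]
  have h1 : ∏ j ∈ Finset.univ.erase i, (C (a i) * w i - X * (C (a j) * w j)) =
      (C (a i) * w i) ^ (k - 1) * ∏ j ∈ Finset.univ.erase i, alphaSeries a w j i := by
    have : ∏ _j ∈ Finset.univ.erase i, (C (a i) * w i) = (C (a i) * w i) ^ (k - 1) := by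
      rw [Finset.prod_const, Finset.card_erase_of_mem (Finset.mem_univ i), Finset.card_univ,
        Fintype.card_fin]
    rw [← this, ← Finset.prod_mul_distrib]
    refine Finset.prod_congr rfl fun j _ => ?_
    rw [alphaSeries, map_mul]
    linear_combination (X * C (a j) * w j) * hainv i + (X * C (a j) * w j * C (a i) * C (a i)⁻¹) * hwinv i
  have h2 : ∏ j ∈ Finset.univ.erase i, (X * (C (a i) * w i) - C (a j) * w j) =
      (-1) ^ (k - 1) * (∏ j ∈ Finset.univ.erase i, (C (a j) * w j)) *
        ∏ j ∈ Finset.univ.erase i, alphaSeries a w i j := by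
    have : ∏ _j ∈ Finset.univ.erase i, (-1 : F⟦X⟧) = (-1) ^ (k - 1) := by
      rw [Finset.prod_const, Finset.card_erase_of_mem (Finset.mem_univ i), Finset.card_univ,
        Fintype.card_fin]
    rw [← this, ← Finset.prod_mul_distrib, ← Finset.prod_mul_distrib]
    refine Finset.prod_congr rfl fun j _ => ?_
    rw [alphaSeries, map_mul]
    linear_combination (-X * C (a i) * w i) * hainv j - (X * C (a i) * w i * C (a j) * C (a j)⁻¹) * hwinv j
  have h3 : betheSeries a w i * ∏ j ∈ Finset.univ.erase i, alphaSeries a w j i =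
      ∏ j ∈ Finset.univ.erase i, alphaSeries a w i j := by
    rw [betheSeries, ← Finset.prod_mul_distrib]
    refine Finset.prod_congr rfl fun j _ => ?_
    have := mul_inv_of_X_dvd (X_dvd_alphaSeries a w j i)
    linear_combination alphaSeries a w i j * this
  have h4 : (C (a i) * w i) * ∏ j ∈ Finset.univ.erase i, (C (a j) * w j) = C (∏ j, a j) := by
    rw [Finset.mul_prod_erase _ (fun j => C (a j) * w j) (Finset.mem_univ i),
      Finset.prod_mul_distrib, hprod, mul_one,
      map_prod]
  have h5 : (C (a i) * w i) ^ (n + k) =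
      (-1) ^ (k - 1) * C (∏ j, a j) * betheSeries a w i := by
    rw [mul_pow, ← map_pow, h i, hfix i, map_mul, map_pow, map_neg, map_one]
  have hne : C (a i) * w i ≠ 0 := by
    refine mul_ne_zero (by simpa using ha i) fun h0 => ?_
    have := hwinv i
    rw [h0, zero_mul] at this
    exact zero_ne_one this
  refine mul_left_cancel₀ hne ?_
  rw [h1, h2]
  have h6 : (C (a i) * w i) ^ (n + k) = (C (a i) * w i) * ((C (a i) * w i) ^ n *
      (C (a i) * w i) ^ (k - 1)) := by
    rw [← pow_add, ← pow_succ']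
    congr 1
    lia
  rw [h6] at h5
  rw [← h3]
  linear_combination (∏ j ∈ Finset.univ.erase i, alphaSeries a w j i) * h5 -
    (-1) ^ (k - 1) * (betheSeries a w i * ∏ j ∈ Finset.univ.erase i, alphaSeries a w j i) * h4

theorem map_inv_of_X_dvd (σ : F →+* F) {w : F⟦X⟧} (h : X ∣ w - 1) :
    PowerSeries.map σ w⁻¹ = (PowerSeries.map σ w)⁻¹ := by
  have h2 : constantCoeff (PowerSeries.map σ w) = 1 := by
    rw [← coeff_zero_eq_constantCoeff_apply, coeff_map, coeff_zero_eq_constantCoeff_apply,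
      constantCoeff_eq_one h, map_one]
  rw [PowerSeries.eq_inv_iff_mul_eq_one (by rw [h2]; exact one_ne_zero), ← map_mul, mul_comm,
    mul_inv_of_X_dvd h, map_one]

/-- A solution which lifts a solution on the unit circle stays on the "unit circle". -/
theorem map_fixed_eq_inv [CharZero F] {N : ℕ} (hN : N ≠ 0) {a : Fin k → F} (σ : F →+* F)
    (hσ : ∀ i, σ (a i) = (a i)⁻¹) {w : Fin k → F⟦X⟧}
    (hw : ∀ i, X ∣ w i - 1) (hfix : ∀ i, w i ^ N = betheSeries a w i) (i : Fin k) :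
    PowerSeries.map σ (w i) = (w i)⁻¹ := by
  -- Conjugate and invert: since `σ(a_i) = a_i⁻¹`, the conjugate of the series for `(i, j)` is the
  -- series of `w'` for `(j, i)`. So `w'` solves the same fixed point problem and equals `w`.
  set w' : Fin k → F⟦X⟧ := fun i => PowerSeries.map σ (w i)⁻¹ with hw'
  have h1 : ∀ i, X ∣ w' i - 1 := fun i => by
    refine X_dvd_sub_one ?_
    rw [hw', ← coeff_zero_eq_constantCoeff_apply, coeff_map, coeff_zero_eq_constantCoeff_apply,
      constantCoeff_eq_one (X_dvd_inv (hw i)), map_one]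
  have hinv : ∀ j, (w' j)⁻¹ = PowerSeries.map σ (w j) := fun j => by
    rw [PowerSeries.inv_eq_iff_mul_eq_one (by rw [constantCoeff_eq_one (h1 j)]; exact one_ne_zero),
      hw', ← map_mul, mul_inv_of_X_dvd (hw j), map_one]
  have h2 : ∀ i j, PowerSeries.map σ (alphaSeries a w i j) = alphaSeries a w' j i := fun i j => by
    rw [alphaSeries, alphaSeries, map_sub, map_mul, map_mul, map_mul (PowerSeries.map σ) (w i), map_one, map_X,
      map_C, map_mul, hσ, map_inv₀, hσ, inv_inv, hinv, mul_comm (a i)⁻¹,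
      mul_comm (PowerSeries.map σ (w i))]
  have h3 : ∀ i, w' i ^ N = betheSeries a w' i := fun i => by
    have h4 := congrArg (PowerSeries.map σ) (hfix i)
    rw [map_pow, betheSeries, map_prod] at h4
    have h5 : (∏ j ∈ Finset.univ.erase i,
        PowerSeries.map σ (alphaSeries a w i j * (alphaSeries a w j i)⁻¹)) *
          betheSeries a w' i = 1 := by
      rw [betheSeries, ← Finset.prod_mul_distrib]
      refine Finset.prod_eq_one fun j _ => ?_
      rw [map_mul, map_inv_of_X_dvd σ (X_dvd_alphaSeries a w j i), h2, h2]
      have h6 := mul_inv_of_X_dvd (X_dvd_alphaSeries a w' i j)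
      have h7 := mul_inv_of_X_dvd (X_dvd_alphaSeries a w' j i)
      linear_combination (alphaSeries a w' j i * (alphaSeries a w' j i)⁻¹) * h6 + h7
    have h8 : w' i * PowerSeries.map σ (w i) = 1 := by
      rw [← hinv, mul_inv_of_X_dvd (h1 i)]
    have h9 : w' i ^ N * PowerSeries.map σ (w i) ^ N = 1 := by rw [← mul_pow, h8, one_pow]
    rw [← h4] at h5
    linear_combination betheSeries a w' i * h9 - w' i ^ N * h5
  have h6 := (isContraction_newtonStep hN a).eq hw h1 ((newtonStep_eq_iff hN a w).2 hfix)
    ((newtonStep_eq_iff hN a w').2 h3)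
  rw [← hinv, ← h6]

end Lift

/-! ### Counting the solutions at `t = 0` -/

section Counting

open Polynomial

/-- The solutions at `t = 0`. -/
theorem exists_solutions_at_zero (k n : ℕ) (hn : 0 < n) :
    ∃ S : Finset (Finset ℂ), n.multichoose k ≤ S.card ∧ ∀ Y ∈ S, Y.card = k ∧
      ∀ y ∈ Y, ‖y‖ = 1 ∧ y ^ (n + k) = (-1) ^ (k - 1) * ∏ z ∈ Y, z := by
  classical
  -- For `k = 0` the empty set would be counted once for each `c` below, so this case is separate.
  rcases Nat.eq_zero_or_pos k with rfl | hk
  · exact ⟨{∅}, by simp, by simp⟩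
  set N := n + k with hN
  have hN0 : N ≠ 0 := by lia
  -- Let `c` be the common value of the `y^N`. If `c = (-1)^{k-1} ∏ y`, then `c^N = (-1)^{(k-1)N}
  -- c^k`, that is `c^n = ε`. Pairs of such a `c` and a `k`-subset of its `N`-th roots number `n *
  -- N.choose k`. The ratio `f` of the two sides is an `N`-th root of unity on each pair, and the
  -- solutions are the fibre over `1`.
  set ε : ℂ := (-1) ^ ((k - 1) * N) with hε
  have hε0 : ε ≠ 0 := pow_ne_zero _ (by simp)
  have hcard : ∀ (r : ℕ) (c : ℂ), r ≠ 0 → c ≠ 0 → (nthRoots r c).toFinset.card = r := by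
    intro r c hr hc
    have h := Complex.isPrimitiveRoot_exp r hr
    rw [Multiset.toFinset_card_of_nodup (h.nthRoots_nodup hc), h.card_nthRoots, if_pos]
    obtain ⟨z, hz⟩ := IsAlgClosed.exists_pow_nat_eq c (Nat.pos_of_ne_zero hr)
    exact ⟨z, hz⟩
  have hmem : ∀ (r : ℕ) (c z : ℂ), r ≠ 0 → (z ∈ (nthRoots r c).toFinset ↔ z ^ r = c) :=
    fun r c z hr => by rw [Multiset.mem_toFinset, mem_nthRoots (Nat.pos_of_ne_zero hr)]
  set T : Finset (Σ _ : ℂ, Finset ℂ) :=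
    (nthRoots n ε).toFinset.sigma fun c => Finset.powersetCard k (nthRoots N c).toFinset with hT
  have hmemT : ∀ p : Σ _ : ℂ, Finset ℂ, p ∈ T ↔
      p.1 ^ n = ε ∧ (∀ y ∈ p.2, y ^ N = p.1) ∧ p.2.card = k := by
    intro p
    rw [hT, Finset.mem_sigma, hmem _ _ _ hn.ne', Finset.mem_powersetCard]
    refine and_congr_right fun _ => and_congr_left fun _ => ?_
    exact forall₂_congr fun y _ => hmem _ _ _ hN0
  have hc0 : ∀ c : ℂ, c ^ n = ε → c ≠ 0 := fun c h h0 => by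
    rw [h0, zero_pow hn.ne'] at h
    exact hε0 h.symm
  have hTcard : T.card = n * N.choose k := by
    rw [hT, Finset.card_sigma, Finset.sum_congr rfl (g := fun _ => N.choose k), Finset.sum_const,
      hcard _ _ hn.ne' hε0, smul_eq_mul]
    intro c hc
    rw [Finset.card_powersetCard, hcard _ _ hN0 (hc0 c ((hmem _ _ _ hn.ne').1 hc))]
  set f : (Σ _ : ℂ, Finset ℂ) → ℂ := fun p => (-1) ^ (k - 1) * (∏ z ∈ p.2, z) / p.1 with hf
  set S := T.filter fun p => f p = 1 with hS
  have hmaps : ∀ p ∈ T, f p ∈ (nthRoots N (1 : ℂ)).toFinset := by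
    intro p hp
    obtain ⟨h1, h2, h3⟩ := (hmemT p).1 hp
    rw [hmem _ _ _ hN0, hf]
    simp only
    rw [div_pow, mul_pow, ← pow_mul, ← Finset.prod_pow, Finset.prod_congr rfl h2,
      Finset.prod_const, h3, ← hε, ← h1, ← pow_add, div_self (pow_ne_zero _ (hc0 _ h1))]
  have hfiber : ∀ ζ ∈ (nthRoots N (1 : ℂ)).toFinset,
      (T.filter fun p => f p = ζ).card ≤ S.card := by
    intro ζ hζ
    rw [hmem _ _ _ hN0] at hζ
    have hζ0 : ζ ≠ 0 := fun h => by rw [h, zero_pow hN0] at hζ; exact zero_ne_one hζ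
    -- Multiplying the set by `η` and `c` by `η^N` divides `f` by `η^{N-k} = η^n = ζ`. So the fibre
    -- over `ζ` embeds into the fibre over `1`.
    obtain ⟨η, hη⟩ := IsAlgClosed.exists_pow_nat_eq ζ hn
    have hη0 : η ≠ 0 := fun h => by rw [h, zero_pow hn.ne'] at hη; exact hζ0 hη.symm
    have hinj := mul_right_injective₀ hη0
    refine Finset.card_le_card_of_injOn
      (fun p => ⟨p.1 * η ^ N, p.2.image (η * ·)⟩) ?_ ?_
    · intro p hp
      obtain ⟨hp, hpf⟩ := Finset.mem_filter.1 hp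
      obtain ⟨h1, h2, h3⟩ := (hmemT p).1 hp
      refine Finset.mem_coe.2 (Finset.mem_filter.2 ⟨(hmemT _).2 ⟨?_, ?_, ?_⟩, ?_⟩)
      · simp only
        rw [mul_pow, h1, ← pow_mul, mul_comm N n, pow_mul, hη, hζ, mul_one]
      · intro y hy
        obtain ⟨z, hz, rfl⟩ := Finset.mem_image.1 hy
        simp only
        rw [mul_pow, h2 z hz, mul_comm]
      · simp only
        rw [Finset.card_image_of_injective _ hinj, h3]
      · simp only [hf] at hpf ⊢
        rw [Finset.prod_image hinj.injOn, Finset.prod_mul_distrib, Finset.prod_const, h3]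
        have hp1 := hc0 _ h1
        rw [div_eq_iff hp1] at hpf
        rw [div_eq_one_iff_eq (mul_ne_zero hp1 (pow_ne_zero _ hη0)), hN, pow_add, hη,
          mul_left_comm, hpf]
        ring
    · rintro ⟨c, Y⟩ - ⟨c', Y'⟩ - h
      simp only [Sigma.mk.injEq, heq_eq_eq] at h ⊢
      exact ⟨mul_right_cancel₀ (pow_ne_zero _ hη0) h.1, Finset.image_injective hinj h.2⟩
  -- There are `N` fibres, none larger than `S`, and `n * N.choose k = N * (N - 1).choose k`.
  have hcount : N * (N - 1).choose k ≤ N * S.card := by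
    have h1 := Finset.card_eq_sum_card_fiberwise hmaps
    have h2 := Finset.sum_le_sum hfiber
    rw [← h1, Finset.sum_const, hcard _ _ hN0 one_ne_zero, smul_eq_mul, hTcard] at h2
    refine le_trans (le_of_eq ?_) h2
    have h3 := Nat.choose_mul_succ_eq (N - 1) k
    rw [show N - 1 + 1 = N by lia, show N - k = n by lia] at h3
    rw [mul_comm, h3, mul_comm]
  refine ⟨S.image Sigma.snd, ?_, ?_⟩
  · rw [Finset.card_image_of_injOn, Nat.multichoose_eq]
    · exact Nat.le_of_mul_le_mul_left hcount (by lia)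
    · rintro ⟨c, Y⟩ hp ⟨c', Y'⟩ hp' rfl
      obtain ⟨-, h2, h3⟩ := (hmemT _).1 (Finset.mem_filter.1 hp).1
      obtain ⟨-, h2', -⟩ := (hmemT _).1 (Finset.mem_filter.1 hp').1
      obtain ⟨y, hy⟩ := Finset.card_pos.1 (by rw [h3]; exact hk)
      simp only at h2 h2' hy
      rw [← h2 y hy, ← h2' y hy]
  · intro Y hY
    obtain ⟨p, hp, rfl⟩ := Finset.mem_image.1 hY
    obtain ⟨hp, hpf⟩ := Finset.mem_filter.1 hp
    obtain ⟨h1, h2, h3⟩ := (hmemT p).1 hp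
    refine ⟨h3, fun y hy => ⟨?_, ?_⟩⟩
    · have h4 : ‖p.1‖ = 1 := by
        have := congrArg norm h1
        rw [norm_pow, hε, norm_pow, norm_neg, norm_one, one_pow] at this
        exact (pow_eq_one_iff_of_nonneg (norm_nonneg _) hn.ne').1 this
      have := congrArg norm (h2 y hy)
      rw [norm_pow, h4] at this
      exact (pow_eq_one_iff_of_nonneg (norm_nonneg _) hN0).1 this
    · rw [h2 y hy]
      rw [hf] at hpf
      exact ((div_eq_one_iff_eq (hc0 _ h1)).1 hpf).symm

open PowerSeries in
/-- A family of Bethe solutions on the "unit circle", pairwise different up to permutation. -/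
theorem exists_solutions (k n : ℕ) (hn : 0 < n) :
    ∃ (S : Finset (Finset ℂ)) (sol : S → Fin k → Puiseux), n.multichoose k ≤ S.card ∧
      (∀ Y, IsBetheSolution n (sol Y)) ∧ (∀ Y i, conj (sol Y i) = (sol Y i)⁻¹) ∧
      ∀ Y Y' (w : Equiv.Perm (Fin k)), sol Y' = sol Y ∘ w → Y = Y' := by
  obtain ⟨S, hS, h⟩ := exists_solutions_at_zero k n hn
  have key : ∀ Y : S, ∃ (a : Fin k → ℂ) (w : Fin k → ℂ⟦X⟧),
      (∀ z, z ∈ Y.1 ↔ ∃ i, a i = z) ∧ Function.Injective a ∧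
      (∀ i, (PowerSeries.X : ℂ⟦X⟧) ∣ w i - 1) ∧ ∀ i, w i ^ (n + k) = betheSeries a w i := by
    intro Y
    let e := (Y.1.equivFinOfCardEq (h Y.1 Y.2).1).symm
    obtain ⟨w, hw, hfix⟩ := (isContraction_newtonStep (by lia : n + k ≠ 0)
      fun i => (e i : ℂ)).exists_fixed
    refine ⟨fun i => e i, w, fun z => ⟨fun hz => ⟨e.symm ⟨z, hz⟩, by simp⟩, ?_⟩,
      Subtype.val_injective.comp e.injective, hw, (newtonStep_eq_iff (by lia) _ _).1 hfix⟩
    rintro ⟨i, rfl⟩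
    exact (e i).2
  choose a w hmem hinj hw hfix using key
  have hn1 : ∀ Y i, ‖a Y i‖ = 1 := fun Y i =>
    ((h Y.1 Y.2).2 _ ((hmem Y _).2 ⟨i, rfl⟩)).1
  have ha : ∀ Y i, a Y i ≠ 0 := fun Y i => by
    rw [← norm_ne_zero_iff, hn1]; exact one_ne_zero
  have hprod : ∀ Y : S, ∏ z ∈ Y.1, z = ∏ i, a Y i := fun Y => by
    classical
    have : Y.1 = Finset.univ.image (a Y) := by
      ext z
      simp [hmem]
    rw [this, Finset.prod_image (hinj Y).injOn]
  have heq : ∀ Y i, a Y i ^ (n + k) = (-1) ^ (k - 1) * ∏ j, a Y j := fun Y i => by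
    rw [((h Y.1 Y.2).2 _ ((hmem Y _).2 ⟨i, rfl⟩)).2, hprod]
  have hc : ∀ Y i, PowerSeries.constantCoeff (PowerSeries.C (a Y i) * w Y i) = a Y i :=
    fun Y i => by
      rw [map_mul, constantCoeff_eq_one (hw Y i), mul_one, PowerSeries.constantCoeff_C]
  have hsol0 : ∀ Y i, ofPS (PowerSeries.C (a Y i) * w Y i) ≠ 0 := fun Y i => by
    rw [map_ne_zero_iff _ ofPS_injective]
    intro h0
    have := hc Y i
    rw [h0, map_zero] at this
    exact ha Y i this.symm
  have hsolinj : ∀ Y, Function.Injective fun i => ofPS (PowerSeries.C (a Y i) * w Y i) := by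
    intro Y i j hij
    have := congrArg PowerSeries.constantCoeff (ofPS_injective hij)
    rw [hc, hc] at this
    exact hinj Y this
  refine ⟨S, fun Y i => ofPS (PowerSeries.C (a Y i) * w Y i), hS, fun Y => ⟨hsol0 Y, hsolinj Y, ?_⟩,
    ?_, ?_⟩
  · intro i
    have h1 := congrArg ofPS (lift_equation (ha Y) (heq Y) (hw Y) (hfix Y) i)
    simp only [map_mul ofPS (_ ^ _), map_pow, map_prod, map_sub,
      map_mul ofPS PowerSeries.X, ofPS_X] at h1
    rw [Finset.prod_div_distrib, Finset.prod_div_distrib, ← mul_div_assoc, h1]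
  · intro Y i
    have hσ : ∀ i, (starRingEnd ℂ) (a Y i) = (a Y i)⁻¹ := fun i => by
      rw [Complex.inv_def, Complex.normSq_eq_norm_sq, hn1]
      simp
    refine eq_inv_of_mul_eq_one_left ?_
    rw [conj_ofPS, map_mul, PowerSeries.map_C, hσ,
      map_fixed_eq_inv (by lia : n + k ≠ 0) _ hσ (hw Y) (hfix Y), ← map_mul, ← map_one ofPS]
    congr 1
    have h1 := mul_inv_of_X_dvd (hw Y i)
    have h2 : (PowerSeries.C (a Y i)⁻¹ : ℂ⟦X⟧) * PowerSeries.C (a Y i) = 1 := by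
      rw [← map_mul, inv_mul_cancel₀ (ha Y i), map_one]
    linear_combination (PowerSeries.C (a Y i)⁻¹ * PowerSeries.C (a Y i)) * h1 + h2
  -- The constant terms of a lift are the elements of `Y`, so `Y` can be recovered from the orbit.
  · intro Y Y' π hπ
    have h1 : ∀ i, a Y' i = a Y (π i) := fun i => by
      have := congrArg PowerSeries.constantCoeff (ofPS_injective (congrFun hπ i))
      rwa [hc, hc] at this
    refine Subtype.ext (Finset.ext fun z => ?_)
    rw [hmem, hmem]
    constructor
    · rintro ⟨i, rfl⟩
      exact ⟨π.symm i, by rw [h1, Equiv.apply_symm_apply]⟩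
    · rintro ⟨i, rfl⟩
      exact ⟨π i, (h1 i).symm⟩

end Counting

/-! ### Partitions and occupation numbers -/

section Partitions

variable {k n : ℕ}

/-- The multiplicities `(m_1(λ), …, m_n(λ))`. -/
def occupation (n : ℕ) (lam : Fin k → ℕ) : Fin n → ℕ :=
  fun i => (Finset.univ.filter fun j => lam j = (i : ℕ) + 1).card

theorem ketPartition_eq (lam : Fin k → ℕ) : ketPartition n lam = ket (occupation n lam) := rfl

theorem colLen_eq_add (lam : Fin k → ℕ) (i : ℕ) :
    colLen lam i = (Finset.univ.filter fun j => lam j = i).card + colLen lam (i + 1) := by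
  rw [colLen, colLen, ← Finset.card_union_of_disjoint]
  · congr 1
    ext j
    simp only [Finset.mem_filter, Finset.mem_univ, true_and, Finset.mem_union]
    lia
  · rw [Finset.disjoint_filter]
    intro j _ h
    lia

theorem colLen_occupation (lam : Fin k → ℕ) (i : Fin n) :
    colLen lam (i + 1) = occupation n lam i + colLen lam (i + 2) := colLen_eq_add lam (i + 1)

theorem colLen_le (lam : Fin k → ℕ) (i : ℕ) : colLen lam i ≤ k :=
  (Finset.card_filter_le _ _).trans (by simp)

theorem colLen_eq_zero {lam : Fin k → ℕ} (h : ∀ j, lam j ≤ n) {i : ℕ} (hi : n < i) :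
    colLen lam i = 0 := by
  rw [colLen, Finset.card_eq_zero, Finset.filter_eq_empty_iff]
  intro j _ hj
  have := h j
  lia

theorem lt_colLen_iff {lam : Fin k → ℕ} (hl : Antitone lam) (i : ℕ) (j : Fin k) :
    (j : ℕ) < colLen lam i ↔ i ≤ lam j := by
  constructor
  · intro h
    by_contra hij
    have hsub : (Finset.univ.filter fun j' => i ≤ lam j') ⊆ Finset.Iio j := fun j' hj' => by
      simp only [Finset.mem_filter, Finset.mem_univ, true_and, Finset.mem_Iio] at hj' ⊢
      by_contra h2
      exact hij (hj'.trans (hl (not_lt.1 h2)))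
    have := Finset.card_le_card hsub
    rw [Fin.card_Iio] at this
    exact absurd h (not_lt.2 this)
  · intro h
    have hsub : Finset.Iic j ⊆ Finset.univ.filter fun j' => i ≤ lam j' := fun j' hj' => by
      simp only [Finset.mem_filter, Finset.mem_univ, true_and, Finset.mem_Iic] at hj' ⊢
      exact h.trans (hl hj')
    have := Finset.card_le_card hsub
    rw [Fin.card_Iic] at this
    exact this

theorem le_of_colLen_le {lam mu : Fin k → ℕ} (hl : Antitone lam) (hm : Antitone mu)
    (h : ∀ i, 1 ≤ i → colLen mu i ≤ colLen lam i) : mu ≤ lam := by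
  intro j
  rcases Nat.eq_zero_or_pos (mu j) with h0 | h0
  · rw [h0]; exact Nat.zero_le _
  · rw [← lt_colLen_iff hl]
    exact lt_of_lt_of_le ((lt_colLen_iff hm _ j).2 le_rfl) (h _ h0)

theorem eq_of_colLen_eq {lam mu : Fin k → ℕ} (hl : Antitone lam) (hm : Antitone mu)
    (h : ∀ i, 1 ≤ i → colLen mu i = colLen lam i) : mu = lam :=
  le_antisymm (le_of_colLen_le hl hm fun i hi => (h i hi).le)
    (le_of_colLen_le hm hl fun i hi => (h i hi).ge)

theorem colLen_mono {lam mu : Fin k → ℕ} (h : mu ≤ lam) (i : ℕ) : colLen mu i ≤ colLen lam i :=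
  Finset.card_le_card fun j hj => by
    simp only [Finset.mem_filter, Finset.mem_univ, true_and] at hj ⊢
    exact hj.trans (h j)

/-- Column lengths are recovered from the multiplicities by descending recursion, starting from
column `n + 1`, which is empty; an antitone tuple is determined by its column lengths. -/
theorem eq_of_occupation_eq {lam mu : Fin k → ℕ} (hl : Antitone lam) (hm : Antitone mu)
    (hln : ∀ j, lam j ≤ n) (hmn : ∀ j, mu j ≤ n) (h : occupation n mu = occupation n lam) :
    mu = lam := by
  refine eq_of_colLen_eq hl hm fun i hi => ?_
  obtain ⟨i, rfl⟩ : ∃ l, i = l + 1 := ⟨i - 1, by lia⟩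
  have key : ∀ d i, n ≤ i + d → colLen mu (i + 1) = colLen lam (i + 1) := by
    intro d
    induction d with
    | zero => intro i hi; rw [colLen_eq_zero hmn (by lia), colLen_eq_zero hln (by lia)]
    | succ d ih =>
      intro i hi
      by_cases hin : i < n
      · have h1 := colLen_occupation mu ⟨i, hin⟩
        have h2 := colLen_occupation lam ⟨i, hin⟩
        rw [h, ih (i + 1) (by lia)] at h1
        rw [h1, h2]
      · rw [colLen_eq_zero hmn (by lia), colLen_eq_zero hln (by lia)]
  exact key n i (by lia)

theorem exists_antitone_of_multiset {s : Multiset ℕ} (hs : s.card = k) :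
    ∃ f : Fin k → ℕ, Antitone f ∧ Finset.univ.val.map f = s := by
  subst hs
  have hlen : (s.sort (· ≥ ·)).length = s.card := Multiset.length_sort _
  refine ⟨fun i => (s.sort (· ≥ ·)).get (i.cast hlen.symm), ?_, ?_⟩
  · intro i j hij
    rcases hij.eq_or_lt with rfl | h
    · exact le_rfl
    · exact List.pairwise_iff_get.1 (Multiset.pairwise_sort s (· ≥ ·)) _ _ h
  · have h : List.ofFn (fun i : Fin s.card => (s.sort (· ≥ ·)).get (i.cast hlen.symm)) =
        s.sort (· ≥ ·) := by
      refine List.ext_get (by simp [hlen]) fun l h1 h2 => ?_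
      simp
    rw [Fin.univ_val_map, h, Multiset.sort_eq]

/-- Sort the multiset with the prescribed multiplicities, padded by zeros to `k` entries. The
padding is needed because the shapes `μ` met while removing strips have fewer than `k` non-zero
parts. -/
theorem exists_partition {m : Fin n → ℕ} (hm : ∑ i, m i ≤ k) :
    ∃ mu : Fin k → ℕ, Antitone mu ∧ (∀ j, mu j ≤ n) ∧ occupation n mu = m := by
  set s : Multiset ℕ := ∑ i : Fin n, Multiset.replicate (m i) ((i : ℕ) + 1) +
    Multiset.replicate (k - ∑ i, m i) 0 with hs
  have hcard : s.card = k := by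
    rw [hs, Multiset.card_add, Multiset.card_sum]
    simp only [Multiset.card_replicate]
    lia
  obtain ⟨f, hf, hfs⟩ := exists_antitone_of_multiset hcard
  refine ⟨f, hf, fun j => ?_, funext fun i => ?_⟩
  · have : f j ∈ s := by
      rw [← hfs]; exact Multiset.mem_map_of_mem f (Finset.mem_univ j)
    rw [hs, Multiset.mem_add, Multiset.mem_sum] at this
    rcases this with ⟨i, -, hi⟩ | h
    · rw [Multiset.eq_of_mem_replicate hi]; exact i.2
    · rw [Multiset.eq_of_mem_replicate h]; exact Nat.zero_le _
  · have h1 : occupation n f i = (Finset.univ.val.map f).count ((i : ℕ) + 1) := by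
      rw [Multiset.count_map, occupation]
      simp only [eq_comm]
      rfl
    rw [h1, hfs, hs, Multiset.count_add, Multiset.count_sum', Multiset.count_replicate,
      if_neg (by lia), add_zero, Finset.sum_eq_single i]
    · rw [Multiset.count_replicate_self]
    · intro j _ hj
      rw [Multiset.count_replicate, if_neg]
      intro h
      exact hj (Fin.ext (by lia))
    · simp

theorem mem_alcove {lam : Fin k → ℕ} :
    lam ∈ alcove k n ↔ (∀ j, 1 ≤ lam j ∧ lam j ≤ n) ∧ Antitone lam := by
  classical
  simp [alcove]

theorem sum_occupation {lam : Fin k → ℕ} (h : ∀ j, lam j ≤ n) :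
    ∑ i, occupation n lam i = colLen lam 1 := by
  have key : ∀ d, ∑ i ∈ Finset.range d, (Finset.univ.filter fun j => lam j = i + 1).card +
      colLen lam (d + 1) = colLen lam 1 := by
    intro d
    induction d with
    | zero => simp
    | succ d ih =>
      rw [Finset.sum_range_succ, ← ih, colLen_eq_add lam (d + 1)]
      ring
  have h1 := key n
  rw [colLen_eq_zero h (Nat.lt_succ_self n), add_zero] at h1
  rw [← h1, ← Fin.sum_univ_eq_sum_range
    fun i => (Finset.univ.filter fun j => lam j = i + 1).card]
  rfl

theorem sum_eq_sum_colLen {lam : Fin k → ℕ} (h : ∀ j, lam j ≤ n) :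
    ∑ j, lam j = ∑ i ∈ Finset.range n, colLen lam (i + 1) := by
  simp only [colLen, Finset.card_filter]
  rw [Finset.sum_comm]
  refine Finset.sum_congr rfl fun j _ => ?_
  rw [← Finset.card_filter]
  have : (Finset.range n).filter (fun i => i + 1 ≤ lam j) = Finset.range (lam j) := by
    ext i
    have := h j
    simp only [Finset.mem_filter, Finset.mem_range]
    lia
  rw [this, Finset.card_range]

theorem mem_alcove_of_colLen {lam : Fin k → ℕ} (hl : Antitone lam) (hn : ∀ j, lam j ≤ n)
    (h : colLen lam 1 = k) : lam ∈ alcove k n :=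
  mem_alcove.2 ⟨fun j => ⟨(lt_colLen_iff hl 1 j).1 (by rw [h]; exact j.2), hn j⟩, hl⟩

theorem colLen_one_of_mem_alcove {lam : Fin k → ℕ} (h : lam ∈ alcove k n) : colLen lam 1 = k := by
  rw [colLen, Finset.filter_true_of_mem fun j _ => ((mem_alcove.1 h).1 j).1]
  simp

theorem occupation_injOn : Set.InjOn (occupation n) (alcove k n : Set (Fin k → ℕ)) := by
  intro lam hl mu hm h
  obtain ⟨h1, h2⟩ := mem_alcove.1 hl
  obtain ⟨h1', h2'⟩ := mem_alcove.1 hm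
  exact eq_of_occupation_eq h2' h2 (fun j => (h1' j).2) (fun j => (h1 j).2) h

theorem exists_mem_alcove {m : Fin n → ℕ} (hm : ∑ i, m i = k) :
    ∃ lam ∈ alcove k n, occupation n lam = m := by
  obtain ⟨mu, h1, h2, h3⟩ := exists_partition hm.le
  exact ⟨mu, mem_alcove_of_colLen h1 h2 (by rw [← sum_occupation h2, h3, hm]), h3⟩

theorem card_alcove (k n : ℕ) : (alcove k n).card = n.multichoose k := by
  classical
  have h := Finset.card_finsuppAntidiag_nat_eq_multichoose (s := (Finset.univ : Finset (Fin n))) k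
  rw [Finset.card_univ, Fintype.card_fin] at h
  rw [← h]
  refine Finset.card_bij (fun lam _ => Finsupp.equivFunOnFinite.symm (occupation n lam)) ?_ ?_ ?_
  · intro lam hl
    rw [Finset.mem_finsuppAntidiag]
    refine ⟨?_, Finset.subset_univ _⟩
    exact (sum_occupation fun j => ((mem_alcove.1 hl).1 j).2).trans (colLen_one_of_mem_alcove hl)
  · intro lam hl mu hm h
    exact occupation_injOn hl hm (Finsupp.equivFunOnFinite.symm.injective h)
  · intro m hm
    rw [Finset.mem_finsuppAntidiag] at hm
    obtain ⟨lam, hl, h⟩ := exists_mem_alcove (m := m) hm.1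
    exact ⟨lam, hl, by rw [h]; exact Finsupp.equivFunOnFinite.symm_apply_apply m⟩

end Partitions

/-! ### The action of `B(u)` and Hall-Littlewood functions -/

section Paths

variable {n : ℕ}

/-- The occupation numbers after moving back the particles: `i ∈ s` if a particle is carried
into site `i`. -/
def pathTarget (j : ℕ) (s : Finset ℕ) (m : Fin n → ℕ) : Fin n → ℕ := fun i =>
  if (i : ℕ) < j then (m i + if (i : ℕ) + 1 ∈ s then 1 else 0) - (if (i : ℕ) ∈ s then 1 else 0)
  else m i

/-- The factor of site `i` in the weight of a path. -/
def pathFactor (u : Puiseux) (s : Finset ℕ) (m : Fin n → ℕ) (i : Fin n) : Puiseux :=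
  if (i : ℕ) ∈ s then u * if (i : ℕ) + 1 ∈ s then 1 else 1 - tVar ^ m i else 1

/-- The weight of a path through the first `j` sites. -/
def pathWeight (j : ℕ) (u : Puiseux) (s : Finset ℕ) (m : Fin n → ℕ) : Puiseux :=
  ∏ i : Fin n, if (i : ℕ) < j then pathFactor u s m i else 1

/-- The contribution of a path to a matrix element. -/
def pathTerm (j : ℕ) (u : Puiseux) (v : Fock n) (s : Finset ℕ) (m : Fin n → ℕ) : Puiseux :=
  if 0 ∈ s then pathWeight j u s m * v (pathTarget j s m) else 0

/-- Splits off the topmost site: `m'` is the occupation after its action, and `s'` only has to agree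
with `s` up to level `j`. -/
theorem pathTerm_succ (j : Fin n) (u : Puiseux) (v : Fock n) (s s' : Finset ℕ) (m m' : Fin n → ℕ)
    (hs : ∀ i ≤ (j : ℕ), i ∈ s ↔ i ∈ s') (hm : ∀ i, i ≠ j → m' i = m i)
    (hj : m' j = (m j + if (j : ℕ) + 1 ∈ s then 1 else 0) - (if (j : ℕ) ∈ s then 1 else 0)) :
    pathTerm (j + 1) u v s m = pathFactor u s m j * pathTerm j u v s' m' := by
  have h0 : 0 ∈ s ↔ 0 ∈ s' := hs 0 (Nat.zero_le _)
  have hw : pathWeight (j + 1) u s m = pathFactor u s m j * pathWeight j u s' m' := by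
    rw [pathWeight, pathWeight, ← Finset.mul_prod_erase _ _ (Finset.mem_univ j),
      if_pos (Nat.lt_succ_self _), ← Finset.mul_prod_erase _
        (fun i : Fin n => if (i : ℕ) < j then pathFactor u s' m' i else 1) (Finset.mem_univ j),
      if_neg (lt_irrefl _), one_mul]
    congr 1
    refine Finset.prod_congr rfl fun i hi => ?_
    have hij : (i : ℕ) ≠ j := fun h => Finset.ne_of_mem_erase hi (Fin.ext h)
    by_cases h : (i : ℕ) < j
    · rw [if_pos (by lia), if_pos h, pathFactor, pathFactor, hm i (Finset.ne_of_mem_erase hi)]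
      simp only [hs i h.le, hs (i + 1) h]
    · rw [if_neg (by lia), if_neg h]
  have ht : pathTarget (j + 1) s m = pathTarget j s' m' := by
    funext i
    rw [pathTarget, pathTarget]
    by_cases hij : i = j
    · subst hij
      rw [if_pos (Nat.lt_succ_self _), if_neg (lt_irrefl _), hj]
    · have hij' : (i : ℕ) ≠ j := fun h => hij (Fin.ext h)
      rw [hm i hij]
      by_cases h : (i : ℕ) < j
      · rw [if_pos (by lia), if_pos h]
        simp only [hs i h.le, hs (i + 1) h]
      · rw [if_neg (by lia), if_neg h]
  rw [pathTerm, pathTerm, hw, ht]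
  simp only [h0, mul_ite, mul_zero, mul_assoc]

theorem ofFn_rev_succ_sites (j : ℕ) (hj : j + 1 ≤ n) :
    (List.ofFn fun i : Fin (j + 1) => Fin.castLE hj i.rev) =
      ⟨j, hj⟩ :: List.ofFn fun i : Fin j => Fin.castLE (Nat.le_of_succ_le hj) i.rev := by
  rw [List.ofFn_succ]
  congr 1
  congr 1
  funext i
  ext
  simp [Fin.rev_succ]

/-- A matrix product is a sum over sequences of auxiliary states, and `s` is the set of levels at
which the state is `1`. The right index `1` forces `0 ∈ s`; the left index decides whether `j ∈ s`.
Each entry for `j + 1` involves both entries for `j`, hence the joint induction. -/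
theorem lProd_paths (u : Puiseux) (v : Fock n) (j : ℕ) (hj : j ≤ n) (m : Fin n → ℕ) :
    lProd (List.ofFn fun i : Fin j => Fin.castLE hj i.rev) u 0 1 v m =
        ∑ s ∈ (Finset.range j).powerset, pathTerm j u v s m ∧
      lProd (List.ofFn fun i : Fin j => Fin.castLE hj i.rev) u 1 1 v m =
        ∑ s ∈ (Finset.range j).powerset, pathTerm j u v (insert j s) m := by
  induction j generalizing m with
  | zero =>
    have h : pathTarget 0 {0} m = m := funext fun i => by simp [pathTarget]
    simp [lProd_nil, pathTerm, pathWeight, h]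
  | succ j ih =>
    have hjn : j ≤ n := Nat.le_of_succ_le hj
    set J : Fin n := ⟨j, hj⟩ with hJ
    have hrange : j ∉ Finset.range j := Finset.notMem_range_self
    have hmul : ∀ a, lProd (List.ofFn fun i : Fin (j + 1) => Fin.castLE hj i.rev) u a 1 v =
        lOp u J a 0 (lProd (List.ofFn fun i : Fin j => Fin.castLE hjn i.rev) u 0 1 v) +
        lOp u J a 1 (lProd (List.ofFn fun i : Fin j => Fin.castLE hjn i.rev) u 1 1 v) := fun a => by
      rw [ofFn_rev_succ_sites, lProd_cons, Matrix.mul_apply, Fin.sum_univ_two, LinearMap.add_apply,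
        Module.End.mul_apply, Module.End.mul_apply]
    have e00 : lOp u J 0 0 = 1 := rfl
    have e01 : lOp u J 0 1 = u • create J := rfl
    have e10 : lOp u J 1 0 = annihilate J := rfl
    have e11 : lOp u J 1 1 = u • 1 := rfl
    rw [Finset.range_add_one, Finset.sum_powerset_insert hrange, Finset.sum_powerset_insert hrange]
    constructor
    · rw [hmul, e00, e01, Finsupp.add_apply, Module.End.one_apply, LinearMap.smul_apply,
        Finsupp.smul_apply, create_apply, (ih hjn _).1, (ih hjn _).2, smul_eq_mul, ← mul_assoc,
        Finset.mul_sum]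
      congr 1
      · refine Finset.sum_congr rfl fun s hs => ?_
        have hs' : ∀ i ∈ s, i < j := fun i hi => Finset.mem_range.1 (Finset.mem_powerset.1 hs hi)
        have h1 : j ∉ s := fun h => lt_irrefl _ (hs' _ h)
        have h2 : j + 1 ∉ s := fun h => absurd (hs' _ h) (by lia)
        rw [pathTerm_succ J u v s s m m (fun _ _ => Iff.rfl) (fun _ _ => rfl)
          (by simp [hJ, h1, h2])]
        simp [pathFactor, hJ, h1]
      · refine Finset.sum_congr rfl fun s hs => ?_
        have hs' : ∀ i ∈ s, i < j := fun i hi => Finset.mem_range.1 (Finset.mem_powerset.1 hs hi)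
        have h2 : j + 1 ∉ insert j s := fun h => by
          rcases Finset.mem_insert.1 h with h | h
          · lia
          · exact absurd (hs' _ h) (by lia)
        rw [pathTerm_succ J u v (insert j s) (insert j s) m (Function.update m J (m J - 1))
          (fun _ _ => Iff.rfl) (fun i hi => Function.update_of_ne hi _ _) (by simp [hJ, h2])]
        simp only [pathFactor, hJ, Finset.mem_insert_self, h2, if_true, if_false]
    · rw [hmul, e10, e11, Finsupp.add_apply, LinearMap.smul_apply, Module.End.one_apply,
        Finsupp.smul_apply, annihilate_apply, (ih hjn _).1, (ih hjn _).2, smul_eq_mul,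
        Finset.mul_sum]
      congr 1
      · refine Finset.sum_congr rfl fun s hs => ?_
        have hs' : ∀ i ∈ s, i < j := fun i hi => Finset.mem_range.1 (Finset.mem_powerset.1 hs hi)
        have h1 : j ∉ insert (j + 1) s := fun h => by
          rcases Finset.mem_insert.1 h with h | h
          · lia
          · exact lt_irrefl _ (hs' _ h)
        rw [pathTerm_succ J u v (insert (j + 1) s) s m (Function.update m J (m J + 1))
          (fun i hi => by simp only [hJ] at hi; rw [Finset.mem_insert]; lia)
          (fun i hi => Function.update_of_ne hi _ _) (by simp [hJ, h1])]
        simp only [pathFactor, hJ, h1, if_false, one_mul]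
      · refine Finset.sum_congr rfl fun s hs => ?_
        rw [pathTerm_succ J u v (insert (j + 1) (insert j s)) (insert j s) m m
          (fun i hi => by simp only [hJ] at hi; rw [Finset.mem_insert]; lia)
          (fun _ _ => rfl) (by simp [hJ])]
        simp [pathFactor, hJ]

theorem opB_apply (u : Puiseux) (v : Fock n) (m : Fin n → ℕ) :
    opB n u v m = ∑ s ∈ (Finset.range n).powerset, pathTerm n u v s m := by
  rw [opB, monodromy_eq_lProd]
  exact (lProd_paths u v n le_rfl m).1

theorem pathWeight_eq (u : Puiseux) (s : Finset ℕ) (m : Fin n → ℕ) :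
    pathWeight n u s m = ∏ i, pathFactor u s m i := by
  simp [pathWeight]

/-- The balance of particles at each site along a path of non-zero weight. -/
theorem pathTarget_add {u : Puiseux} {v : Fock n} {s : Finset ℕ} {m : Fin n → ℕ}
    (h : pathTerm n u v s m ≠ 0) (i : Fin n) :
    pathTarget n s m i + (if (i : ℕ) ∈ s then 1 else 0) =
      m i + if (i : ℕ) + 1 ∈ s then 1 else 0 := by
  rw [pathTarget, if_pos i.2]
  refine Nat.sub_add_cancel ?_
  split_ifs with h1 h2
  · lia
  -- The only case where the subtraction could truncate: a particle created at an empty site, where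
  -- the factor `1 - t^0` makes the weight vanish.
  · have hw : pathWeight n u s m ≠ 0 := fun h0 => h (by rw [pathTerm, h0]; simp)
    rw [pathWeight_eq, Finset.prod_ne_zero_iff] at hw
    have hi := hw i (Finset.mem_univ i)
    rw [pathFactor, if_pos h1, if_neg h2] at hi
    rcases Nat.eq_zero_or_pos (m i) with h3 | h3
    · rw [h3, pow_zero, sub_self, mul_zero] at hi
      exact absurd rfl hi
    · exact h3
  · exact Nat.zero_le _
  · exact Nat.zero_le _

/-- Summing the balance over the sites telescopes. The state is `1` at level `0` and `0` at level
`n`, so exactly one particle is created. -/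
theorem sum_pathTarget {u : Puiseux} {v : Fock n} {s : Finset ℕ} {m : Fin n → ℕ}
    (hs : s ∈ (Finset.range n).powerset) (h : pathTerm n u v s m ≠ 0) :
    ∑ i, pathTarget n s m i + 1 = ∑ i, m i := by
  have h0 : 0 ∈ s := by
    by_contra h0
    exact h (by rw [pathTerm, if_neg h0])
  have hn : n ∉ s := fun hn => Finset.notMem_range_self (Finset.mem_powerset.1 hs hn)
  have h1 := Finset.sum_congr (rfl : (Finset.univ : Finset (Fin n)) = Finset.univ)
    fun i _ => pathTarget_add h i
  rw [Finset.sum_add_distrib, Finset.sum_add_distrib,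
    Fin.sum_univ_eq_sum_range (fun i => if i ∈ s then 1 else 0),
    Fin.sum_univ_eq_sum_range (fun i => if i + 1 ∈ s then 1 else 0)] at h1
  have h2 := Finset.sum_range_succ (fun i => if i ∈ s then 1 else 0) n
  rw [Finset.sum_range_succ', if_pos h0, if_neg hn] at h2
  lia

theorem bVector_apply_eq_zero (S : Multiset Puiseux) {m : Fin n → ℕ} (hm : ∑ i, m i ≠ S.card) :
    bVector n S m = 0 := by
  induction S using Multiset.induction_on generalizing m with
  | empty =>
    rw [bVector, Multiset.foldr_zero, ket, Finsupp.single_eq_of_ne']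
    rintro rfl
    simp at hm
  | cons u S ih =>
    rw [bVector_cons, opB_apply]
    refine Finset.sum_eq_zero fun s hs => ?_
    by_contra h
    have h1 := sum_pathTarget hs h
    rw [Multiset.card_cons] at hm
    rw [pathTerm, ih (by lia)] at h
    simp at h

end Paths

/-! ### Bethe vectors and Hall-Littlewood functions -/

section Strips

variable {k n : ℕ} {R : Type*} [CommRing R]

theorem isHorizontalStrip_of_phi_ne_zero {t : R} {lam mu : Fin k → ℕ} (h : phi t lam mu ≠ 0) :
    IsHorizontalStrip lam mu := by
  by_contra h'
  exact h (if_neg h')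

/-- Brings all products to the fixed range of the `n` sites, so that `φ`, `ψ` and path weights can
be compared factor by factor. -/
theorem prod_Icc_filter_eq {lam : Fin k → ℕ} (hn : ∀ j, lam j ≤ n) (p : ℕ → Prop)
    [DecidablePred p] (hp : ∀ i, Finset.univ.sup lam < i → i ≤ n → ¬ p i ) (f : ℕ → R) :
    ∏ i ∈ (Finset.Icc 1 (Finset.univ.sup lam)).filter p, f i =
      ∏ i ∈ Finset.range n, if p (i + 1) then f (i + 1) else 1 := by
  have hsup : Finset.univ.sup lam ≤ n := Finset.sup_le fun j _ => hn j
  have h1 : (Finset.Icc 1 (Finset.univ.sup lam)).filter p = (Finset.Icc 1 n).filter p := by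
    ext i
    simp only [Finset.mem_filter, Finset.mem_Icc]
    constructor
    · rintro ⟨⟨h1, h2⟩, h3⟩; exact ⟨⟨h1, h2.trans hsup⟩, h3⟩
    · rintro ⟨⟨h1, h2⟩, h3⟩
      exact ⟨⟨h1, not_lt.1 fun h => hp i h h2 h3⟩, h3⟩
  rw [h1, Finset.prod_filter, Finset.range_eq_Ico, Finset.prod_Ico_add' (fun i => if p i then f i else 1),
    zero_add]
  rfl

theorem colLen_eq_zero_of_sup {lam : Fin k → ℕ} {i : ℕ} (h : Finset.univ.sup lam < i) :
    colLen lam i = 0 := colLen_eq_zero (fun j => Finset.le_sup (Finset.mem_univ j)) h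

theorem phi_eq {t : R} {lam mu : Fin k → ℕ} (hn : ∀ j, lam j ≤ n) (h : IsHorizontalStrip lam mu) :
    phi t lam mu = ∏ i ∈ Finset.range n,
      if colLen lam (i + 1) = colLen mu (i + 1) + 1 ∧ colLen lam (i + 2) = colLen mu (i + 2)
      then 1 - t ^ (colLen lam (i + 1) - colLen lam (i + 2)) else 1 := by
  classical
  rw [phi, if_pos h, prod_Icc_filter_eq hn]
  rintro i hi - ⟨h1, -⟩
  rw [colLen_eq_zero_of_sup hi] at h1
  lia

theorem psi_eq {t : R} {lam mu : Fin k → ℕ} (hn : ∀ j, lam j ≤ n) (h : IsHorizontalStrip lam mu) :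
    psi t lam mu = ∏ i ∈ Finset.range n,
      if colLen lam (i + 1) = colLen mu (i + 1) ∧ colLen lam (i + 2) = colLen mu (i + 2) + 1
      then 1 - t ^ (colLen mu (i + 1) - colLen mu (i + 2)) else 1 := by
  classical
  rw [psi, if_pos h, prod_Icc_filter_eq hn]
  rintro i hi - ⟨-, h1⟩
  rw [colLen_eq_zero_of_sup (hi.trans (Nat.lt_succ_self i))] at h1
  lia

theorem mem_subpartitions {lam mu : Fin k → ℕ} :
    mu ∈ subpartitions lam ↔ mu ≤ lam ∧ Antitone mu := by
  classical
  simp [subpartitions, Pi.le_def]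

theorem colLen_one_eq_zero {lam : Fin k → ℕ} (h : colLen lam 1 = 0) : lam = 0 := by
  funext j
  rw [colLen, Finset.card_eq_zero, Finset.filter_eq_empty_iff] at h
  have := h (Finset.mem_univ j)
  simp only [Pi.zero_apply]
  lia

/-- A horizontal strip adds at most one box to the first column, so at least as many variables as
non-zero parts are needed. -/
theorem tableauSum_eq_zero {w : (Fin k → ℕ) → (Fin k → ℕ) → R}
    (hw : ∀ lam mu, ¬ IsHorizontalStrip lam mu → w lam mu = 0) {r : ℕ} (x : Fin r → R)
    {lam : Fin k → ℕ} (h : r < colLen lam 1) : tableauSum w r x lam = 0 := by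
  induction r generalizing lam with
  | zero =>
    rw [tableauSum, if_neg]
    rintro rfl
    simp [colLen] at h
  | succ r ih =>
    rw [tableauSum]
    refine Finset.sum_eq_zero fun mu _ => ?_
    by_cases hs : IsHorizontalStrip lam mu
    · rw [ih _ (by have := hs.2 1 le_rfl; lia), mul_zero]
    · rw [hw _ _ hs, zero_mul, zero_mul]

theorem map_tableauSum {S : Type*} [CommRing S] (f : R →+* S) {w : (Fin k → ℕ) → (Fin k → ℕ) → R}
    {w' : (Fin k → ℕ) → (Fin k → ℕ) → S} (hw : ∀ lam mu, f (w lam mu) = w' lam mu) {r : ℕ}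
    (x : Fin r → R) (lam : Fin k → ℕ) :
    f (tableauSum w r x lam) = tableauSum w' r (fun i => f (x i)) lam := by
  induction r generalizing lam with
  | zero => rw [tableauSum, tableauSum]; split_ifs <;> simp
  | succ r ih =>
    rw [tableauSum, tableauSum, map_sum]
    refine Finset.sum_congr rfl fun mu _ => ?_
    rw [map_mul, map_mul, map_pow, hw, ih]

theorem map_phi {S : Type*} [CommRing S] (f : R →+* S) (t : R) (lam mu : Fin k → ℕ) :
    f (phi t lam mu) = phi (f t) lam mu := by
  rw [phi, phi]
  split_ifs
  · rw [map_prod]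
    simp
  · exact map_zero f

/-- The columns of `λ / μ` that contain a box, shifted by one. -/
def stripColumns (n : ℕ) (lam mu : Fin k → ℕ) : Finset ℕ :=
  (Finset.range n).filter fun i => colLen lam (i + 1) = colLen mu (i + 1) + 1

theorem mem_stripColumns {lam mu : Fin k → ℕ} (hl : ∀ j, lam j ≤ n) (i : ℕ) :
    i ∈ stripColumns n lam mu ↔ colLen lam (i + 1) = colLen mu (i + 1) + 1 := by
  rw [stripColumns, Finset.mem_filter, Finset.mem_range, and_iff_right_iff_imp]
  intro h1
  by_contra h2
  rw [colLen_eq_zero hl (by lia)] at h1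
  lia

theorem colLen_eq_add_stripColumns {lam mu : Fin k → ℕ} (hl : ∀ j, lam j ≤ n)
    (h : IsHorizontalStrip lam mu) (i : ℕ) :
    colLen lam (i + 1) = colLen mu (i + 1) + if i ∈ stripColumns n lam mu then 1 else 0 := by
  have h1 := colLen_mono h.1 (i + 1)
  have h2 := h.2 (i + 1) (by lia)
  have h3 := mem_stripColumns (mu := mu) hl i
  split_ifs with h4
  · exact h3.1 h4
  · have := fun h => h4 (h3.2 h)
    lia

theorem sum_sub_sum_eq {lam mu : Fin k → ℕ} (hl : ∀ j, lam j ≤ n)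
    (h : IsHorizontalStrip lam mu) :
    ∑ j, lam j - ∑ j, mu j = (stripColumns n lam mu).card := by
  rw [sum_eq_sum_colLen hl, sum_eq_sum_colLen fun j => (h.1 j).trans (hl j),
    Finset.sum_congr rfl fun i _ => colLen_eq_add_stripColumns hl h i, Finset.sum_add_distrib,
    Nat.add_sub_cancel_left, ← Finset.card_filter]
  congr 1
  ext i
  rw [Finset.mem_filter, Finset.mem_range, and_iff_right_iff_imp]
  intro hi
  exact Finset.mem_range.1 (Finset.mem_filter.1 hi).1

/-- The auxiliary state at level `i` is `1` when column `i + 1` of `λ / μ` has a box. Each box gives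
a factor `u`, and a box with none in the next column is a creation at that site, with the factor `1
- t^m` of `φ`. The condition `h0` is the path condition `0 ∈ s`. -/
theorem strip_term_eq {lam mu : Fin k → ℕ} (hl : ∀ j, lam j ≤ n)
    (h : IsHorizontalStrip lam mu) (h0 : colLen lam 1 = colLen mu 1 + 1) (u : Puiseux)
    (v : Fock n) :
    phi tVar lam mu * u ^ (∑ j, lam j - ∑ j, mu j) * v (occupation n mu) =
      pathTerm n u v (stripColumns n lam mu) (occupation n lam) := by
  have hc := colLen_eq_add_stripColumns hl h
  rw [pathTerm, if_pos ((mem_stripColumns hl 0).2 h0)]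
  congr 1
  · rw [phi_eq hl h, sum_sub_sum_eq hl h, pathWeight_eq]
    have h1 : u ^ (stripColumns n lam mu).card =
        ∏ i ∈ Finset.range n, if i ∈ stripColumns n lam mu then u else 1 := by
      rw [Finset.prod_ite_mem, Finset.inter_eq_right.2
        (show stripColumns n lam mu ⊆ Finset.range n from Finset.filter_subset _ _),
        Finset.prod_const]
    rw [h1, ← Finset.prod_mul_distrib, Finset.prod_range]
    refine Finset.prod_congr rfl fun i _ => ?_
    have h2 := colLen_occupation lam i
    have h3 := mem_stripColumns (mu := mu) hl i
    have h4 := mem_stripColumns (mu := mu) hl (i + 1)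
    have h5 := hc (i + 1)
    rw [pathFactor]
    by_cases hi : (i : ℕ) ∈ stripColumns n lam mu
    · by_cases hi' : (i : ℕ) + 1 ∈ stripColumns n lam mu
      · rw [if_pos hi, if_pos hi, if_pos hi', if_neg]
        · ring
        · rintro ⟨-, h6⟩
          rw [if_pos hi'] at h5
          lia
      · rw [if_pos hi, if_pos hi, if_neg hi', if_pos]
        · rw [h2, Nat.add_sub_cancel, mul_comm]
        · exact ⟨h3.1 hi, by rw [if_neg hi', add_zero] at h5; exact h5⟩
    · rw [if_neg hi, if_neg hi, if_neg, mul_one]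
      rintro ⟨h6, -⟩
      exact hi (h3.2 h6)
  · congr 1
    funext i
    rw [pathTarget, if_pos i.2]
    have h2 := colLen_occupation lam i
    have h3 := colLen_occupation mu i
    have h4 := hc i
    have h5 := hc (i + 1)
    rw [show (i : ℕ) + 1 + 1 = i + 2 by lia] at h5
    lia

/-- The target of a path with non-zero term has one particle less, so it comes from some `μ`.
Particle balance, summed down from site `n`, shows that the column lengths of `λ` and `μ` differ by
the indicator of `s`. -/
theorem exists_strip {lam : Fin k → ℕ} (hla : Antitone lam) (hl : ∀ j, lam j ≤ n) {u : Puiseux}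
    {v : Fock n} {s : Finset ℕ} (hs : s ∈ (Finset.range n).powerset)
    (h : pathTerm n u v s (occupation n lam) ≠ 0) :
    ∃ mu, IsHorizontalStrip lam mu ∧ Antitone mu ∧ colLen lam 1 = colLen mu 1 + 1 ∧
      stripColumns n lam mu = s := by
  have hsum := sum_pathTarget hs h
  rw [sum_occupation hl] at hsum
  have hk := colLen_le lam 1
  obtain ⟨mu, hmu, hmn, hocc⟩ := exists_partition (k := k) (m := pathTarget n s (occupation n lam))
    (by lia)
  have hs' : ∀ i ∈ s, i < n := fun i hi => Finset.mem_range.1 (Finset.mem_powerset.1 hs hi)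
  have key : ∀ d i, n ≤ i + d →
      colLen lam (i + 1) = colLen mu (i + 1) + if i ∈ s then 1 else 0 := by
    intro d
    induction d with
    | zero =>
      intro i hi
      rw [colLen_eq_zero hmn (by lia), colLen_eq_zero hl (by lia), if_neg]
      intro h
      have := hs' i h
      lia
    | succ d ih =>
      intro i hi
      by_cases hin : i < n
      · have h1 := colLen_occupation mu ⟨i, hin⟩
        have h2 := colLen_occupation lam ⟨i, hin⟩
        have h3 := pathTarget_add h ⟨i, hin⟩
        have h4 := ih (i + 1) (by lia)
        rw [hocc] at h1
        simp only at h1 h2 h3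
        rw [show i + 1 + 1 = i + 2 by lia] at h4
        lia
      · rw [colLen_eq_zero hmn (by lia), colLen_eq_zero hl (by lia), if_neg]
        intro h
        have := hs' i h
        lia
  have h0 : 0 ∈ s := by
    by_contra h0
    exact h (by rw [pathTerm, if_neg h0])
  have hle : mu ≤ lam := le_of_colLen_le hla hmu fun i hi => by
    obtain ⟨i, rfl⟩ : ∃ l, i = l + 1 := ⟨i - 1, by lia⟩
    rw [key n i (by lia)]
    exact Nat.le_add_right _ _
  refine ⟨mu, ⟨hle, fun i hi => ?_⟩, hmu, ?_, ?_⟩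
  · obtain ⟨i, rfl⟩ : ∃ l, i = l + 1 := ⟨i - 1, by lia⟩
    rw [key n i (by lia)]
    split_ifs <;> lia
  · rw [key n 0 (by lia), if_pos h0]
  · ext i
    rw [mem_stripColumns hl, key n i (by lia)]
    split_ifs with hi <;> simp [hi]

open scoped Classical in
theorem opB_apply_occupation {lam : Fin k → ℕ} (hla : Antitone lam) (hl : ∀ j, lam j ≤ n)
    (u : Puiseux) (v : Fock n) :
    opB n u v (occupation n lam) =
      ∑ mu ∈ (subpartitions lam).filter (fun mu => colLen lam 1 = colLen mu 1 + 1),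
        phi tVar lam mu * u ^ (∑ j, lam j - ∑ j, mu j) * v (occupation n mu) := by
  rw [opB_apply]
  symm
  have hstrip : ∀ mu, phi tVar lam mu * u ^ (∑ j, lam j - ∑ j, mu j) * v (occupation n mu) ≠ 0 →
      IsHorizontalStrip lam mu := fun mu h =>
    isHorizontalStrip_of_phi_ne_zero (left_ne_zero_of_mul (left_ne_zero_of_mul h))
  have hterm : ∀ mu ∈ (subpartitions lam).filter (fun mu => colLen lam 1 = colLen mu 1 + 1),
      phi tVar lam mu * u ^ (∑ j, lam j - ∑ j, mu j) * v (occupation n mu) ≠ 0 →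
      phi tVar lam mu * u ^ (∑ j, lam j - ∑ j, mu j) * v (occupation n mu) =
        pathTerm n u v (stripColumns n lam mu) (occupation n lam) := fun mu hmu h =>
    strip_term_eq hl (hstrip mu h) (Finset.mem_filter.1 hmu).2 u v
  refine Finset.sum_bij_ne_zero (fun mu _ _ => stripColumns n lam mu) ?_ ?_ ?_ hterm
  · intro mu _ _
    exact Finset.mem_powerset.2 (Finset.filter_subset _ _)
  · intro mu h1 h2 mu' h1' h2' h
    have ha := (mem_subpartitions.1 (Finset.mem_filter.1 h1).1).2
    have ha' := (mem_subpartitions.1 (Finset.mem_filter.1 h1').1).2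
    refine eq_of_colLen_eq ha' ha fun i hi => ?_
    obtain ⟨i, rfl⟩ : ∃ l, i = l + 1 := ⟨i - 1, by lia⟩
    have h3 := colLen_eq_add_stripColumns hl (hstrip mu h2) i
    have h4 := colLen_eq_add_stripColumns hl (hstrip mu' h2') i
    rw [h] at h3
    lia
  · intro s hs h
    obtain ⟨mu, h1, h2, h3, rfl⟩ := exists_strip hla hl hs h
    refine ⟨mu, Finset.mem_filter.2 ⟨mem_subpartitions.2 ⟨h1.1, h2⟩, h3⟩, ?_, rfl⟩
    rw [strip_term_eq hl h1 h3]
    exact h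

/-- Induction on the variables: `B(u)` acts by the branching rule of `Q_λ`, the last variable being
the outermost operator. -/
theorem bVector_apply_occupation {r : ℕ} (x : Fin r → Puiseux) {lam : Fin k → ℕ}
    (hla : Antitone lam) (hl : ∀ j, lam j ≤ n) (hr : colLen lam 1 = r) :
    bVector n (Finset.univ.val.map x) (occupation n lam) = hallLittlewoodQ tVar x lam := by
  classical
  induction r generalizing lam with
  | zero =>
    have h0 := colLen_one_eq_zero hr
    have h1 : occupation n lam = 0 := by
      funext i
      simp [h0, occupation]
    rw [hallLittlewoodQ, tableauSum, if_pos h0, h1]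
    simp [bVector, ket]
  | succ r ih =>
    have hx : (Finset.univ : Finset (Fin (r + 1))).val.map x =
        x (Fin.last r) ::ₘ (Finset.univ : Finset (Fin r)).val.map fun i => x i.castSucc := by
      rw [Fin.univ_castSuccEmb, Finset.cons_val, Multiset.map_cons, Finset.map_val,
        Multiset.map_map]
      rfl
    rw [hx, bVector_cons, opB_apply_occupation hla hl, hallLittlewoodQ, tableauSum,
      Finset.sum_filter]
    refine Finset.sum_congr rfl fun mu hmu => ?_
    obtain ⟨h1, h2⟩ := mem_subpartitions.1 hmu
    split_ifs with h3
    · rw [ih _ h2 (fun j => (h1 j).trans (hl j)) (by lia)]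
      rfl
    -- A strip without a box in the first column occurs in the branching rule but not in `B(u)`. It
    -- leaves `r + 1` non-zero parts for `r` variables and contributes zero.
    · by_cases hs : IsHorizontalStrip lam mu
      · have h4 := hs.2 1 le_rfl
        rw [tableauSum_eq_zero (w := phi tVar) (fun lam mu h => if_neg h) _ (by lia), mul_zero]
      · rw [phi, if_neg hs, zero_mul, zero_mul]

theorem betheVector_eq_sum (y : Fin k → Puiseux) :
    betheVector n y = ∑ lam ∈ alcove k n,
      hallLittlewoodQ tVar (fun i => (y i)⁻¹) lam • ketPartition n lam := by
  refine Finsupp.ext fun m => ?_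
  rw [betheVector_eq_bVector, Finsupp.finsetSum_apply]
  by_cases hm : ∑ i, m i = k
  · obtain ⟨lam, hl, rfl⟩ := exists_mem_alcove hm
    obtain ⟨h1, h2⟩ := mem_alcove.1 hl
    rw [bVector_apply_occupation _ h2 (fun j => (h1 j).2) (colLen_one_of_mem_alcove hl),
      Finset.sum_eq_single_of_mem lam hl]
    · rw [Finsupp.smul_apply, ketPartition_eq, ket, Finsupp.single_eq_same, smul_eq_mul, mul_one]
    · intro mu hmu hne
      rw [Finsupp.smul_apply, ketPartition_eq, ket, Finsupp.single_eq_of_ne', smul_zero]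
      exact fun h => hne (occupation_injOn hmu hl h)
  · rw [bVector_apply_eq_zero _ (by simpa using hm)]
    refine (Finset.sum_eq_zero fun mu hmu => ?_).symm
    rw [Finsupp.smul_apply, ketPartition_eq, ket, Finsupp.single_eq_of_ne', smul_zero]
    rintro rfl
    exact hm ((sum_occupation fun j => ((mem_alcove.1 hmu).1 j).2).trans
      (colLen_one_of_mem_alcove hmu))

theorem tPoch_succ (r : ℕ) : tPoch (r + 1) = tPoch r * (1 - tVar ^ (r + 1)) :=
  Finset.prod_range_succ _ _

/-- Each multiplicity changes by at most one along a strip. The factor of `φ` occurs when it grows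
from `μ` to `λ`, that of `ψ` when it drops, and each is the matching ratio of Pochhammer symbols. By
induction this yields `Q_λ = ∏ (t)_{m_i(λ)} P_λ`. -/
theorem phi_mul_tPoch {lam mu : Fin k → ℕ} (hl : ∀ j, lam j ≤ n)
    (h : IsHorizontalStrip lam mu) :
    phi tVar lam mu * ∏ i, tPoch (occupation n mu i) =
      psi tVar lam mu * ∏ i, tPoch (occupation n lam i) := by
  rw [phi_eq hl h, psi_eq hl h, Finset.prod_range, Finset.prod_range, ← Finset.prod_mul_distrib,
    ← Finset.prod_mul_distrib]
  refine Finset.prod_congr rfl fun i _ => ?_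
  have h1 := colLen_occupation lam i
  have h2 := colLen_occupation mu i
  have h3 := colLen_mono h.1 (i + 1)
  have h4 := colLen_mono h.1 (i + 2)
  have h5 := h.2 (i + 1) (by lia)
  have h6 := h.2 (i + 2) (by lia)
  have e1 : colLen lam (i + 1) - colLen lam (i + 2) = occupation n lam i := by lia
  have e2 : colLen mu (i + 1) - colLen mu (i + 2) = occupation n mu i := by lia
  rw [e1, e2]
  by_cases c1 : colLen lam (i + 1) = colLen mu (i + 1) <;>
    by_cases c2 : colLen lam (i + 2) = colLen mu (i + 2)
  · rw [if_neg (by lia), if_neg (by lia), show occupation n lam i = occupation n mu i by lia]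
  · rw [if_neg (by lia), if_pos (by lia), show occupation n mu i = occupation n lam i + 1 by lia,
      tPoch_succ]
    ring
  · rw [if_pos (by lia), if_neg (by lia), show occupation n lam i = occupation n mu i + 1 by lia,
      tPoch_succ]
    ring
  · rw [if_neg (by lia), if_neg (by lia), show occupation n lam i = occupation n mu i by lia]

theorem hallLittlewoodQ_eq {r : ℕ} (x : Fin r → Puiseux) {lam : Fin k → ℕ}
    (hl : ∀ j, lam j ≤ n) :
    hallLittlewoodQ tVar x lam =
      (∏ i, tPoch (occupation n lam i)) * hallLittlewoodP tVar x lam := by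
  induction r generalizing lam with
  | zero =>
    rw [hallLittlewoodQ, hallLittlewoodP, tableauSum, tableauSum]
    split_ifs with h
    · subst h
      simp [occupation, tPoch]
    · rw [mul_zero]
  | succ r ih =>
    rw [hallLittlewoodQ, hallLittlewoodP, tableauSum, tableauSum, Finset.mul_sum]
    refine Finset.sum_congr rfl fun mu hmu => ?_
    have h1 := (mem_subpartitions.1 hmu).1
    have h2 := ih (fun i => x i.castSucc) (fun j => (h1 j).trans (hl j))
    rw [hallLittlewoodQ, hallLittlewoodP] at h2
    rw [h2]
    by_cases hs : IsHorizontalStrip lam mu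
    · have h3 := phi_mul_tPoch hl hs
      linear_combination (x (Fin.last r) ^ (∑ j, lam j - ∑ j, mu j) *
        tableauSum (psi tVar) r (fun i => x i.castSucc) mu) * h3
    · rw [phi, psi, if_neg hs, if_neg hs]
      ring

theorem conj_hallLittlewoodQ {r : ℕ} (x : Fin r → Puiseux) (lam : Fin k → ℕ) :
    conj (hallLittlewoodQ tVar x lam) = hallLittlewoodQ tVar (fun i => conj (x i)) lam := by
  rw [← conjHom_apply, hallLittlewoodQ, hallLittlewoodQ]
  refine map_tableauSum conjHom (fun lam mu => ?_) x lam
  rw [map_phi, conjHom_apply, conj_tVar]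

end Strips

/-! ### The scalar product -/

section ScalarProduct

variable {n : ℕ}

theorem fockInner_eq_finsuppSum (v w : Fock n) :
    fockInner v w = v.sum fun m c => conj c * w m / ∏ i, tPoch (m i) := rfl

theorem fockInner_zero_left (w : Fock n) : fockInner 0 w = 0 := by
  rw [fockInner, Finsupp.support_zero, Finset.sum_empty]

theorem fockInner_add_left (v v' w : Fock n) :
    fockInner (v + v') w = fockInner v w + fockInner v' w := by
  rw [fockInner_eq_finsuppSum, Finsupp.sum_add_index', fockInner_eq_finsuppSum,
    fockInner_eq_finsuppSum]
  · intro m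
    rw [← conjHom_apply, map_zero, zero_mul, zero_div]
  · intro m c c'
    rw [← conjHom_apply, map_add, conjHom_apply, conjHom_apply, add_mul, add_div]

theorem fockInner_smul_left (c : Puiseux) (v w : Fock n) :
    fockInner (c • v) w = conj c * fockInner v w := by
  rw [fockInner_eq_finsuppSum, Finsupp.sum_smul_index, fockInner_eq_finsuppSum, Finsupp.mul_sum]
  · refine Finsupp.sum_congr fun m _ => ?_
    rw [← conjHom_apply, map_mul, conjHom_apply, conjHom_apply, mul_assoc, mul_div_assoc]
  · intro m
    rw [← conjHom_apply, map_zero, zero_mul, zero_div]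

theorem fockInner_add_right (v w w' : Fock n) :
    fockInner v (w + w') = fockInner v w + fockInner v w' := by
  rw [fockInner, fockInner, fockInner, ← Finset.sum_add_distrib]
  refine Finset.sum_congr rfl fun m _ => ?_
  rw [Finsupp.add_apply, mul_add, add_div]

theorem fockInner_smul_right (c : Puiseux) (v w : Fock n) :
    fockInner v (c • w) = c * fockInner v w := by
  rw [fockInner, fockInner, Finset.mul_sum]
  refine Finset.sum_congr rfl fun m _ => ?_
  rw [Finsupp.smul_apply, smul_eq_mul]
  ring

theorem fockInner_ket_left (m : Fin n → ℕ) (w : Fock n) :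
    fockInner (ket m) w = w m / ∏ i, tPoch (m i) := by
  have h0 : conj 0 = 0 := map_zero conjHom
  have h1 : conj 1 = 1 := map_one conjHom
  rw [fockInner_eq_finsuppSum, ket, Finsupp.sum_single_index (by rw [h0, zero_mul, zero_div]),
    h1, one_mul]

theorem fockInner_sum_left {ι : Type*} (s : Finset ι) (f : ι → Fock n) (w : Fock n) :
    fockInner (∑ i ∈ s, f i) w = ∑ i ∈ s, fockInner (f i) w :=
  map_sum (AddMonoidHom.mk' (fun v => fockInner v w) fun v v' => fockInner_add_left v v' w) f s

theorem fockInner_sum_ketPartition {k : ℕ} (c d : (Fin k → ℕ) → Puiseux) :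
    fockInner (∑ lam ∈ alcove k n, c lam • ketPartition n lam)
        (∑ lam ∈ alcove k n, d lam • ketPartition n lam) =
      ∑ lam ∈ alcove k n, conj (c lam) * (d lam / ∏ i, tPoch (occupation n lam i)) := by
  rw [fockInner_sum_left]
  refine Finset.sum_congr rfl fun lam hl => ?_
  rw [fockInner_smul_left, ketPartition_eq, fockInner_ket_left, Finsupp.finsetSum_apply,
    Finset.sum_eq_single_of_mem lam hl]
  · rw [Finsupp.smul_apply, ketPartition_eq, ket, Finsupp.single_eq_same, smul_eq_mul, mul_one]
  · intro mu hmu hne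
    rw [Finsupp.smul_apply, ketPartition_eq, ket, Finsupp.single_eq_of_ne', smul_zero]
    exact fun h => hne (occupation_injOn hmu hl h)

/-- `Y` is adjoint to `X` for the scalar product of the Fock space. -/
def IsAdj (X Y : Module.End Puiseux (Fock n)) : Prop :=
  ∀ v w, fockInner (X v) w = fockInner v (Y w)

theorem IsAdj.of_ket {X Y : Module.End Puiseux (Fock n)}
    (h : ∀ m w, fockInner (X (ket m)) w = fockInner (ket m) (Y w)) : IsAdj X Y := by
  intro v w
  induction v using Finsupp.induction_linear with
  | zero => rw [map_zero, fockInner_zero_left, fockInner_zero_left]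
  | add v v' hv hv' => rw [map_add, fockInner_add_left, fockInner_add_left, hv, hv']
  | single m c =>
    have e : Finsupp.single m c = c • (ket m : Fock n) := by
      rw [ket, Finsupp.smul_single, smul_eq_mul, mul_one]
    rw [e, map_smul, fockInner_smul_left, fockInner_smul_left, h]

theorem IsAdj.add {X Y X' Y' : Module.End Puiseux (Fock n)} (h : IsAdj X Y) (h' : IsAdj X' Y') :
    IsAdj (X + X') (Y + Y') := fun v w => by
  rw [LinearMap.add_apply, LinearMap.add_apply, fockInner_add_left, fockInner_add_right, h, h']

theorem IsAdj.mul {X Y X' Y' : Module.End Puiseux (Fock n)} (h : IsAdj X Y) (h' : IsAdj X' Y') :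
    IsAdj (X * X') (Y' * Y) := fun v w => by
  rw [Module.End.mul_apply, Module.End.mul_apply, h, h']

theorem IsAdj.smul {X Y : Module.End Puiseux (Fock n)} (h : IsAdj X Y) (c : Puiseux) :
    IsAdj (c • X) (conj c • Y) := fun v w => by
  rw [LinearMap.smul_apply, LinearMap.smul_apply, fockInner_smul_left, fockInner_smul_right, h]

theorem isAdj_one : IsAdj (1 : Module.End Puiseux (Fock n)) 1 := fun _ _ => rfl

theorem isAdj_zero : IsAdj (0 : Module.End Puiseux (Fock n)) 0 := fun v w => by
  rw [LinearMap.zero_apply, LinearMap.zero_apply, fockInner_zero_left, ← zero_smul Puiseux w,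
    fockInner_smul_right, zero_mul]

theorem prod_tPoch_update (m : Fin n → ℕ) (i : Fin n) (r : ℕ) :
    ∏ j, tPoch (Function.update m i r j) = tPoch r * ∏ j ∈ Finset.univ.erase i, tPoch (m j) := by
  rw [← Finset.mul_prod_erase _ _ (Finset.mem_univ i), Function.update_self]
  congr 1
  refine Finset.prod_congr rfl fun j hj => ?_
  rw [Function.update_of_ne (Finset.ne_of_mem_erase hj)]

theorem prod_tPoch_update_succ (m : Fin n → ℕ) (i : Fin n) :
    ∏ j, tPoch (Function.update m i (m i + 1) j) =
      (1 - tVar ^ (m i + 1)) * ∏ j, tPoch (m j) := by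
  rw [prod_tPoch_update, tPoch_succ, ← Finset.mul_prod_erase _ _ (Finset.mem_univ i)]
  ring

theorem create_ket (i : Fin n) (m : Fin n → ℕ) :
    create i (ket m) = (1 - tVar ^ (m i + 1)) • ket (Function.update m i (m i + 1)) := by
  rw [create, ket, Finsupp.linearCombination_single, one_smul]

theorem annihilate_ket_update (i : Fin n) (m : Fin n → ℕ) :
    annihilate i (ket (Function.update m i (m i + 1))) = ket m := by
  rw [annihilate, ket, Finsupp.linearCombination_single, one_smul, Function.update_self,
    if_neg (Nat.succ_ne_zero _), Nat.add_sub_cancel, Function.update_idem, Function.update_eq_self]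

theorem annihilate_ket_of_eq_zero {i : Fin n} {m : Fin n → ℕ} (h : m i = 0) :
    annihilate i (ket m) = 0 := by
  rw [annihilate, ket, Finsupp.linearCombination_single, one_smul, if_pos h]

theorem isAdj_create (i : Fin n) : IsAdj (create i) (annihilate i) := by
  refine IsAdj.of_ket fun m w => ?_
  have h := one_sub_tVar_pow_ne_zero (Nat.succ_ne_zero (m i))
  have h1 : conj (1 - tVar ^ (m i + 1)) = 1 - tVar ^ (m i + 1) := by
    rw [← conjHom_apply, map_sub, map_one, map_pow, conjHom_apply, conj_tVar]
  rw [create_ket, fockInner_smul_left, fockInner_ket_left, fockInner_ket_left, annihilate_apply,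
    prod_tPoch_update_succ, h1, ← mul_div_assoc, mul_div_mul_left _ _ h]

theorem isAdj_annihilate (i : Fin n) : IsAdj (annihilate i) (create i) := by
  refine IsAdj.of_ket fun m w => ?_
  rw [fockInner_ket_left, create_apply]
  rcases Nat.eq_zero_or_pos (m i) with h0 | h0
  · rw [annihilate_ket_of_eq_zero h0, fockInner_zero_left, h0, pow_zero, sub_self, zero_mul,
      zero_div]
  · obtain ⟨m', rfl⟩ : ∃ m', m = Function.update m' i (m' i + 1) :=
      ⟨Function.update m i (m i - 1), by
        rw [Function.update_self, Function.update_idem, Nat.sub_add_cancel h0,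
          Function.update_eq_self]⟩
    have h := one_sub_tVar_pow_ne_zero (Nat.succ_ne_zero (m' i))
    rw [annihilate_ket_update, fockInner_ket_left, prod_tPoch_update_succ, Function.update_self,
      Nat.add_sub_cancel, Function.update_idem, Function.update_eq_self, mul_div_mul_left _ _ h]

/-- Taking adjoints replaces `u` by `ū⁻¹` and flips both auxiliary indices, up to the factor `ū`.
The flip exchanges `A` and `D`, so it preserves the transfer matrix. -/
theorem isAdj_lOp {u : Puiseux} (hu : u ≠ 0) (i : Fin n) (a b : Fin 2) :
    IsAdj (lOp u i a b) (conj u • lOp (conj u)⁻¹ i a.rev b.rev) := by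
  have hu' : conj u ≠ 0 := (map_ne_zero conjHom).2 hu
  have h00 : ∀ w : Puiseux, lOp w i 0 0 = 1 := fun _ => rfl
  have h01 : ∀ w : Puiseux, lOp w i 0 1 = w • create i := fun _ => rfl
  have h10 : ∀ w : Puiseux, lOp w i 1 0 = annihilate i := fun _ => rfl
  have h11 : ∀ w : Puiseux, lOp w i 1 1 = w • 1 := fun _ => rfl
  have r0 : (0 : Fin 2).rev = 1 := rfl
  have r1 : (1 : Fin 2).rev = 0 := rfl
  revert a b
  rw [Fin.forall_fin_two, Fin.forall_fin_two, Fin.forall_fin_two, r0, r1, h00, h01, h10, h11, h00,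
    h01, h10, h11, smul_smul, smul_smul, mul_inv_cancel₀ hu', one_smul, one_smul]
  exact ⟨⟨isAdj_one, (isAdj_create i).smul u⟩, isAdj_annihilate i, isAdj_one.smul u⟩

theorem isAdj_lProd {u : Puiseux} (hu : u ≠ 0) {l : List (Fin n)} (hl : l.Nodup) (a b : Fin 2) :
    IsAdj (lProd l u a b) (conj u ^ l.length • lProd l (conj u)⁻¹ a.rev b.rev) := by
  induction l generalizing a b with
  | nil =>
    rw [lProd_nil, lProd_nil, List.length_nil, pow_zero, one_smul, Matrix.one_apply,
      Matrix.one_apply]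
    by_cases h : a = b
    · rw [if_pos h, if_pos (congrArg Fin.rev h)]
      exact isAdj_one
    · rw [if_neg h, if_neg fun h' => h (Fin.rev_injective h')]
      exact isAdj_zero
  | cons i l ih =>
    rw [List.nodup_cons] at hl
    -- Adjunction reverses the order of the sites; commuting entries of different sites restore it.
    have hcomm : ∀ c d, Commute (lOp (conj u)⁻¹ i a.rev c) (lProd l (conj u)⁻¹ d b.rev) :=
      fun c d => commute_lProd (fun j hj a' b' => commute_lOp (fun h : i = j => hl.1 (h ▸ hj)) _ _ _ _
        _ _) _ _
    have h : ∀ c, IsAdj (lOp u i a c * lProd l u c b)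
        (conj u ^ (l.length + 1) •
          (lOp (conj u)⁻¹ i a.rev c.rev * lProd l (conj u)⁻¹ c.rev b.rev)) := fun c => by
      have h1 := (isAdj_lOp hu i a c).mul (ih hl.2 c b)
      rwa [smul_mul_smul_comm, ← pow_succ, ← (hcomm c.rev c.rev).eq] at h1
    have r0 : (0 : Fin 2).rev = 1 := rfl
    have r1 : (1 : Fin 2).rev = 0 := rfl
    have h2 := (h 0).add (h 1)
    rw [r0, r1, ← smul_add] at h2
    rw [lProd_cons, lProd_cons, Matrix.mul_apply, Matrix.mul_apply, Fin.sum_univ_two,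
      Fin.sum_univ_two, List.length_cons, add_comm (lOp (conj u)⁻¹ i a.rev 0 * _)]
    exact h2

theorem isAdj_transferMatrix {u : Puiseux} (hu : u ≠ 0) :
    IsAdj (transferMatrix n u) (conj u ^ n • transferMatrix n (conj u)⁻¹) := by
  have h0 := isAdj_lProd hu (nodup_ofFn_rev (n := n)) 0 0
  have h1 := isAdj_lProd hu (nodup_ofFn_rev (n := n)) 1 1
  have r0 : (0 : Fin 2).rev = 1 := rfl
  have r1 : (1 : Fin 2).rev = 0 := rfl
  have h2 := h0.add h1
  rw [r0, r1, ← smul_add, List.length_ofFn, add_comm (lProd _ (conj u)⁻¹ 1 1)] at h2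
  rw [transferMatrix, transferMatrix, monodromy_eq_lProd, monodromy_eq_lProd]
  exact h2

-- A natural number is wanted as the spectral parameter because conjugation fixes it.
open Polynomial in
theorem exists_nat_eval_ne_zero {K : Type*} [Field K] [CharZero K] {p : K[X]} (hp : p ≠ 0) :
    ∃ u : ℕ, p.eval (u : K) ≠ 0 := by
  by_contra! h
  refine hp (eq_zero_of_infinite_isRoot p
    ((Set.infinite_range_of_injective (Nat.cast_injective (R := K))).mono ?_))
  rintro _ ⟨u, rfl⟩
  exact h u

-- Since conjugation inverts the roots, each factor of one product in the eigenvalue becomes `t`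
-- times a factor of the other at `u⁻¹`. The two terms of the eigenvalue are exchanged.
open Polynomial in
theorem conj_tq_eval {k : ℕ} {y : Fin k → Puiseux} (hy : ∀ i, y i ≠ 0)
    (hconj : ∀ i, conj (y i) = (y i)⁻¹) {L : Puiseux[X]}
    (hL : tqRhs tVar n k (qPoly y) = qPoly y * L) {u : Puiseux} (hu0 : u ≠ 0) (hu : conj u = u)
    (h : ∀ i, 1 - u * y i ≠ 0) (h' : ∀ i, 1 - u * (y i)⁻¹ ≠ 0) :
    conj (L.eval u) = u ^ n * L.eval u⁻¹ := by
  have ht := tVar_ne_zero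
  have h2 : ∀ i, 1 - u⁻¹ * y i ≠ 0 := fun i h0 => h' i (by
    have : u⁻¹ * y i = 1 := by linear_combination -h0
    rw [← eq_inv_of_mul_eq_one_left this, mul_inv_cancel₀ hu0, sub_self])
  have e1 : ∀ i, (1 - u * (y i)⁻¹ * tVar) / (1 - u * (y i)⁻¹) =
      tVar * ((1 - u⁻¹ * tVar⁻¹ * y i) / (1 - u⁻¹ * y i)) := fun i => by
    have := hy i
    rw [← mul_div_assoc, div_eq_div_iff (h' i) (h2 i)]
    field_simp
    ring
  have e2 : ∀ i, (1 - u⁻¹ * y i * tVar) / (1 - u⁻¹ * y i) =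
      tVar * ((1 - u * tVar⁻¹ * (y i)⁻¹) / (1 - u * (y i)⁻¹)) := fun i => by
    have := hy i
    rw [← mul_div_assoc, div_eq_div_iff (h2 i) (h' i)]
    field_simp
    ring
  have e3 : ∀ f : Fin k → Puiseux, ∏ i, tVar * f i = tVar ^ k * ∏ i, f i := fun f => by
    rw [Finset.prod_mul_distrib, Finset.prod_const, Finset.card_univ, Fintype.card_fin]
  rw [tq_eval ht hL h, tq_eval ht hL h2, ← conjHom_apply]
  simp only [map_add, map_mul, map_prod, map_div₀, map_sub, map_one, map_pow, map_inv₀]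
  simp only [conjHom_apply, conj_tVar, hu, hconj, e1, e2, e3, inv_pow]
  field_simp
  ring

-- With `ū = u`, moving `E(u)` across the scalar product gives `u^n E(u⁻¹)`, which acts on the
-- second vector by the conjugate of `L'(u)`. A `u` with `L(u) ≠ L'(u)` then forces the product to
-- vanish.
open Polynomial in
theorem fockInner_betheVector_eq_zero {k : ℕ} {y y' : Fin k → Puiseux} (hy : IsBetheSolution n y)
    (hy' : IsBetheSolution n y') (hconj : ∀ i, conj (y' i) = (y' i)⁻¹) {L L' : Puiseux[X]}
    (hL : tqRhs tVar n k (qPoly y) = qPoly y * L)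
    (hL' : tqRhs tVar n k (qPoly y') = qPoly y' * L') (hne : L ≠ L') :
    fockInner (betheVector n y) (betheVector n y') = 0 := by
  obtain ⟨u, hu⟩ := exists_nat_eval_ne_zero (p := (L - L') * X * qPoly y' * qPoly fun i => (y' i)⁻¹)
    (mul_ne_zero (mul_ne_zero (mul_ne_zero (sub_ne_zero.2 hne) X_ne_zero) (qPoly_ne_zero _))
      (qPoly_ne_zero _))
  rw [eval_mul, eval_mul, eval_mul, eval_sub, eval_X, qPoly_eval, qPoly_eval] at hu
  obtain ⟨h1, h2⟩ := mul_ne_zero_iff.1 hu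
  obtain ⟨h1, h3⟩ := mul_ne_zero_iff.1 h1
  obtain ⟨h1, h4⟩ := mul_ne_zero_iff.1 h1
  rw [Finset.prod_ne_zero_iff] at h2 h3
  have hc : conj (u : Puiseux) = u := map_natCast conjHom u
  have h5 := isAdj_transferMatrix (n := n) h4 (betheVector n y) (betheVector n y')
  rw [hc, LinearMap.smul_apply, bethe_eigen hy hL, bethe_eigen hy' hL', fockInner_smul_left,
    smul_smul, fockInner_smul_right, ← conj_tq_eval hy'.1 hconj hL' h4 hc
      (fun i => h3 i (Finset.mem_univ i)) (fun i => h2 i (Finset.mem_univ i))] at h5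
  have h6 : conj (L.eval (u : Puiseux)) - conj (L'.eval (u : Puiseux)) ≠ 0 := by
    rw [← conjHom_apply, ← conjHom_apply, ← map_sub]
    exact (map_ne_zero conjHom).2 h1
  refine (mul_eq_zero.1 ?_).resolve_left h6
  rw [sub_mul, h5, sub_self]

/-- On the unit circle the conjugate of `Q_λ(y⁻¹)` is `Q_λ(y)`, and dividing `Q_λ(y'⁻¹)` by the
inverse norm of `|λ⟩` gives `P_λ(ȳ')`. -/
theorem fockInner_betheVector {k : ℕ} {y y' : Fin k → Puiseux}
    (hconj : ∀ i, conj (y i) = (y i)⁻¹) (hconj' : ∀ i, conj (y' i) = (y' i)⁻¹) :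
    fockInner (betheVector n y) (betheVector n y') =
      ∑ lam ∈ alcove k n, hallLittlewoodQ tVar y lam *
        hallLittlewoodP tVar (fun i => conj (y' i)) lam := by
  rw [betheVector_eq_sum, betheVector_eq_sum, fockInner_sum_ketPartition]
  refine Finset.sum_congr rfl fun lam hl => ?_
  rw [conj_hallLittlewoodQ, hallLittlewoodQ_eq (fun i => (y' i)⁻¹) fun j => ((mem_alcove.1 hl).1 j).2,
    mul_div_cancel_left₀ _ (Finset.prod_ne_zero_iff.2 fun i _ => tPoch_ne_zero _)]
  simp only [← hconj, ← hconj', conj_conj]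

end ScalarProduct

/-! ### Ideals with as many zeros as the dimension of the quotient -/

section ZeroLocus

open MvPolynomial

variable {σ K : Type*} [Field K]

/-- Evaluation at a zero of the ideal `I`, on the quotient by `I`. -/
def evalQuotient (I : Ideal (MvPolynomial σ K)) (z : zeroLocus K I) :
    (MvPolynomial σ K ⧸ I) →ₐ[K] K :=
  Ideal.Quotient.liftₐ I (aeval z.1) fun p hp => z.2 p hp

theorem evalQuotient_mk (I : Ideal (MvPolynomial σ K)) (z : zeroLocus K I)
    (p : MvPolynomial σ K) : evalQuotient I z (Ideal.Quotient.mk I p) = aeval z.1 p := rfl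

theorem evalQuotient_injective (I : Ideal (MvPolynomial σ K)) :
    Function.Injective (evalQuotient I) := fun z z' h => by
  refine Subtype.ext (funext fun i => ?_)
  have := congrArg (fun f => f (Ideal.Quotient.mk I (X i))) h
  simpa only [evalQuotient_mk, aeval_X] using this

theorem linearIndependent_evalQuotient (I : Ideal (MvPolynomial σ K)) :
    LinearIndependent K fun z : zeroLocus K I => (evalQuotient I z).toLinearMap :=
  (linearIndependent_algHom_toLinearMap K _ K).comp _ (evalQuotient_injective I)

/-- Evaluations at distinct zeros are distinct characters, hence independent in the dual of the
quotient, so there are at most as many zeros as the dimension. If `Z` attains it, they span the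
dual, and a class killed by all of them is zero. -/
theorem zeroLocus_of_finrank_le {I : Ideal (MvPolynomial σ K)}
    [Module.Finite K (MvPolynomial σ K ⧸ I)] {Z : Finset (σ → K)} (hZ : ↑Z ⊆ zeroLocus K I)
    (h : Module.finrank K (MvPolynomial σ K ⧸ I) ≤ Z.card) :
    zeroLocus K I = Z ∧ vanishingIdeal K (zeroLocus K I) = I ∧
      Module.finrank K (MvPolynomial σ K ⧸ I) = Z.card := by
  have hli := linearIndependent_evalQuotient I
  have : Finite (zeroLocus K I) := hli.finite
  have : Fintype (zeroLocus K I) := Fintype.ofFinite _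
  have hdual : Module.finrank K (Module.Dual K (MvPolynomial σ K ⧸ I)) =
      Module.finrank K (MvPolynomial σ K ⧸ I) := Subspace.dual_finrank_eq
  have h1 : Fintype.card (zeroLocus K I) ≤ Module.finrank K (MvPolynomial σ K ⧸ I) :=
    hdual ▸ hli.fintype_card_le_finrank
  have h2 : (zeroLocus K I).ncard = Fintype.card (zeroLocus K I) := by
    rw [← Nat.card_coe_set_eq, Nat.card_eq_fintype_card]
  have h3 : (Z : Set (σ → K)) = zeroLocus K I :=
    Set.eq_of_subset_of_ncard_le hZ (by rw [h2, Set.ncard_coe_finset]; exact h1.trans h)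
      (Set.toFinite _)
  have h4 : Z.card = Fintype.card (zeroLocus K I) := by rw [← h2, ← h3, Set.ncard_coe_finset]
  refine ⟨h3.symm, le_antisymm (fun p hp => ?_) (le_vanishingIdeal_zeroLocus I),
    le_antisymm h (h4 ▸ h1)⟩
  have hspan := hli.span_eq_top_of_card_eq_finrank' (le_antisymm
    hli.fintype_card_le_finrank (by rw [hdual, ← h4]; exact h))
  rw [← Ideal.Quotient.eq_zero_iff_mem, ← Module.forall_dual_apply_eq_zero_iff K]
  intro φ
  have hφ : φ ∈ Submodule.span K (Set.range fun z : zeroLocus K I =>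
      (evalQuotient I z).toLinearMap) := by
    rw [hspan]
    exact Submodule.mem_top
  induction hφ using Submodule.span_induction with
  | mem f hf =>
    obtain ⟨z, rfl⟩ := hf
    exact hp z.1 z.2
  | zero => rfl
  | add f g _ _ hf hg => rw [LinearMap.add_apply, hf, hg, add_zero]
  | smul c f _ hf => rw [LinearMap.smul_apply, hf, smul_zero]

end ZeroLocus

/-! ### Completeness -/

section Completeness

variable {k n : ℕ}

theorem esymmPoint_eq_iff {y y' : {y : Fin k → Puiseux // IsBetheSolution n y}} :
    esymmPoint y.1 = esymmPoint y'.1 ↔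
      (Quotient.mk _ y : BetheOrbit k n) = Quotient.mk _ y' := by
  rw [Quotient.eq]
  constructor
  · exact fun h => exists_perm_of_qPoly_eq y'.2.1 y'.2.2.1 (qPoly_eq_of_esymmPoint_eq h)
  · rintro ⟨w, hw⟩
    rw [hw, esymmPoint_comp_perm]

theorem exists_esymmPoint_image (k : ℕ) (hn : 0 < n) :
    ∃ Z : Finset (Fin k → Puiseux),
      ((Z : Set (Fin k → Puiseux)) ⊆ esymmPoint ''
        {y : Fin k → Puiseux | IsBetheSolution n y ∧ ∀ i, conj (y i) = (y i)⁻¹}) ∧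
        Module.finrank Puiseux (MvPolynomial (Fin k) Puiseux ⧸ betheIdeal k n) ≤ Z.card ∧
        n.multichoose k ≤ Z.card := by
  classical
  obtain ⟨S, sol, hS, hsol, hconj, hperm⟩ := exists_solutions k n hn
  have hinj : Function.Injective fun Y => esymmPoint (sol Y) := fun Y Y' h => by
    obtain ⟨w, hw⟩ := exists_perm_of_qPoly_eq (hsol Y').1 (hsol Y').2.1
      (qPoly_eq_of_esymmPoint_eq h)
    exact hperm Y Y' w hw
  have hcard : (Finset.univ.image fun Y => esymmPoint (sol Y)).card = S.card := by
    rw [Finset.card_image_of_injective _ hinj, Finset.card_univ, Fintype.card_coe]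
  refine ⟨Finset.univ.image fun Y => esymmPoint (sol Y), ?_, ?_, ?_⟩
  · intro z hz
    obtain ⟨Y, -, rfl⟩ := Finset.mem_image.1 (Finset.mem_coe.1 hz)
    exact ⟨sol Y, ⟨hsol Y, hconj Y⟩, rfl⟩
  · rw [hcard]
    exact (betheIdeal_quotient k n hn).2.trans hS
  · rw [hcard]
    exact hS

/-- The two bounds meet here: the dimension is at most `n.multichoose k`, which is at most the
number of constructed points, which are zeros of the ideal. -/
theorem betheIdeal_zeroLocus (k : ℕ) (hn : 0 < n) :
    ∃ Z : Finset (Fin k → Puiseux),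
      ((Z : Set (Fin k → Puiseux)) ⊆ esymmPoint ''
        {y : Fin k → Puiseux | IsBetheSolution n y ∧ ∀ i, conj (y i) = (y i)⁻¹}) ∧
        Z.card = (alcove k n).card ∧
        MvPolynomial.zeroLocus Puiseux (betheIdeal k n) = Z ∧
        MvPolynomial.vanishingIdeal Puiseux
          (MvPolynomial.zeroLocus Puiseux (betheIdeal k n)) = betheIdeal k n ∧
        Module.finrank Puiseux (MvPolynomial (Fin k) Puiseux ⧸ betheIdeal k n) = Z.card := by
  obtain ⟨Z, hZ, h1, h2⟩ := exists_esymmPoint_image k hn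
  have := (betheIdeal_quotient k n hn).1
  have hZ' : ↑Z ⊆ MvPolynomial.zeroLocus Puiseux (betheIdeal k n) := fun z hz => by
    obtain ⟨y, hy, rfl⟩ := hZ hz
    exact esymmPoint_mem_zeroLocus hn hy.1
  obtain ⟨h3, h4, h5⟩ := zeroLocus_of_finrank_le hZ' h1
  refine ⟨Z, hZ, ?_, h3, h4, h5⟩
  rw [card_alcove]
  exact le_antisymm (h5 ▸ (betheIdeal_quotient k n hn).2) h2

theorem zeroLocus_betheIdeal_eq_image (k : ℕ) (hn : 0 < n) :
    MvPolynomial.zeroLocus Puiseux (betheIdeal k n) =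
      esymmPoint '' {y : Fin k → Puiseux | IsBetheSolution n y} := by
  obtain ⟨Z, hZ, -, h, -⟩ := betheIdeal_zeroLocus k hn
  refine Set.Subset.antisymm ?_ ?_
  · rw [h]
    exact hZ.trans (Set.image_mono fun y hy => hy.1)
  · rintro _ ⟨y, hy, rfl⟩
    exact esymmPoint_mem_zeroLocus hn hy

theorem isRadical_betheIdeal (k : ℕ) (hn : 0 < n) : (betheIdeal k n).IsRadical := by
  obtain ⟨Z, -, -, -, h, -⟩ := betheIdeal_zeroLocus k hn
  intro p hp
  rw [← h]
  exact MvPolynomial.radical_le_vanishingIdeal_zeroLocus _ hp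

/-- The Bethe roots lie on the unit circle. -/
theorem conj_betheSolution (hn : 0 < n) {y : Fin k → Puiseux} (hy : IsBetheSolution n y)
    (i : Fin k) : conj (y i) = (y i)⁻¹ := by
  obtain ⟨Z, hZ, -, h, -⟩ := betheIdeal_zeroLocus k hn
  have h1 := esymmPoint_mem_zeroLocus hn hy
  rw [h] at h1
  -- By the count, every zero comes from a constructed solution, so any solution is a permutation of
  -- one on the unit circle.
  obtain ⟨y', hy', he⟩ := hZ h1
  obtain ⟨w, rfl⟩ := exists_perm_of_qPoly_eq hy.1 hy.2.1 (qPoly_eq_of_esymmPoint_eq he)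
  exact hy'.2 (w i)

theorem exists_bijective_betheOrbit (k : ℕ) (hn : 0 < n) :
    ∃ y : ↥(alcove k n) → {y : Fin k → Puiseux // IsBetheSolution n y},
      Function.Bijective fun σ => (Quotient.mk _ (y σ) : BetheOrbit k n) := by
  obtain ⟨Z, -, hcard, h, -⟩ := betheIdeal_zeroLocus k hn
  have himage := zeroLocus_betheIdeal_eq_image k hn
  rw [h] at himage
  have hmem : ∀ z : Z, ∃ y : {y : Fin k → Puiseux // IsBetheSolution n y},
      esymmPoint y.1 = z := fun z => by
    obtain ⟨y, hy, he⟩ := himage.subset z.2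
    exact ⟨⟨y, hy⟩, he⟩
  choose f hf using hmem
  have e : ↥(alcove k n) ≃ Z := Fintype.equivOfCardEq (by
    rw [Fintype.card_coe, Fintype.card_coe, hcard])
  refine ⟨fun σ => f (e σ), fun σ σ' hσ => ?_, fun q => ?_⟩
  · have h1 := esymmPoint_eq_iff.2 hσ
    rw [hf, hf] at h1
    exact e.injective (Subtype.ext h1)
  · obtain ⟨y, rfl⟩ := Quotient.exists_rep q
    have hz : esymmPoint y.1 ∈ Z := by
      rw [← Finset.mem_coe, himage]
      exact ⟨y.1, y.2, rfl⟩
    refine ⟨e.symm ⟨_, hz⟩, esymmPoint_eq_iff.1 ?_⟩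
    beta_reduce
    rw [Equiv.apply_symm_apply, hf]

open Polynomial in
theorem tq_ne_of_orbit_ne (hn : 0 < n) {y y' : {y : Fin k → Puiseux // IsBetheSolution n y}}
    (h : (Quotient.mk _ y : BetheOrbit k n) ≠ Quotient.mk _ y') {L L' : Puiseux[X]}
    (hL : tqRhs tVar n k (qPoly y.1) = qPoly y.1 * L)
    (hL' : tqRhs tVar n k (qPoly y'.1) = qPoly y'.1 * L') : L ≠ L' := by
  rintro rfl
  exact h (Quotient.sound (exists_perm_of_qPoly_eq y'.2.1 y'.2.2.1
    (qPoly_eq_of_tq (fun r hr => one_sub_tVar_pow_ne_zero hr) hn hL hL')))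

theorem fockInner_eq_zero_of_orbit_ne (hn : 0 < n)
    {y y' : {y : Fin k → Puiseux // IsBetheSolution n y}}
    (h : (Quotient.mk _ y : BetheOrbit k n) ≠ Quotient.mk _ y') :
    fockInner (betheVector n y.1) (betheVector n y'.1) = 0 := by
  obtain ⟨L, hL⟩ := exists_tq y.2
  obtain ⟨L', hL'⟩ := exists_tq y'.2
  exact fockInner_betheVector_eq_zero y.2 y'.2 (conj_betheSolution hn y'.2) hL hL'
    (tq_ne_of_orbit_ne hn h hL hL')

/-- The eigenvalue polynomials are pairwise distinct, so a single `u`, a non-root of the product of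
their differences, separates all eigenvalues. The vectors are then eigenvectors of one operator for
distinct eigenvalues. -/
theorem linearIndependent_betheVector (hn : 0 < n) {ι : Type*} [Finite ι]
    {y : ι → {y : Fin k → Puiseux // IsBetheSolution n y}}
    (h : Function.Injective fun σ => (Quotient.mk _ (y σ) : BetheOrbit k n)) :
    LinearIndependent Puiseux fun σ => betheVector n (y σ).1 := by
  classical
  have := Fintype.ofFinite ι
  choose L hL using fun σ => exists_tq (y σ).2
  have hne : ∀ σ σ', σ ≠ σ' → L σ - L σ' ≠ 0 := fun σ σ' hσ =>
    sub_ne_zero.2 (tq_ne_of_orbit_ne hn (h.ne hσ) (hL σ) (hL σ'))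
  obtain ⟨u, hu⟩ := exists_nat_eval_ne_zero
    (p := ∏ p ∈ (Finset.univ : Finset ι).offDiag, (L p.1 - L p.2))
    (Finset.prod_ne_zero_iff.2 fun p hp => hne _ _ (Finset.mem_offDiag.1 hp).2.2)
  rw [Polynomial.eval_prod, Finset.prod_ne_zero_iff] at hu
  refine Module.End.eigenvectors_linearIndependent' (transferMatrix n (u : Puiseux))
    (fun σ => (L σ).eval (u : Puiseux)) (fun σ σ' hσ => ?_) _ fun σ =>
      ⟨Module.End.mem_eigenspace_iff.2 (bethe_eigen (y σ).2 (hL σ) _),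
        betheVector_ne_zero hn (y σ).2.1⟩
  by_contra hne'
  refine hu (σ, σ') (Finset.mem_offDiag.2 ⟨Finset.mem_univ _, Finset.mem_univ _, hne'⟩) ?_
  rw [Polynomial.eval_sub, sub_eq_zero]
  exact hσ

theorem betheVector_mem_fockSector (y : Fin k → Puiseux) : betheVector n y ∈ fockSector n k := by
  rw [betheVector_eq_sum]
  exact Submodule.sum_mem _ fun lam hl =>
    Submodule.smul_mem _ _ (Submodule.subset_span ⟨lam, hl, rfl⟩)

theorem span_betheVector (hn : 0 < n)
    {y : ↥(alcove k n) → {y : Fin k → Puiseux // IsBetheSolution n y}}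
    (h : Function.Injective fun σ => (Quotient.mk _ (y σ) : BetheOrbit k n)) :
    Submodule.span Puiseux (Set.range fun σ => betheVector n (y σ).1) = fockSector n k := by
  classical
  have hfin : Module.Finite Puiseux (fockSector n k) :=
    Module.Finite.span_of_finite Puiseux ((alcove k n).finite_toSet.image _)
  refine Submodule.eq_of_le_of_finrank_le (Submodule.span_le.2 ?_) ?_
  · rintro _ ⟨σ, rfl⟩
    exact betheVector_mem_fockSector _
  · rw [finrank_span_eq_card (linearIndependent_betheVector hn h), Fintype.card_coe, fockSector,
      ← Finset.coe_image]
    exact (finrank_span_finset_le_card _).trans Finset.card_image_le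

theorem hasEigenvector_betheVector (hn : 0 < n) {y : Fin k → Puiseux} (hy : IsBetheSolution n y)
    (u : Puiseux) :
    ∃ μ, Module.End.HasEigenvector (transferMatrix n u) μ (betheVector n y) := by
  obtain ⟨L, hL⟩ := exists_tq hy
  exact ⟨L.eval u, Module.End.mem_eigenspace_iff.2 (bethe_eigen hy hL u),
    betheVector_ne_zero hn hy.1⟩

end Completeness

end QBoson

end

/-! ### Assembly of the theorem -/

theorem mainTheorem3 (k n : ℕ) (hn : 0 < n) :
    -- (1) partitions in the alcove are in bijection with solutions up to permutation
    (∃ y : ↥(QBoson.alcove k n) →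
        {y : Fin k → QBoson.Puiseux // QBoson.IsBetheSolution n y},
      Function.Bijective fun σ => (Quotient.mk _ (y σ) : QBoson.BetheOrbit k n)) ∧
    -- the variety of solutions and its vanishing ideal
    MvPolynomial.zeroLocus QBoson.Puiseux (QBoson.betheIdeal k n) =
      QBoson.esymmPoint '' {y : Fin k → QBoson.Puiseux | QBoson.IsBetheSolution n y} ∧
    MvPolynomial.vanishingIdeal QBoson.Puiseux
        (MvPolynomial.zeroLocus QBoson.Puiseux (QBoson.betheIdeal k n)) =
      QBoson.betheIdeal k n ∧
    (QBoson.betheIdeal k n).IsRadical ∧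
    Module.Finite QBoson.Puiseux
      (MvPolynomial (Fin k) QBoson.Puiseux ⧸ QBoson.betheIdeal k n) ∧
    Module.finrank QBoson.Puiseux
      (MvPolynomial (Fin k) QBoson.Puiseux ⧸ QBoson.betheIdeal k n) =
        (QBoson.alcove k n).card ∧
    -- (2) for any such bijection, the Bethe vectors form an orthogonal eigenbasis
    ∀ y : ↥(QBoson.alcove k n) →
        {y : Fin k → QBoson.Puiseux // QBoson.IsBetheSolution n y},
      (Function.Bijective fun σ => (Quotient.mk _ (y σ) : QBoson.BetheOrbit k n)) →
      (∀ σ, QBoson.betheVector n (y σ).1 =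
        ∑ lam ∈ QBoson.alcove k n,
          QBoson.hallLittlewoodQ QBoson.tVar (fun i => ((y σ).1 i)⁻¹) lam •
            QBoson.ketPartition n lam) ∧
      LinearIndependent QBoson.Puiseux (fun σ => QBoson.betheVector n (y σ).1) ∧
      Submodule.span QBoson.Puiseux (Set.range fun σ => QBoson.betheVector n (y σ).1) =
        QBoson.fockSector n k ∧
      (∀ ρ σ, QBoson.fockInner (QBoson.betheVector n (y ρ).1) (QBoson.betheVector n (y σ).1) =
        ∑ lam ∈ QBoson.alcove k n,
          QBoson.hallLittlewoodQ QBoson.tVar (y ρ).1 lam *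
            QBoson.hallLittlewoodP QBoson.tVar (fun i => QBoson.conj ((y σ).1 i)) lam) ∧
      (∀ ρ σ, ρ ≠ σ →
        QBoson.fockInner (QBoson.betheVector n (y ρ).1) (QBoson.betheVector n (y σ).1) = 0) ∧
      (∀ σ (u : QBoson.Puiseux), ∃ μ : QBoson.Puiseux,
        Module.End.HasEigenvector (QBoson.transferMatrix n u) μ
          (QBoson.betheVector n (y σ).1)) ∧
      (∀ σ (u : QBoson.Puiseux), (∀ i, 1 - u * (y σ).1 i ≠ 0) →
        QBoson.transferMatrix n u (QBoson.betheVector n (y σ).1) =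
          (∏ i, (1 - u * (y σ).1 i * QBoson.tVar) / (1 - u * (y σ).1 i) +
            QBoson.tVar ^ k * u ^ n *
              ∏ i, (1 - u * QBoson.tVar⁻¹ * (y σ).1 i) / (1 - u * (y σ).1 i)) •
            QBoson.betheVector n (y σ).1) := by
  obtain ⟨Z, -, hcard, -, hvan, hrank⟩ := QBoson.betheIdeal_zeroLocus k hn
  refine ⟨QBoson.exists_bijective_betheOrbit k hn, QBoson.zeroLocus_betheIdeal_eq_image k hn, hvan,
    QBoson.isRadical_betheIdeal k hn, (QBoson.betheIdeal_quotient k n hn).1, hrank.trans hcard,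
    fun y hy => ⟨fun σ => QBoson.betheVector_eq_sum _,
      QBoson.linearIndependent_betheVector hn hy.1, QBoson.span_betheVector hn hy.1,
      fun ρ σ => QBoson.fockInner_betheVector (QBoson.conj_betheSolution hn (y ρ).2)
        (QBoson.conj_betheSolution hn (y σ).2),
      fun ρ σ hne => QBoson.fockInner_eq_zero_of_orbit_ne hn (hy.1.ne hne),
      fun σ u => QBoson.hasEigenvector_betheVector hn (y σ).2 u,
      fun σ u hu => QBoson.bethe_eigen_of_ne (y σ).2 hu⟩⟩
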